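/- Let $\mathcal C$ be a fusion category over $\mathbb C$: a $\mathbb C$-linear abelian semisimple rigid monoidal category with bilinear tensor product, finitely many isomorphism classes of simple objects, finite-dimensional morphism spaces and simple unit $\mathbf 1$. All functors between such categories below are $\mathbb C$-linear. Notation. - $U(\mathcal C)$ is the universal grading group of $\mathcal C$: the group generated by symbols $[S]$ for the simple objects $S$, with relations $[S][T]=[R]$ whenever the simple object $R$ is a constituent of $S\otimes T$; write $\deg S\in U(\mathcal C)$ for the class of $S$. - $\mathrm{Inv}(\mathcal D)$ is the group of isomorphism classes of $\otimes$-invertible objects of a monoidal category $\mathcal D$, and $Z(\mathcal C)$ is the Drinfeld center, whose objects are pairs of an object of $\mathcal C$ and a half-braiding. - $\mathrm{Eq}(\mathcal C)$ is the group, under composition, of $\mathbb C$-linear tensor autoequivalences of $\mathcal C$ up to monoidal natural isomorphism. - $\pi_1\mathrm{BrPic}(\mathcal C)$ is the group, under composition, of $\mathcal C$-$\mathcal C$-bimodule autoequivalences of the regular bimodule category ${}_{\mathcal C}\mathcal C_{\mathcal C}$ (the unit object of $\mathrm{BrPic}(\mathcal C)$) up to bimodule natural isomorphism. - $\mathrm{Out}(\mathcal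 C)$ is the set of equivalence classes of those invertible finite semisimple $\mathcal C$-$\mathcal C$-bimodule categories that are equivalent to $\mathcal C$ as left $\mathcal C$-module categories, with the multiplication induced by the relative tensor product $\boxtimes_{\mathcal C}$. Claim. $\mathrm{Out}(\mathcal C)$ is a group, the five maps below are well-defined group homomorphisms, and the first is an isomorphism. 1. $e:\pi_1\mathrm{BrPic}(\mathcal C)\to\mathrm{Inv}(Z(\mathcal C))$ sends $\varphi$ to the object $\varphi(\mathbf 1)$ with the half-braiding $\varphi(\mathbf 1)\otimes Y\cong\varphi(\mathbf 1\otimes Y)\cong\varphi(Y\otimes\mathbf 1)\cong Y\otimes\varphi(\mathbf 1)$ given by the bimodule structure of $\varphi$. 2. $\iota:\mathrm{Hom}(U(\mathcal C),\mathbb C^\times)\to\pi_1\mathrm{BrPic}(\mathcal C)$ is such that $e(\iota(\chi))$ is the class of the object $\mathbf 1$ with the half-braiding that on a simple object $S$ is $\chi(\deg S)$ times the canonical isomorphism $\mathbf 1\otimes S\cong S\otimes\mathbf 1$. 3. $\delta:\pi_1\mathrm{BrPic}(\mathcal C)\to\mathrm{Inv}(\mathcal C)$ is the composite of $e$ with the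 map $\mathrm{Inv}(Z(\mathcal C))\to\mathrm{Inv}(\mathcal C)$ that forgets the half-braiding. 4. $F_-:\mathrm{Inv}(\mathcal C)\to\mathrm{Eq}(\mathcal C)$ sends $g$ to the inner autoequivalence $F_g(X)=g\otimes X\otimes g^*$. 5. $M_-:\mathrm{Eq}(\mathcal C)\to\mathrm{Out}(\mathcal C)$ sends $F$ to $M_F$, the category $\mathcal C$ with left action by $\otimes$ and right action twisted by $F$, i.e. $x\cdot m\cdot y=x\otimes m\otimes F(y)$. Moreover the sequence of groups $$1\to\mathrm{Hom}(U(\mathcal C),\mathbb C^\times)\xrightarrow{\ \iota\ }\pi_1\mathrm{BrPic}(\mathcal C)\xrightarrow{\ \delta\ }\mathrm{Inv}(\mathcal C)\xrightarrow{\ F_-\ }\mathrm{Eq}(\mathcal C)\xrightarrow{\ M_-\ }\mathrm{Out}(\mathcal C)\to1$$ is exact. -/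

import Mathlib

open CategoryTheory CategoryTheory.Limits CategoryTheory.MonoidalCategory
open scoped CategoryTheory.MonoidalCategory.MonoidalLeftAction
open scoped CategoryTheory.MonoidalCategory.MonoidalRightAction
open CategoryTheory.Functor.LaxLeftLinear CategoryTheory.Functor.OplaxLeftLinear
open CategoryTheory.Functor.LaxRightLinear CategoryTheory.Functor.OplaxRightLinear

universe v u

namespace FusionLES

noncomputable section

/-! ## Fusion categories -/

attribute [local instance] Abelian.hasFiniteBiproducts

/-- Finite semisimple `ℂ`-linear abelian categories. -/
class IsFiniteSemisimple (D : Type u) [Category.{v} D] [Abelian D] [Linear ℂ D] : Prop where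
  finite_hom : ∀ X Y : D, FiniteDimensional ℂ (X ⟶ Y)
  semisimple : ∀ X : D, ∃ (n : ℕ) (S : Fin n → D), (∀ i, Simple (S i)) ∧ Nonempty (X ≅ ⨁ S)
  finite_simples : ∃ (n : ℕ) (S : Fin n → D), ∀ X : D, Simple X → ∃ i, Nonempty (X ≅ S i)

/-- Fusion categories over `ℂ`: finite semisimple `ℂ`-linear rigid monoidal categories (with
bilinear tensor product) whose unit object is simple. -/
class IsFusion (C : Type u) [Category.{v} C] [Abelian C] [Linear ℂ C] [MonoidalCategory C]
    [MonoidalPreadditive C] [MonoidalLinear ℂ C] [RigidCategory C] : Prop extends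
    IsFiniteSemisimple C where
  simple_unit : Simple (𝟙_ C)

/-! ## The universal grading group -/

section Grading

variable (C : Type u) [Category.{v} C] [Abelian C] [MonoidalCategory C]

/-- The relations `[X] [Y] = [Z]`, for `X`, `Y`, `Z` simple and `Z` a constituent of `X ⊗ Y`. -/
def gradingRels : Set (FreeGroup {X : C // Simple X}) :=
  {r | ∃ (X Y Z : {X : C // Simple X}) (f : Z.1 ⟶ X.1 ⊗ Y.1), f ≠ 0 ∧
    r = FreeGroup.of X * FreeGroup.of Y * (FreeGroup.of Z)⁻¹}

/-- The universal grading group `U(C)`: the group generated by the simple objects with the relations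
`[X] [Y] = [Z]` whenever `Z` is a constituent of `X ⊗ Y`. -/
abbrev UniversalGradingGroup : Type u := PresentedGroup (gradingRels C)

variable {C}

/-- The degree of a simple object in the universal grading. -/
def univDeg (X : C) [hX : Simple X] : UniversalGradingGroup C := PresentedGroup.of ⟨X, hX⟩

/-- A grading of `C` by a group `G`: an assignment of degrees to the simple objects that is
compatible with the tensor product. -/
def IsGrading {G : Type*} [Group G] (d : {X : C // Simple X} → G) : Prop :=
  ∀ (X Y Z : {X : C // Simple X}) (f : Z.1 ⟶ X.1 ⊗ Y.1), f ≠ 0 → d Z = d X * d Y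

/-- The degree function of `U(C)` is a grading, and every grading factors uniquely through it. -/
theorem univDeg_universal {G : Type*} [Group G] (d : {X : C // Simple X} → G) :
    IsGrading d ↔ ∃! φ : UniversalGradingGroup C →* G, ∀ X, φ (PresentedGroup.of X) = d X := by
  constructor
  · intro hd
    have h : ∀ r ∈ gradingRels C, FreeGroup.lift d r = 1 := by
      rintro r ⟨X, Y, Z, f, hf, rfl⟩
      simp [hd X Y Z f hf]
    refine ⟨PresentedGroup.toGroup h, fun X => PresentedGroup.toGroup.of h, ?_⟩
    intro ψ hψ
    exact PresentedGroup.ext fun X => by rw [hψ X, PresentedGroup.toGroup.of h]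
  · rintro ⟨φ, hφ, -⟩ X Y Z f hf
    rw [← hφ, ← hφ, ← hφ, ← map_mul]
    congr 1
    have h : (PresentedGroup.mk (gradingRels C)
        (FreeGroup.of X * FreeGroup.of Y * (FreeGroup.of Z)⁻¹)) = 1 :=
      PresentedGroup.one_of_mem ⟨X, Y, Z, f, hf, rfl⟩
    rw [map_mul, map_inv, mul_inv_eq_one, map_mul] at h
    exact h.symm

end Grading

/-! ## Invertible objects -/

section Inv

variable (C : Type u) [Category.{v} C] [MonoidalCategory C]

/-- The group of isomorphism classes of (tensor-)invertible objects. -/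
abbrev InvGroup : Type u := (Skeleton C)ˣ

/-- The homomorphism `Inv(Z(C)) → Inv(C)` forgetting the half-braiding. -/
def forgetInv : InvGroup (Center C) →* InvGroup C :=
  Units.map (Skeleton.monoidHom (Center.forget C))

variable {C}

theorem isEquivalence_tensorLeft {g h : C} (i : g ⊗ h ≅ 𝟙_ C) (j : h ⊗ g ≅ 𝟙_ C) :
    (tensorLeft g).IsEquivalence := by
  let E : C ≌ C := CategoryTheory.Equivalence.mk (tensorLeft g) (tensorLeft h)
    (NatIso.ofComponents (fun X => (λ_ X).symm ≪≫ whiskerRightIso j.symm X ≪≫ α_ h g X)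
      (fun f => by
        dsimp [whiskerRightIso]
        rw [leftUnitor_inv_naturality_assoc, whisker_exchange_assoc]
        simp))
    (NatIso.ofComponents (fun X => (α_ g h X).symm ≪≫ whiskerRightIso i X ≪≫ λ_ X)
      (fun f => by
        dsimp [whiskerRightIso]
        rw [Category.assoc, Category.assoc, ← leftUnitor_naturality, ← whisker_exchange_assoc]
        simp))
  exact E.isEquivalence_functor

theorem isEquivalence_tensorRight {g h : C} (i : g ⊗ h ≅ 𝟙_ C) (j : h ⊗ g ≅ 𝟙_ C) :
    (tensorRight h).IsEquivalence := by
  let E : C ≌ C := CategoryTheory.Equivalence.mk (tensorRight h) (tensorRight g)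
    (NatIso.ofComponents (fun X => (ρ_ X).symm ≪≫ whiskerLeftIso X j.symm ≪≫ (α_ X h g).symm)
      (fun f => by
        dsimp [whiskerLeftIso]
        rw [rightUnitor_inv_naturality_assoc, ← whisker_exchange_assoc]
        simp))
    (NatIso.ofComponents (fun X => α_ X g h ≪≫ whiskerLeftIso X i ≪≫ ρ_ X)
      (fun f => by
        dsimp [whiskerLeftIso]
        rw [Category.assoc, Category.assoc, ← rightUnitor_naturality, whisker_exchange_assoc]
        simp))
  exact E.isEquivalence_functor

variable [RigidCategory C]

/-- An object `g` is invertible if evaluation `g* ⊗ g ⟶ 𝟙` and coevaluation `𝟙 ⟶ g ⊗ g*` are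
isomorphisms. -/
structure IsInvertibleObj (g : C) : Prop where
  ev : IsIso (ε_ g gᘁ)
  coev : IsIso (η_ g gᘁ)

/-- The class in `Inv(C)` of an invertible object. -/
def InvGroup.mk (g : C) (hg : IsInvertibleObj g) : InvGroup C where
  val := toSkeleton g
  inv := toSkeleton gᘁ
  val_inv := by
    have := hg.coev
    rw [← Skeleton.toSkeleton_tensorObj]
    exact Quotient.sound ⟨(asIso (η_ g gᘁ)).symm⟩
  inv_val := by
    have := hg.ev
    rw [← Skeleton.toSkeleton_tensorObj]
    exact Quotient.sound ⟨asIso (ε_ g gᘁ)⟩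

theorem InvGroup.mk_surjective (x : InvGroup C) : ∃ (g : C) (hg : IsInvertibleObj g),
    InvGroup.mk g hg = x := by
  obtain ⟨g, hg⟩ : ∃ g : C, toSkeleton g = x.val := Quotient.exists_rep x.val
  obtain ⟨h, hh⟩ : ∃ h : C, toSkeleton h = x.inv := Quotient.exists_rep x.inv
  have h1 : Nonempty (g ⊗ h ≅ 𝟙_ C) := by
    have := x.val_inv
    rw [← hg, ← hh, ← Skeleton.toSkeleton_tensorObj] at this
    exact Quotient.exact this
  have h2 : Nonempty (h ⊗ g ≅ 𝟙_ C) := by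
    have := x.inv_val
    rw [← hg, ← hh, ← Skeleton.toSkeleton_tensorObj] at this
    exact Quotient.exact this
  obtain ⟨i⟩ := h1
  obtain ⟨j⟩ := h2
  have := isEquivalence_tensorLeft i j
  let adj := tensorLeftAdjunction g gᘁ
  have : (tensorLeft gᘁ).IsEquivalence := adj.isEquivalence_left_of_isEquivalence_right
  have e1 : IsIso (adj.unit.app (𝟙_ C)) := inferInstance
  have e2 : IsIso (adj.counit.app (𝟙_ C)) := inferInstance
  have f1 : adj.unit.app (𝟙_ C) = η_ g gᘁ ≫ g ◁ (ρ_ _).inv := by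
    simp [adj, tensorLeftAdjunction, tensorLeftHomEquiv, unitors_inv_equal]
  have f2 : adj.counit.app (𝟙_ C) = gᘁ ◁ (ρ_ _).hom ≫ ε_ g gᘁ := by
    simp [adj, tensorLeftAdjunction, tensorLeftHomEquiv, unitors_equal]
  refine ⟨g, ⟨?_, ?_⟩, Units.ext hg⟩
  · rw [f2] at e2
    exact (isIso_comp_left_iff _ _).1 e2
  · rw [f1] at e1
    exact (isIso_comp_right_iff _ _).1 e1

end Inv
/-! ## Tensor autoequivalences -/

section Eq

variable (C : Type u) [Category.{v} C] [Abelian C] [Linear ℂ C] [MonoidalCategory C]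

/-- Tensor autoequivalences of `C`: `ℂ`-linear strong monoidal functors `C ⥤ C` which are
equivalences of categories. -/
structure TensorAut where
  /-- the underlying functor -/
  toFunctor : C ⥤ C
  [monoidal : toFunctor.Monoidal]
  [additive : toFunctor.Additive]
  [linear : toFunctor.Linear ℂ]
  [isEquivalence : toFunctor.IsEquivalence]

attribute [instance] TensorAut.monoidal TensorAut.additive TensorAut.linear
  TensorAut.isEquivalence

variable {C}

/-- Tensor autoequivalences are identified when there is a monoidal natural isomorphism. -/
def TensorAut.Iso (F G : TensorAut C) : Prop :=
  ∃ e : F.toFunctor ≅ G.toFunctor, NatTrans.IsMonoidal e.hom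

variable (C) in
instance TensorAut.setoid : Setoid (TensorAut C) where
  r := TensorAut.Iso
  iseqv :=
    { refl := fun F => ⟨Iso.refl _, inferInstanceAs (NatTrans.IsMonoidal (𝟙 F.toFunctor))⟩
      symm := fun ⟨e, _⟩ => ⟨e.symm, inferInstanceAs (NatTrans.IsMonoidal e.inv)⟩
      trans := fun ⟨e, _⟩ ⟨e', _⟩ =>
        ⟨e ≪≫ e', inferInstanceAs (NatTrans.IsMonoidal (e.hom ≫ e'.hom))⟩ }

/-- The identity autoequivalence. -/
def TensorAut.id : TensorAut C := { toFunctor := 𝟭 C }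

/-- The composite `F ∘ G`. -/
def TensorAut.comp (F G : TensorAut C) : TensorAut C := { toFunctor := G.toFunctor ⋙ F.toFunctor }

/-- The inverse autoequivalence. -/
def TensorAut.inverse (F : TensorAut C) : TensorAut C :=
  letI : F.toFunctor.asEquivalence.functor.Monoidal := F.monoidal
  letI := F.toFunctor.asEquivalence.inverseMonoidal
  haveI : F.toFunctor.asEquivalence.functor.Additive := F.additive
  haveI : F.toFunctor.asEquivalence.functor.Linear ℂ := F.linear
  { toFunctor := F.toFunctor.asEquivalence.inverse }

variable (C) in
/-- The group `Eq(C)` of isomorphism classes of tensor autoequivalences of `C`. -/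
def EqGroup : Type (max u v) := Quotient (TensorAut.setoid C)

/-- The class in `Eq(C)` of a tensor autoequivalence. -/
def EqGroup.mk (F : TensorAut C) : EqGroup C := Quotient.mk _ F

theorem TensorAut.iso_comp {F F' G G' : TensorAut C} (h : F.Iso F') (h' : G.Iso G') :
    (F.comp G).Iso (F'.comp G') := by
  obtain ⟨e, he⟩ := h
  obtain ⟨e', he'⟩ := h'
  exact ⟨NatIso.hcomp e' e, inferInstanceAs (NatTrans.IsMonoidal (e'.hom ◫ e.hom))⟩

theorem TensorAut.inverse_comp (F : TensorAut C) : (F.inverse.comp F).Iso TensorAut.id := by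
  let E := F.toFunctor.asEquivalence
  let i1 : E.functor.Monoidal := F.monoidal
  let i2 : E.inverse.Monoidal := E.inverseMonoidal
  have i3 : E.IsMonoidal :=
    letI := E.toAdjunction.rightAdjointLaxMonoidal
    show E.toAdjunction.IsMonoidal from
      { leftAdjoint_ε := rfl, leftAdjoint_μ := fun _ _ => rfl }
  have i4 : NatTrans.IsMonoidal E.unitIso.hom := inferInstanceAs (NatTrans.IsMonoidal E.unit)
  exact ⟨E.unitIso.symm, inferInstanceAs (NatTrans.IsMonoidal E.unitIso.inv)⟩

instance : Group (EqGroup C) where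
  mul := Quotient.map₂ TensorAut.comp fun _ _ h _ _ h' => TensorAut.iso_comp h h'
  one := EqGroup.mk TensorAut.id
  inv := fun x => EqGroup.mk (Quotient.out x).inverse
  mul_assoc := by
    rintro ⟨F⟩ ⟨G⟩ ⟨H⟩
    exact Quotient.sound ⟨Functor.associator _ _ _ |>.symm, inferInstanceAs (NatTrans.IsMonoidal
      (Functor.associator H.toFunctor G.toFunctor F.toFunctor).inv)⟩
  one_mul := by
    rintro ⟨F⟩
    exact Quotient.sound ⟨F.toFunctor.rightUnitor,
      inferInstanceAs (NatTrans.IsMonoidal F.toFunctor.rightUnitor.hom)⟩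
  mul_one := by
    rintro ⟨F⟩
    exact Quotient.sound ⟨F.toFunctor.leftUnitor,
      inferInstanceAs (NatTrans.IsMonoidal F.toFunctor.leftUnitor.hom)⟩
  inv_mul_cancel := by
    intro x
    have h : x = EqGroup.mk (Quotient.out x) := (Quotient.out_eq x).symm
    conv_lhs => rhs; rw [h]
    exact Quotient.sound (Quotient.out x).inverse_comp

end Eq

/-! ## Inner autoequivalences -/

section Inner

variable {C : Type u} [Category.{v} C] [MonoidalCategory C] [RigidCategory C]

/-- The morphism `((g ⊗ X) ⊗ g*) ⊗ ((g ⊗ Y) ⊗ g*) ⟶ (g ⊗ (X ⊗ Y)) ⊗ g*` induced by evaluation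
`g* ⊗ g ⟶ 𝟙`. -/
def conjμ (g : C) (hg : IsInvertibleObj g) (X Y : C) :
    ((g ⊗ X) ⊗ gᘁ) ⊗ ((g ⊗ Y) ⊗ gᘁ) ≅ (g ⊗ (X ⊗ Y)) ⊗ gᘁ :=
  haveI := hg.ev
  α_ (g ⊗ X) gᘁ ((g ⊗ Y) ⊗ gᘁ) ≪≫ whiskerLeftIso (g ⊗ X)
    ((α_ gᘁ (g ⊗ Y) gᘁ).symm ≪≫ whiskerRightIso ((α_ gᘁ g Y).symm ≪≫
      whiskerRightIso (asIso (ε_ g gᘁ)) Y ≪≫ λ_ Y) gᘁ) ≪≫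
    (α_ (g ⊗ X) Y gᘁ).symm ≪≫ whiskerRightIso (α_ g X Y) gᘁ

theorem conjμ_hom (g : C) (hg : IsInvertibleObj g) (X Y : C) :
    (conjμ g hg X Y).hom = 𝟙 _ ⊗≫ (g ⊗ X) ◁ (ε_ g gᘁ) ▷ (Y ⊗ gᘁ) ⊗≫ 𝟙 _ := by
  dsimp [conjμ, whiskerRightIso, whiskerLeftIso]
  monoidal

/-- The tensor structure of `X ↦ (g ⊗ X) ⊗ g*`, induced by coevaluation `𝟙 ⟶ g ⊗ g*` and evaluation
`g* ⊗ g ⟶ 𝟙`. -/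
def conjCore (g : C) (hg : IsInvertibleObj g) :
    (tensorLeft g ⋙ tensorRight gᘁ).CoreMonoidal :=
  haveI := hg.coev
  { εIso := asIso (η_ g gᘁ) ≪≫ whiskerRightIso (ρ_ g).symm gᘁ
    μIso := fun X Y => conjμ g hg X Y
    μIso_hom_natural_left := by
      intro X Y f Z
      dsimp
      rw [conjμ_hom, conjμ_hom]
      calc
        _ = 𝟙 _ ⊗≫ (((g ◁ f) ▷ (gᘁ ⊗ g)) ≫ (g ⊗ Y) ◁ ε_ g gᘁ) ▷ (Z ⊗ gᘁ) ⊗≫ 𝟙 _ := by monoidal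
        _ = _ := by rw [← whisker_exchange]; monoidal
    μIso_hom_natural_right := by
      intro X Y Z f
      dsimp
      rw [conjμ_hom, conjμ_hom]
      calc
        _ = 𝟙 _ ⊗≫ (g ⊗ Z) ◁ (((gᘁ ⊗ g) ◁ (f ▷ gᘁ)) ≫ ε_ g gᘁ ▷ (Y ⊗ gᘁ)) ⊗≫ 𝟙 _ := by monoidal
        _ = _ := by rw [whisker_exchange]; monoidal
    associativity := by
      intro X Y Z
      dsimp
      rw [conjμ_hom, conjμ_hom, conjμ_hom, conjμ_hom]
      calc
        _ = 𝟙 _ ⊗≫ (g ⊗ X) ◁ (ε_ g gᘁ ▷ (Y ⊗ (gᘁ ⊗ g) ⊗ Z ⊗ gᘁ) ≫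
              (𝟙_ C) ◁ (Y ◁ (ε_ g gᘁ ▷ (Z ⊗ gᘁ)))) ⊗≫ 𝟙 _ := by monoidal
        _ = _ := by rw [← whisker_exchange]; monoidal
    left_unitality := by
      intro X
      dsimp [whiskerRightIso]
      rw [conjμ_hom]
      calc
        _ = 𝟙 _ ⊗≫ ((λ_ g).hom ≫ (ρ_ g).inv) ▷ (X ⊗ gᘁ) ⊗≫ 𝟙 _ := by monoidal
        _ = _ := by
          rw [← ExactPairing.evaluation_coevaluation g gᘁ]
          monoidal
    right_unitality := by
      intro X
      dsimp [whiskerRightIso]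
      rw [conjμ_hom]
      calc
        _ = 𝟙 _ ⊗≫ (g ⊗ X) ◁ ((ρ_ gᘁ).hom ≫ (λ_ gᘁ).inv) ⊗≫ 𝟙 _ := by monoidal
        _ = _ := by
          rw [← ExactPairing.coevaluation_evaluation g gᘁ]
          monoidal }

theorem conj_isEquivalence (g : C) (hg : IsInvertibleObj g) :
    (tensorLeft g ⋙ tensorRight gᘁ).IsEquivalence := by
  have := hg.ev
  have := hg.coev
  have h1 := isEquivalence_tensorLeft (asIso (η_ g gᘁ)).symm (asIso (ε_ g gᘁ))
  have h2 := isEquivalence_tensorRight (asIso (η_ g gᘁ)).symm (asIso (ε_ g gᘁ))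
  infer_instance

/-- The inner autoequivalence `F_g : X ↦ (g ⊗ X) ⊗ g*`. -/
def innerAut [Abelian C] [Linear ℂ C] [MonoidalPreadditive C] [MonoidalLinear ℂ C]
    (g : C) (hg : IsInvertibleObj g) : TensorAut C :=
  letI := (conjCore g hg).toMonoidal
  haveI := conj_isEquivalence g hg
  { toFunctor := tensorLeft g ⋙ tensorRight gᘁ }

end Inner

/-! ## Bimodule categories -/

/-- A finite semisimple `C`-`C`-bimodule category: a finite semisimple `ℂ`-linear category with a
bilinear left action and a bilinear right action of `C`, and a natural isomorphism
`(x ⊙ₗ m) ⊙ᵣ y ≅ x ⊙ₗ (m ⊙ᵣ y)` coherent with both actions. -/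
structure Bimod (C : Type u) [Category.{v} C] [Abelian C] [Linear ℂ C] [MonoidalCategory C] where
  /-- the underlying category -/
  carrier : Type u
  [category : Category.{v} carrier]
  [abelian : Abelian carrier]
  [linear : Linear ℂ carrier]
  [semisimple : IsFiniteSemisimple carrier]
  /-- the left action -/
  [left : MonoidalLeftAction C carrier]
  /-- the right action -/
  [right : MonoidalRightAction C carrier]
  left_additive_left : ∀ (x y : C) (f g : x ⟶ y) (m : carrier), (f + g) ⊵ₗ m = f ⊵ₗ m + g ⊵ₗ m
  left_linear_left : ∀ (x y : C) (r : ℂ) (f : x ⟶ y) (m : carrier), (r • f) ⊵ₗ m = r • (f ⊵ₗ m)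
  left_additive_right : ∀ (x : C) (m n : carrier) (f g : m ⟶ n), x ⊴ₗ (f + g) = x ⊴ₗ f + x ⊴ₗ g
  left_linear_right : ∀ (x : C) (m n : carrier) (r : ℂ) (f : m ⟶ n), x ⊴ₗ (r • f) = r • (x ⊴ₗ f)
  right_additive_right : ∀ (m : carrier) (x y : C) (f g : x ⟶ y), m ⊴ᵣ (f + g) = m ⊴ᵣ f + m ⊴ᵣ g
  right_linear_right : ∀ (m : carrier) (x y : C) (r : ℂ) (f : x ⟶ y), m ⊴ᵣ (r • f) = r • (m ⊴ᵣ f)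
  right_additive_left : ∀ (m n : carrier) (f g : m ⟶ n) (x : C), (f + g) ⊵ᵣ x = f ⊵ᵣ x + g ⊵ᵣ x
  right_linear_left : ∀ (m n : carrier) (r : ℂ) (f : m ⟶ n) (x : C), (r • f) ⊵ᵣ x = r • (f ⊵ᵣ x)
  /-- the middle associativity isomorphism -/
  mid : ∀ (x : C) (m : carrier) (y : C), (x ⊙ₗ m) ⊙ᵣ y ≅ x ⊙ₗ (m ⊙ᵣ y)
  mid_naturality_left : ∀ {x x' : C} (f : x ⟶ x') (m : carrier) (y : C),
    (f ⊵ₗ m) ⊵ᵣ y ≫ (mid x' m y).hom = (mid x m y).hom ≫ f ⊵ₗ (m ⊙ᵣ y)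
  mid_naturality_middle : ∀ (x : C) {m m' : carrier} (f : m ⟶ m') (y : C),
    (x ⊴ₗ f) ⊵ᵣ y ≫ (mid x m' y).hom = (mid x m y).hom ≫ x ⊴ₗ (f ⊵ᵣ y)
  mid_naturality_right : ∀ (x : C) (m : carrier) {y y' : C} (f : y ⟶ y'),
    (x ⊙ₗ m) ⊴ᵣ f ≫ (mid x m y').hom = (mid x m y).hom ≫ x ⊴ₗ (m ⊴ᵣ f)
  mid_assoc_left : ∀ (x x' : C) (m : carrier) (y : C),
    (αₗ x x' m).hom ⊵ᵣ y ≫ (mid x (x' ⊙ₗ m) y).hom ≫ x ⊴ₗ (mid x' m y).hom =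
      (mid (x ⊗ x') m y).hom ≫ (αₗ x x' (m ⊙ᵣ y)).hom
  mid_assoc_right : ∀ (x : C) (m : carrier) (y y' : C),
    (αᵣ (x ⊙ₗ m) y y').hom ≫ (mid x m y).hom ⊵ᵣ y' ≫ (mid x (m ⊙ᵣ y) y').hom =
      (mid x m (y ⊗ y')).hom ≫ x ⊴ₗ (αᵣ m y y').hom
  mid_unit_left : ∀ (m : carrier) (y : C),
    (mid (𝟙_ C) m y).hom ≫ (λₗ (m ⊙ᵣ y)).hom = (λₗ m).hom ⊵ᵣ y
  mid_unit_right : ∀ (x : C) (m : carrier),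
    (mid x m (𝟙_ C)).hom ≫ x ⊴ₗ (ρᵣ m).hom = (ρᵣ (x ⊙ₗ m)).hom

section Bimod

variable {C : Type u} [Category.{v} C] [Abelian C] [Linear ℂ C] [MonoidalCategory C]

instance : CoeSort (Bimod C) (Type u) := ⟨Bimod.carrier⟩

attribute [instance] Bimod.category Bimod.abelian Bimod.linear Bimod.semisimple Bimod.left
  Bimod.right

/-- `C`-`C`-bimodule functors: `ℂ`-linear functors with compatible left and right `C`-module
functor structures. -/
structure BimodFunctor (M N : Bimod C) where
  /-- the underlying functor -/
  toFunctor : M ⥤ N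
  [additive : toFunctor.Additive]
  [linear : toFunctor.Linear ℂ]
  [left : toFunctor.LeftLinear C]
  [right : toFunctor.RightLinear C]
  mid_comm : ∀ (x : C) (m : M) (y : C),
    (N.mid x (toFunctor.obj m) y).hom ≫ x ⊴ₗ μᵣ toFunctor m y ≫ μₗ toFunctor x (m ⊙ᵣ y) =
      (μₗ toFunctor x m) ⊵ᵣ y ≫ μᵣ toFunctor (x ⊙ₗ m) y ≫ toFunctor.map (M.mid x m y).hom

attribute [instance] BimodFunctor.additive BimodFunctor.linear BimodFunctor.left BimodFunctor.right

/-- Two bimodule functors are isomorphic if there is a natural isomorphism compatible with the left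
and right module functor structures. -/
def BimodFunctor.Iso {M N : Bimod C} (F G : BimodFunctor M N) : Prop :=
  ∃ e : F.toFunctor ≅ G.toFunctor,
    (∀ (x : C) (m : M), μₗ F.toFunctor x m ≫ e.hom.app (x ⊙ₗ m) =
      x ⊴ₗ e.hom.app m ≫ μₗ G.toFunctor x m) ∧
    (∀ (m : M) (y : C), μᵣ F.toFunctor m y ≫ e.hom.app (m ⊙ᵣ y) =
      e.hom.app m ⊵ᵣ y ≫ μᵣ G.toFunctor m y)

theorem BimodFunctor.Iso.refl {M N : Bimod C} (F : BimodFunctor M N) : F.Iso F :=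
  ⟨CategoryTheory.Iso.refl _, by simp, by simp⟩

theorem BimodFunctor.Iso.symm {M N : Bimod C} {F G : BimodFunctor M N} (h : F.Iso G) :
    G.Iso F := by
  obtain ⟨e, h1, h2⟩ := h
  refine ⟨e.symm, fun x m => ?_, fun m y => ?_⟩
  · rw [← cancel_mono (e.hom.app (x ⊙ₗ m)), Category.assoc, Category.assoc, h1,
      ← MonoidalLeftAction.actionHomRight_comp_assoc]
    simp
  · rw [← cancel_mono (e.hom.app (m ⊙ᵣ y)), Category.assoc, Category.assoc, h2,
      ← MonoidalRightAction.comp_actionHomLeft_assoc]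
    simp

theorem BimodFunctor.Iso.trans {M N : Bimod C} {F G H : BimodFunctor M N} (h : F.Iso G)
    (h' : G.Iso H) : F.Iso H := by
  obtain ⟨e, h1, h2⟩ := h
  obtain ⟨e', h1', h2'⟩ := h'
  refine ⟨e ≪≫ e', fun x m => ?_, fun m y => ?_⟩
  · simp [reassoc_of% h1, h1']
  · simp [reassoc_of% h2, h2']

/-- Left module functors from lax ones with invertible structure morphisms. -/
abbrev leftLinearOfIsIso {D D' : Type*} [Category* D] [Category* D'] [MonoidalLeftAction C D]
    [MonoidalLeftAction C D'] (F : D ⥤ D') [F.LaxLeftLinear C]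
    (h : ∀ (x : C) d, IsIso (μₗ F x d)) : F.LeftLinear C where
  δₗ x d := inv (μₗ F x d)
  δₗ_naturality_left f d := by
    rw [IsIso.comp_inv_eq, Category.assoc, IsIso.eq_inv_comp, μₗ_naturality_left]
  δₗ_naturality_right x _ _ f := by
    rw [IsIso.comp_inv_eq, Category.assoc, IsIso.eq_inv_comp, μₗ_naturality_right]
  δₗ_associativity x y d := by
    rw [IsIso.inv_comp_eq, μₗ_associativity_assoc]
    simp
  δₗ_unitality_inv d := by simp
  μₗ_comp_δₗ := by simp
  δₗ_comp_μₗ := by simp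

/-- Right module functors from lax ones with invertible structure morphisms. -/
abbrev rightLinearOfIsIso {D D' : Type*} [Category* D] [Category* D'] [MonoidalRightAction C D]
    [MonoidalRightAction C D'] (F : D ⥤ D') [F.LaxRightLinear C]
    (h : ∀ d (x : C), IsIso (μᵣ F d x)) : F.RightLinear C where
  δᵣ d x := inv (μᵣ F d x)
  δᵣ_naturality_left f d := by
    rw [IsIso.comp_inv_eq, Category.assoc, IsIso.eq_inv_comp, μᵣ_naturality_left]
  δᵣ_naturality_right x _ _ f := by
    rw [IsIso.comp_inv_eq, Category.assoc, IsIso.eq_inv_comp, μᵣ_naturality_right]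
  δᵣ_associativity d x y := by
    rw [IsIso.inv_comp_eq, μᵣ_associativity_assoc]
    simp
  δᵣ_unitality_inv d := by simp
  μᵣ_comp_δᵣ := by simp
  δᵣ_comp_μᵣ := by simp

/-- The identity bimodule functor. -/
def BimodFunctor.id (M : Bimod C) : BimodFunctor M M :=
  letI l : (𝟭 M : M ⥤ M).LaxLeftLinear C := { μₗ := fun x m => 𝟙 (x ⊙ₗ m) }
  letI r : (𝟭 M : M ⥤ M).LaxRightLinear C := { μᵣ := fun m x => 𝟙 (m ⊙ᵣ x) }
  { toFunctor := 𝟭 M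
    left := leftLinearOfIsIso (𝟭 M) fun x m => inferInstanceAs (IsIso (𝟙 (x ⊙ₗ m)))
    right := rightLinearOfIsIso (𝟭 M) fun m x => inferInstanceAs (IsIso (𝟙 (m ⊙ᵣ x)))
    mid_comm := fun x m y => by
      change _ ≫ x ⊴ₗ 𝟙 (m ⊙ᵣ y) ≫ 𝟙 _ = 𝟙 (x ⊙ₗ m) ⊵ᵣ y ≫ 𝟙 _ ≫ _
      simp }

/-- The composite of bimodule functors (first `F`, then `G`). -/
def BimodFunctor.comp {M N P : Bimod C} (F : BimodFunctor M N) (G : BimodFunctor N P) :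
    BimodFunctor M P :=
  letI l : (F.toFunctor ⋙ G.toFunctor).LaxLeftLinear C :=
    { μₗ := fun x m => μₗ G.toFunctor x (F.toFunctor.obj m) ≫ G.toFunctor.map (μₗ F.toFunctor x m)
      μₗ_naturality_left := fun f d => by simp [← Functor.map_comp]
      μₗ_naturality_right := fun x _ _ f => by simp [← Functor.map_comp]
      μₗ_associativity := fun x y d => by
        simp [← Functor.map_comp]
        rw [Functor.map_comp, μₗ_associativity_assoc]
      μₗ_unitality := fun d => by simp [← Functor.map_comp] }
  letI r : (F.toFunctor ⋙ G.toFunctor).LaxRightLinear C :=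
    { μᵣ := fun m x => μᵣ G.toFunctor (F.toFunctor.obj m) x ≫ G.toFunctor.map (μᵣ F.toFunctor m x)
      μᵣ_naturality_left := fun f d => by simp [← Functor.map_comp]
      μᵣ_naturality_right := fun x _ _ f => by simp [← Functor.map_comp]
      μᵣ_associativity := fun d x y => by
        simp [← Functor.map_comp]
        rw [Functor.map_comp, μᵣ_associativity_assoc]
      μᵣ_unitality := fun d => by simp [← Functor.map_comp] }
  { toFunctor := F.toFunctor ⋙ G.toFunctor
    left := leftLinearOfIsIso _ fun x m => inferInstanceAs
      (IsIso (μₗ G.toFunctor x (F.toFunctor.obj m) ≫ G.toFunctor.map (μₗ F.toFunctor x m)))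
    right := rightLinearOfIsIso _ fun m x => inferInstanceAs
      (IsIso (μᵣ G.toFunctor (F.toFunctor.obj m) x ≫ G.toFunctor.map (μᵣ F.toFunctor m x)))
    mid_comm := fun x m y => by
      have h1 := F.mid_comm x m y
      have h2 := G.mid_comm x (F.toFunctor.obj m) y
      change _ ≫ x ⊴ₗ (_ ≫ _) ≫ (_ ≫ _) = (_ ≫ _) ⊵ᵣ y ≫ (_ ≫ _) ≫ G.toFunctor.map (F.toFunctor.map _)
      simp only [MonoidalLeftAction.actionHomRight_comp, MonoidalRightAction.comp_actionHomLeft,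
        Category.assoc, μₗ_naturality_right_assoc, μᵣ_naturality_left_assoc]
      dsimp only [Functor.comp_obj]
      rw [reassoc_of% h2, ← Functor.map_comp, ← Functor.map_comp, ← Functor.map_comp,
        ← Functor.map_comp, h1] }

section

variable {M N : Bimod C} (F : BimodFunctor M N) [F.toFunctor.IsEquivalence]

/-- The counit of the quasi-inverse. -/
def BimodFunctor.counit (n : N) : F.toFunctor.obj (F.toFunctor.inv.obj n) ≅ n :=
  F.toFunctor.asEquivalence.counitIso.app n

@[simp]
theorem BimodFunctor.counit_naturality {n n' : N} (f : n ⟶ n') :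
    F.toFunctor.map (F.toFunctor.inv.map f) ≫ (F.counit n').hom = (F.counit n).hom ≫ f :=
  F.toFunctor.asEquivalence.counitIso.hom.naturality f

@[simp]
theorem BimodFunctor.counit_naturality_assoc {n n' : N} (f : n ⟶ n') {Z : N} (h : n' ⟶ Z) :
    F.toFunctor.map (F.toFunctor.inv.map f) ≫ (F.counit n').hom ≫ h =
      (F.counit n).hom ≫ f ≫ h := by
  rw [← Category.assoc, F.counit_naturality, Category.assoc]

/-- The left module structure morphism of the quasi-inverse. -/
def BimodFunctor.invμₗ (x : C) (n : N) :
    x ⊙ₗ F.toFunctor.inv.obj n ⟶ F.toFunctor.inv.obj (x ⊙ₗ n) :=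
  F.toFunctor.preimage (δₗ F.toFunctor x (F.toFunctor.inv.obj n) ≫ x ⊴ₗ (F.counit n).hom ≫
    (F.counit (x ⊙ₗ n)).inv)

/-- The right module structure morphism of the quasi-inverse. -/
def BimodFunctor.invμᵣ (n : N) (x : C) :
    F.toFunctor.inv.obj n ⊙ᵣ x ⟶ F.toFunctor.inv.obj (n ⊙ᵣ x) :=
  F.toFunctor.preimage (δᵣ F.toFunctor (F.toFunctor.inv.obj n) x ≫ (F.counit n).hom ⊵ᵣ x ≫
    (F.counit (n ⊙ᵣ x)).inv)

@[simp]
theorem BimodFunctor.map_invμₗ (x : C) (n : N) : F.toFunctor.map (F.invμₗ x n) =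
    δₗ F.toFunctor x (F.toFunctor.inv.obj n) ≫ x ⊴ₗ (F.counit n).hom ≫ (F.counit (x ⊙ₗ n)).inv :=
  F.toFunctor.map_preimage _

@[simp]
theorem BimodFunctor.map_invμₗ_assoc (x : C) (n : N) {Z : N}
    (h : F.toFunctor.obj (F.toFunctor.inv.obj (x ⊙ₗ n)) ⟶ Z) :
    F.toFunctor.map (F.invμₗ x n) ≫ h = δₗ F.toFunctor x (F.toFunctor.inv.obj n) ≫
      x ⊴ₗ (F.counit n).hom ≫ (F.counit (x ⊙ₗ n)).inv ≫ h := by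
  rw [F.map_invμₗ]; simp only [Category.assoc]

@[simp]
theorem BimodFunctor.map_invμᵣ (n : N) (x : C) : F.toFunctor.map (F.invμᵣ n x) =
    δᵣ F.toFunctor (F.toFunctor.inv.obj n) x ≫ (F.counit n).hom ⊵ᵣ x ≫ (F.counit (n ⊙ᵣ x)).inv :=
  F.toFunctor.map_preimage _

@[simp]
theorem BimodFunctor.map_invμᵣ_assoc (n : N) (x : C) {Z : N}
    (h : F.toFunctor.obj (F.toFunctor.inv.obj (n ⊙ᵣ x)) ⟶ Z) :
    F.toFunctor.map (F.invμᵣ n x) ≫ h = δᵣ F.toFunctor (F.toFunctor.inv.obj n) x ≫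
      (F.counit n).hom ⊵ᵣ x ≫ (F.counit (n ⊙ᵣ x)).inv ≫ h := by
  rw [F.map_invμᵣ]; simp only [Category.assoc]

instance (x : C) (n : N) : IsIso (F.invμₗ x n) := by
  have : IsIso (F.toFunctor.map (F.invμₗ x n)) := by rw [F.map_invμₗ]; infer_instance
  exact isIso_of_reflects_iso _ F.toFunctor

instance (n : N) (x : C) : IsIso (F.invμᵣ n x) := by
  have : IsIso (F.toFunctor.map (F.invμᵣ n x)) := by rw [F.map_invμᵣ]; infer_instance
  exact isIso_of_reflects_iso _ F.toFunctor

theorem BimodFunctor.mid_comm_δ {M N : Bimod C} (F : BimodFunctor M N) (x : C) (m : M) (y : C) :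
    F.toFunctor.map (M.mid x m y).hom ≫ δₗ F.toFunctor x (m ⊙ᵣ y) ≫ x ⊴ₗ δᵣ F.toFunctor m y =
      δᵣ F.toFunctor (x ⊙ₗ m) y ≫ δₗ F.toFunctor x m ⊵ᵣ y ≫
        (N.mid x (F.toFunctor.obj m) y).hom := by
  have h := F.mid_comm x m y
  rw [← cancel_mono (x ⊴ₗ μᵣ F.toFunctor m y), ← cancel_mono (μₗ F.toFunctor x (m ⊙ᵣ y))]
  simp only [Category.assoc, h, ← MonoidalLeftAction.actionHomRight_comp_assoc,
    ← MonoidalRightAction.comp_actionHomLeft_assoc, Functor.RightLinear.δᵣ_comp_μᵣ,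
    Functor.LeftLinear.δₗ_comp_μₗ, MonoidalLeftAction.actionHomRight_id,
    MonoidalRightAction.id_actionHomLeft, Category.id_comp, Category.comp_id,
    Functor.RightLinear.δᵣ_comp_μᵣ_assoc]

/-- The quasi-inverse of a bimodule equivalence. -/
def BimodFunctor.inverse : BimodFunctor N M :=
  letI l : F.toFunctor.inv.LaxLeftLinear C :=
    { μₗ := F.invμₗ
      μₗ_naturality_left := fun f d => by
        apply F.toFunctor.map_injective
        rw [← cancel_mono (F.counit _).hom]
        simp [-Functor.fun_inv_map]
        rw [MonoidalLeftAction.action_exchange]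
      μₗ_naturality_right := fun x _ _ f => by
        apply F.toFunctor.map_injective
        rw [← cancel_mono (F.counit _).hom]
        simp [-Functor.fun_inv_map]
        rw [← MonoidalLeftAction.actionHomRight_comp, F.counit_naturality,
          MonoidalLeftAction.actionHomRight_comp]
      μₗ_associativity := fun x y d => by
        apply F.toFunctor.map_injective
        rw [← cancel_mono (F.counit _).hom]
        simp [-Functor.fun_inv_map]
      μₗ_unitality := fun d => by
        apply F.toFunctor.map_injective
        rw [← cancel_mono (F.counit _).hom]
        simp [-Functor.fun_inv_map]
        }
  letI r : F.toFunctor.inv.LaxRightLinear C :=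
    { μᵣ := F.invμᵣ
      μᵣ_naturality_left := fun f d => by
        apply F.toFunctor.map_injective
        rw [← cancel_mono (F.counit _).hom]
        simp [-Functor.fun_inv_map]
        rw [← MonoidalRightAction.comp_actionHomLeft, F.counit_naturality,
          MonoidalRightAction.comp_actionHomLeft]
      μᵣ_naturality_right := fun x _ _ f => by
        apply F.toFunctor.map_injective
        rw [← cancel_mono (F.counit _).hom]
        simp [-Functor.fun_inv_map]
        rw [MonoidalRightAction.action_exchange]
      μᵣ_associativity := fun d x y => by
        apply F.toFunctor.map_injective
        rw [← cancel_mono (F.counit _).hom]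
        simp [-Functor.fun_inv_map]
      μᵣ_unitality := fun d => by
        apply F.toFunctor.map_injective
        rw [← cancel_mono (F.counit _).hom]
        simp [-Functor.fun_inv_map]
        }
  haveI := F.additive
  haveI : F.toFunctor.asEquivalence.functor.Additive := F.additive
  haveI : F.toFunctor.asEquivalence.functor.Linear ℂ := F.linear
  { toFunctor := F.toFunctor.inv
    additive := inferInstanceAs F.toFunctor.asEquivalence.inverse.Additive
    linear := inferInstanceAs (F.toFunctor.asEquivalence.inverse.Linear ℂ)
    left := leftLinearOfIsIso _ fun x n => inferInstanceAs (IsIso (F.invμₗ x n))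
    right := rightLinearOfIsIso _ fun n x => inferInstanceAs (IsIso (F.invμᵣ n x))
    mid_comm := fun x m y => by
      change _ ≫ x ⊴ₗ F.invμᵣ _ _ ≫ F.invμₗ _ _ = F.invμₗ _ _ ⊵ᵣ y ≫ F.invμᵣ _ _ ≫ _
      apply F.toFunctor.map_injective
      rw [← cancel_mono (F.counit _).hom]
      simp [-Functor.fun_inv_map]
      rw [reassoc_of% F.mid_comm_δ, N.mid_naturality_middle] }

end

end Bimod

/-! ## Equivalence of bimodule categories and `π₁` of the Brauer-Picard 2-group -/

section BrPic

variable {C : Type u} [Category.{v} C] [Abelian C] [Linear ℂ C] [MonoidalCategory C]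

/-- Two bimodule categories are equivalent if there is a bimodule functor between them which is an
equivalence of categories. -/
def Bimod.Equivalent (M N : Bimod C) : Prop :=
  ∃ F : BimodFunctor M N, F.toFunctor.IsEquivalence

variable (C) in
instance Bimod.setoid : Setoid (Bimod C) where
  r := Bimod.Equivalent
  iseqv :=
    { refl := fun M => ⟨BimodFunctor.id M, inferInstanceAs ((𝟭 M : M ⥤ M).IsEquivalence)⟩
      symm := fun ⟨F, _⟩ => ⟨F.inverse, inferInstanceAs F.toFunctor.inv.IsEquivalence⟩
      trans := fun ⟨F, _⟩ ⟨G, _⟩ =>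
        ⟨F.comp G, inferInstanceAs ((F.toFunctor ⋙ G.toFunctor).IsEquivalence)⟩ }

theorem BimodFunctor.iso_comp {M N P : Bimod C} {F F' : BimodFunctor M N} {G G' : BimodFunctor N P}
    (h : F.Iso F') (h' : G.Iso G') : (F.comp G).Iso (F'.comp G') := by
  obtain ⟨e, h1, h2⟩ := h
  obtain ⟨e', h1', h2'⟩ := h'
  refine ⟨NatIso.hcomp e e', fun x m => ?_, fun m y => ?_⟩
  · change (μₗ G.toFunctor x (F.toFunctor.obj m) ≫ _) ≫ e'.hom.app _ ≫ G'.toFunctor.map _ =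
      x ⊴ₗ (e'.hom.app (F.toFunctor.obj m) ≫ G'.toFunctor.map (e.hom.app m) :
        _ ⟶ G'.toFunctor.obj (F'.toFunctor.obj m)) ≫
          μₗ G'.toFunctor x (F'.toFunctor.obj m) ≫ G'.toFunctor.map (μₗ F'.toFunctor x m)
    simp only [Category.assoc, NatTrans.naturality_assoc, ← Functor.map_comp, h1]
    rw [reassoc_of% h1' x (F.toFunctor.obj m), MonoidalLeftAction.actionHomRight_comp,
      Category.assoc, Functor.map_comp, μₗ_naturality_right_assoc]
  · change (μᵣ G.toFunctor (F.toFunctor.obj m) y ≫ _) ≫ e'.hom.app _ ≫ G'.toFunctor.map _ =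
      (e'.hom.app (F.toFunctor.obj m) ≫ G'.toFunctor.map (e.hom.app m) :
        _ ⟶ G'.toFunctor.obj (F'.toFunctor.obj m)) ⊵ᵣ y ≫
          μᵣ G'.toFunctor (F'.toFunctor.obj m) y ≫ G'.toFunctor.map (μᵣ F'.toFunctor m y)
    simp only [Category.assoc, NatTrans.naturality_assoc, ← Functor.map_comp, h2]
    rw [reassoc_of% h2' (F.toFunctor.obj m) y, MonoidalRightAction.comp_actionHomLeft,
      Category.assoc, Functor.map_comp, μᵣ_naturality_left_assoc]

theorem BimodFunctor.inverse_comp {M N : Bimod C} (F : BimodFunctor M N)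
    [F.toFunctor.IsEquivalence] : (F.inverse.comp F).Iso (BimodFunctor.id N) := by
  refine ⟨F.toFunctor.asEquivalence.counitIso, fun x m => ?_, fun m y => ?_⟩
  · change (μₗ F.toFunctor x (F.toFunctor.inv.obj m) ≫ F.toFunctor.map (F.invμₗ _ _)) ≫
      (F.counit _).hom = x ⊴ₗ (F.counit _).hom ≫ 𝟙 _
    simp
  · change (μᵣ F.toFunctor (F.toFunctor.inv.obj m) y ≫ F.toFunctor.map (F.invμᵣ _ _)) ≫
      (F.counit _).hom = (F.counit _).hom ⊵ᵣ y ≫ 𝟙 _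
    simp

/-- Bimodule autoequivalences of `M`. -/
structure BimodAut (M : Bimod C) extends BimodFunctor M M where
  [isEquivalence : toFunctor.IsEquivalence]

attribute [instance] BimodAut.isEquivalence

instance BimodAut.setoid (M : Bimod C) : Setoid (BimodAut M) where
  r F G := F.toBimodFunctor.Iso G.toBimodFunctor
  iseqv := ⟨fun F => BimodFunctor.Iso.refl F.1, BimodFunctor.Iso.symm, BimodFunctor.Iso.trans⟩

/-- The group of isomorphism classes of bimodule autoequivalences of `M`, under composition. -/
def BimodAutGroup (M : Bimod C) : Type (max u v) := Quotient (BimodAut.setoid M)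

/-- The class of a bimodule autoequivalence. -/
def BimodAutGroup.mk {M : Bimod C} (F : BimodAut M) : BimodAutGroup M := Quotient.mk _ F

/-- The identity. -/
def BimodAut.id (M : Bimod C) : BimodAut M :=
  { BimodFunctor.id M with isEquivalence := inferInstanceAs ((𝟭 M : M ⥤ M).IsEquivalence) }

/-- The composite `F ∘ G`. -/
def BimodAut.comp {M : Bimod C} (F G : BimodAut M) : BimodAut M :=
  { G.toBimodFunctor.comp F.toBimodFunctor with
    isEquivalence := inferInstanceAs ((G.toFunctor ⋙ F.toFunctor).IsEquivalence) }

/-- The inverse. -/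
def BimodAut.inverse {M : Bimod C} (F : BimodAut M) : BimodAut M :=
  { F.toBimodFunctor.inverse with
    isEquivalence := inferInstanceAs F.toFunctor.inv.IsEquivalence }

instance (M : Bimod C) : Mul (BimodAutGroup M) where
  mul := Quotient.map₂ BimodAut.comp fun _ _ h _ _ h' => BimodFunctor.iso_comp h' h

instance (M : Bimod C) : One (BimodAutGroup M) where
  one := BimodAutGroup.mk (BimodAut.id M)

instance (M : Bimod C) : Inv (BimodAutGroup M) where
  inv x := BimodAutGroup.mk (Quotient.out x).inverse

instance (M : Bimod C) : Group (BimodAutGroup M) :=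
  Group.ofRightAxioms
    (by
      rintro ⟨F⟩ ⟨G⟩ ⟨H⟩
      refine Quotient.sound ⟨Iso.refl _, fun x m => ?_, fun m x => ?_⟩
      · change ((_ ≫ _) ≫ F.toFunctor.map _) ≫ 𝟙 _ = x ⊴ₗ 𝟙 _ ≫
          μₗ F.toFunctor x (G.toFunctor.obj (H.toFunctor.obj m)) ≫ F.toFunctor.map (_ ≫ _)
        simp
      · change ((_ ≫ _) ≫ F.toFunctor.map _) ≫ 𝟙 _ = 𝟙 _ ⊵ᵣ x ≫
          μᵣ F.toFunctor (G.toFunctor.obj (H.toFunctor.obj m)) x ≫ F.toFunctor.map (_ ≫ _)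
        simp)
    (by
      rintro ⟨F⟩
      refine Quotient.sound ⟨Iso.refl _, fun x m => ?_, fun m x => ?_⟩
      · change (μₗ F.toFunctor x m ≫ F.toFunctor.map (𝟙 (x ⊙ₗ m))) ≫ 𝟙 _ =
          x ⊴ₗ 𝟙 (F.toFunctor.obj m) ≫ μₗ F.toFunctor x m
        simp
      · change (μᵣ F.toFunctor m x ≫ F.toFunctor.map (𝟙 (m ⊙ᵣ x))) ≫ 𝟙 _ =
          𝟙 (F.toFunctor.obj m) ⊵ᵣ x ≫ μᵣ F.toFunctor m x
        simp)
    (by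
      intro x
      have h : x = BimodAutGroup.mk (Quotient.out x) := (Quotient.out_eq x).symm
      conv_lhs => lhs; rw [h]
      exact Quotient.sound (BimodFunctor.inverse_comp (Quotient.out x).toBimodFunctor))

end BrPic

section Regular

variable (C : Type u) [Category.{v} C] [Abelian C] [Linear ℂ C] [MonoidalCategory C]
  [MonoidalPreadditive C] [MonoidalLinear ℂ C] [IsFiniteSemisimple C]

/-- The regular bimodule category `C`. -/
def regular : Bimod C where
  carrier := C
  left := MonoidalCategory.selfLeftAction C
  right := MonoidalCategory.selRightfAction C
  left_additive_left _ _ f g m := MonoidalPreadditive.add_whiskerRight f g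
  left_linear_left _ _ r f m := MonoidalLinear.smul_whiskerRight r f m
  left_additive_right x _ _ f g := MonoidalPreadditive.whiskerLeft_add f g
  left_linear_right x _ _ r f := MonoidalLinear.whiskerLeft_smul x r f
  right_additive_right m _ _ f g := MonoidalPreadditive.whiskerLeft_add f g
  right_linear_right m _ _ r f := MonoidalLinear.whiskerLeft_smul m r f
  right_additive_left _ _ f g x := MonoidalPreadditive.add_whiskerRight f g
  right_linear_left _ _ r f x := MonoidalLinear.smul_whiskerRight r f x
  mid x m y := α_ x m y
  mid_naturality_left f m y := by simp
  mid_naturality_middle x _ _ f y := by simp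
  mid_naturality_right x m _ _ f := by simp
  mid_assoc_left x x' m y := by simp
  mid_assoc_right x m y y' := by simp
  mid_unit_left m y := by simp
  mid_unit_right x m := by simp

/-- `π₁` of the Brauer-Picard categorical 2-group of `C`: the isomorphism classes of automorphisms
of its unit object, the regular bimodule category. -/
abbrev PiOneBrPic : Type (max u v) := BimodAutGroup (regular C)

variable {C}

/-- The right action of `C` on itself through a tensor functor `F`: `m ⊙ᵣ y = m ⊗ F(y)`. -/
abbrev twistedRightAction (F : C ⥤ C) [F.Monoidal] : MonoidalRightAction C C where
  actionObj m y := m ⊗ F.obj y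
  actionHomLeft f y := f ▷ F.obj y
  actionHomRight m _ _ f := m ◁ F.map f
  actionHom f g := f ⊗ₘ F.map g
  actionAssocIso m x y := whiskerLeftIso m (Functor.Monoidal.μIso F x y).symm ≪≫
    (α_ m (F.obj x) (F.obj y)).symm
  actionUnitIso m := whiskerLeftIso m (Functor.Monoidal.εIso F).symm ≪≫ ρ_ m
  actionHom_def f g := by simp [MonoidalCategory.tensorHom_def]
  actionHomRight_id := by simp
  id_actionHomLeft := by simp
  actionHom_comp := by simp
  actionAssocIso_hom_naturality {m m' x x' y y'} f g h := by
    change (f ⊗ₘ F.map (g ⊗ₘ h)) ≫ m' ◁ Functor.OplaxMonoidal.δ F x' y' ≫ (α_ _ _ _).inv =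
      (m ◁ Functor.OplaxMonoidal.δ F x y ≫ (α_ _ _ _).inv) ≫ ((f ⊗ₘ F.map g) ⊗ₘ F.map h)
    rw [Category.assoc, ← associator_inv_naturality, ← id_tensorHom, ← id_tensorHom,
      tensorHom_comp_tensorHom_assoc, tensorHom_comp_tensorHom_assoc,
      Functor.OplaxMonoidal.δ_natural, Category.comp_id, Category.id_comp]
  actionUnitIso_hom_naturality f := by
    simp [← whisker_exchange_assoc]
  actionHomRight_whiskerRight f c d := by
    simp [← MonoidalCategory.whiskerLeft_comp]
  whiskerRight_actionHomLeft c _ _ f d := by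
    simp [← MonoidalCategory.whiskerLeft_comp]
  actionHom_associator x y z d := by
    have h := congrArg (fun t => d ◁ t) (Functor.OplaxMonoidal.associativity F x y z)
    simp only [MonoidalCategory.whiskerLeft_comp] at h
    simp
    rw [← reassoc_of% h]
    simp
  actionHom_leftUnitor c d := by
    dsimp [whiskerLeftIso]
    rw [Functor.Monoidal.map_leftUnitor]
    monoidal
  actionHom_rightUnitor c d := by
    dsimp [whiskerLeftIso]
    rw [Functor.Monoidal.map_rightUnitor]
    monoidal

/-- The bimodule category `M_F`: the category `C` with the actions
`x ⊙ₗ m ⊙ᵣ y = x ⊗ m ⊗ F(y)`. -/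
def twisted (F : TensorAut C) : Bimod C where
  carrier := C
  left := MonoidalCategory.selfLeftAction C
  right := twistedRightAction F.toFunctor
  left_additive_left _ _ f g m := MonoidalPreadditive.add_whiskerRight f g
  left_linear_left _ _ r f m := MonoidalLinear.smul_whiskerRight r f m
  left_additive_right x _ _ f g := MonoidalPreadditive.whiskerLeft_add f g
  left_linear_right x _ _ r f := MonoidalLinear.whiskerLeft_smul x r f
  right_additive_right m _ _ f g := by
    change m ◁ F.toFunctor.map (f + g) = m ◁ F.toFunctor.map f + m ◁ F.toFunctor.map g
    simp [MonoidalPreadditive.whiskerLeft_add]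
  right_linear_right m _ _ r f := by
    change m ◁ F.toFunctor.map (r • f) = r • (m ◁ F.toFunctor.map f)
    simp
  right_additive_left _ _ f g x := MonoidalPreadditive.add_whiskerRight f g
  right_linear_left _ _ r f x := MonoidalLinear.smul_whiskerRight r f _
  mid x m y := α_ x m (F.toFunctor.obj y)
  mid_naturality_left f m y := by
    change (f ▷ m) ▷ F.toFunctor.obj y ≫ _ = _ ≫ f ▷ (m ⊗ F.toFunctor.obj y)
    simp
  mid_naturality_middle x _ _ f y := by
    change (x ◁ f) ▷ F.toFunctor.obj y ≫ _ = _ ≫ x ◁ (f ▷ F.toFunctor.obj y)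
    simp
  mid_naturality_right x m _ _ f := by
    change (x ⊗ m) ◁ F.toFunctor.map f ≫ _ = _ ≫ x ◁ (m ◁ F.toFunctor.map f)
    simp
  mid_assoc_left x x' m y := by
    change _ ▷ F.toFunctor.obj y ≫ _ = _ ≫ (α_ x x' (m ⊗ F.toFunctor.obj y)).hom
    simp
  mid_assoc_right x m y y' := by
    change (_ ◁ _ ≫ _) ≫ (α_ x m (F.toFunctor.obj y)).hom ▷ F.toFunctor.obj y' ≫
      (α_ x (m ⊗ F.toFunctor.obj y) (F.toFunctor.obj y')).hom = _ ≫ x ◁ (_ ◁ _ ≫ _)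
    simp
  mid_unit_left m y := by
    change _ ≫ (λ_ (m ⊗ F.toFunctor.obj y)).hom = (λ_ m).hom ▷ F.toFunctor.obj y
    simp
  mid_unit_right x m := by
    change _ ≫ x ◁ (m ◁ _ ≫ (ρ_ m).hom) = (x ⊗ m) ◁ _ ≫ (ρ_ (x ⊗ m)).hom
    simp

end Regular

/-! ## Relative tensor products of bimodule categories -/

section RelTensor

variable {C : Type u} [Category.{v} C] [Abelian C] [Linear ℂ C] [MonoidalCategory C]

/-- `C`-balanced functors `M × N ⟶ A`: bilinear functors `B` with a natural coherent isomorphism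
`B(m ⊙ᵣ x, n) ≅ B(m, x ⊙ₗ n)`. -/
structure BalancedFunctor (M N : Bimod C) (A : Type u) [Category.{v} A] [Abelian A]
    [Linear ℂ A] where
  /-- the underlying bifunctor -/
  toFunctor : M ⥤ N ⥤ A
  additive_left : ∀ n, (toFunctor.flip.obj n).Additive
  linear_left : ∀ n, (toFunctor.flip.obj n).Linear ℂ
  additive_right : ∀ m, (toFunctor.obj m).Additive
  linear_right : ∀ m, (toFunctor.obj m).Linear ℂ
  /-- the balancing isomorphism -/
  bal : ∀ (m : M) (x : C) (n : N),
    (toFunctor.obj (m ⊙ᵣ x)).obj n ≅ (toFunctor.obj m).obj (x ⊙ₗ n)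
  bal_naturality_left : ∀ {m m' : M} (f : m ⟶ m') (x : C) (n : N),
    (toFunctor.map (f ⊵ᵣ x)).app n ≫ (bal m' x n).hom =
      (bal m x n).hom ≫ (toFunctor.map f).app (x ⊙ₗ n)
  bal_naturality_middle : ∀ (m : M) {x x' : C} (f : x ⟶ x') (n : N),
    (toFunctor.map (m ⊴ᵣ f)).app n ≫ (bal m x' n).hom =
      (bal m x n).hom ≫ (toFunctor.obj m).map (f ⊵ₗ n)
  bal_naturality_right : ∀ (m : M) (x : C) {n n' : N} (f : n ⟶ n'),
    (toFunctor.obj (m ⊙ᵣ x)).map f ≫ (bal m x n').hom =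
      (bal m x n).hom ≫ (toFunctor.obj m).map (x ⊴ₗ f)
  bal_assoc : ∀ (m : M) (x y : C) (n : N),
    (bal m (x ⊗ y) n).hom ≫ (toFunctor.obj m).map (αₗ x y n).hom =
      (toFunctor.map (αᵣ m x y).hom).app n ≫ (bal (m ⊙ᵣ x) y n).hom ≫ (bal m x (y ⊙ₗ n)).hom
  bal_unit : ∀ (m : M) (n : N),
    (bal m (𝟙_ C) n).hom ≫ (toFunctor.obj m).map (λₗ n).hom = (toFunctor.map (ρᵣ m).hom).app n

namespace BalancedFunctor

variable {M N : Bimod C} {A A' : Type u} [Category.{v} A] [Abelian A] [Linear ℂ A]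
  [Category.{v} A'] [Abelian A'] [Linear ℂ A']

/-- The balanced functor `T ∘ B`. -/
def postcomp (B : BalancedFunctor M N A) (T : A ⥤ A') [T.Additive] [T.Linear ℂ] :
    BalancedFunctor M N A' where
  toFunctor := B.toFunctor ⋙ (Functor.whiskeringRight N A A').obj T
  additive_left n :=
    haveI := B.additive_left n
    inferInstanceAs (B.toFunctor.flip.obj n ⋙ T).Additive
  linear_left n :=
    haveI := B.linear_left n
    inferInstanceAs ((B.toFunctor.flip.obj n ⋙ T).Linear ℂ)
  additive_right m :=
    haveI := B.additive_right m
    inferInstanceAs (B.toFunctor.obj m ⋙ T).Additive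
  linear_right m :=
    haveI := B.linear_right m
    inferInstanceAs ((B.toFunctor.obj m ⋙ T).Linear ℂ)
  bal m x n := T.mapIso (B.bal m x n)
  bal_naturality_left f x n := by simp [← Functor.map_comp, B.bal_naturality_left]
  bal_naturality_middle m _ _ f n := by simp [← Functor.map_comp, B.bal_naturality_middle]
  bal_naturality_right m x _ _ f := by simp [← Functor.map_comp, B.bal_naturality_right]
  bal_assoc m x y n := by simp [← Functor.map_comp, B.bal_assoc]
  bal_unit m n := by simp [← Functor.map_comp, B.bal_unit]

/-- Morphisms of balanced functors: natural transformations compatible with the balancings. -/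
def IsHom {B B' : BalancedFunctor M N A} (τ : B.toFunctor ⟶ B'.toFunctor) : Prop :=
  ∀ (m : M) (x : C) (n : N), (τ.app (m ⊙ᵣ x)).app n ≫ (B'.bal m x n).hom =
    (B.bal m x n).hom ≫ (τ.app m).app (x ⊙ₗ n)

/-- A balanced functor `B : M × N ⟶ A` is universal if for every finite semisimple category `D`,
composition with `B` is an equivalence (that is, essentially surjective and fully faithful) from the
category of linear functors `A ⥤ D` to the category of balanced functors `M × N ⟶ D`. -/
def IsUniversal (B : BalancedFunctor M N A) : Prop :=
  ∀ (D : Type u) [Category.{v} D] [Abelian D] [Linear ℂ D] [IsFiniteSemisimple D],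
    (∀ B' : BalancedFunctor M N D, ∃ (T : A ⥤ D) (_ : T.Additive) (_ : T.Linear ℂ)
      (e : (B.postcomp T).toFunctor ≅ B'.toFunctor), IsHom e.hom) ∧
    (∀ (T T' : A ⥤ D) [T.Additive] [T.Linear ℂ] [T'.Additive] [T'.Linear ℂ]
      (τ : (B.postcomp T).toFunctor ⟶ (B.postcomp T').toFunctor), IsHom τ →
        ∃! σ : T ⟶ T', ∀ m n, (τ.app m).app n = σ.app ((B.toFunctor.obj m).obj n))

end BalancedFunctor

/-- The data exhibiting the bimodule category `P` as the relative tensor product `M ⊠_C N`: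
a universal balanced functor `B : M × N ⟶ P`, with coherent natural isomorphisms
`x ⊙ₗ B(m, n) ≅ B(x ⊙ₗ m, n)` and `B(m, n) ⊙ᵣ y ≅ B(m, n ⊙ᵣ y)` compatible with the balancing and
with each other (so that the actions on `P` are those induced from the left action on `M` and the
right action on `N`). -/
structure RelTensor (M N P : Bimod C) extends BalancedFunctor M N P where
  universal : toBalancedFunctor.IsUniversal
  [left : ∀ n, (toFunctor.flip.obj n).LeftLinear C]
  [right : ∀ m, (toFunctor.obj m).RightLinear C]
  left_naturality : ∀ (x : C) (m : M) {n n' : N} (f : n ⟶ n'),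
    x ⊴ₗ (toFunctor.obj m).map f ≫ μₗ (toFunctor.flip.obj n') x m =
      μₗ (toFunctor.flip.obj n) x m ≫ (toFunctor.obj (x ⊙ₗ m)).map f
  right_naturality : ∀ {m m' : M} (f : m ⟶ m') (n : N) (y : C),
    (toFunctor.map f).app n ⊵ᵣ y ≫ μᵣ (toFunctor.obj m') n y =
      μᵣ (toFunctor.obj m) n y ≫ (toFunctor.map f).app (n ⊙ᵣ y)
  left_bal : ∀ (x : C) (m : M) (y : C) (n : N),
    μₗ (toFunctor.flip.obj n) x (m ⊙ᵣ y) ≫ (toFunctor.map (M.mid x m y).inv).app n ≫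
      (bal (x ⊙ₗ m) y n).hom = x ⊴ₗ (bal m y n).hom ≫ μₗ (toFunctor.flip.obj (y ⊙ₗ n)) x m
  right_bal : ∀ (m : M) (x : C) (n : N) (y : C),
    μᵣ (toFunctor.obj (m ⊙ᵣ x)) n y ≫ (bal m x (n ⊙ᵣ y)).hom =
      (bal m x n).hom ⊵ᵣ y ≫ μᵣ (toFunctor.obj m) (x ⊙ₗ n) y ≫
        (toFunctor.obj m).map (N.mid x n y).hom
  mid_comm : ∀ (x : C) (m : M) (n : N) (y : C),
    (P.mid x ((toFunctor.obj m).obj n) y).hom ≫ x ⊴ₗ μᵣ (toFunctor.obj m) n y ≫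
      μₗ (toFunctor.flip.obj (n ⊙ᵣ y)) x m =
        μₗ (toFunctor.flip.obj n) x m ⊵ᵣ y ≫ μᵣ (toFunctor.obj (x ⊙ₗ m)) n y

/-- `P` is a relative tensor product `M ⊠_C N`, as a bimodule category. -/
def IsRelTensor (M N P : Bimod C) : Prop := Nonempty (RelTensor M N P)

variable [MonoidalPreadditive C] [MonoidalLinear ℂ C] [IsFiniteSemisimple C]

/-- A bimodule category is invertible if it has an inverse for `⊠_C`. -/
def Bimod.IsInvertible (M : Bimod C) : Prop :=
  ∃ N : Bimod C, IsRelTensor M N (regular C) ∧ IsRelTensor N M (regular C)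

/-- A bimodule category is outer if it is invertible and equivalent to `C` as a left module
category. -/
structure Bimod.IsOuter (M : Bimod C) : Prop where
  invertible : M.IsInvertible
  left_trivial : ∃ F : (regular C) ⥤ M, F.Additive ∧ F.Linear ℂ ∧ F.IsEquivalence ∧
    Nonempty (F.LeftLinear C)

variable (C) in
/-- Outer bimodule categories. -/
abbrev OuterBimod : Type (max (u + 1) (v + 1)) := {M : Bimod C // M.IsOuter}

variable (C) in
/-- `Out(C)`: the equivalence classes of outer bimodule categories. -/
def Out : Type (max (u + 1) (v + 1)) :=
  Quotient ((Bimod.setoid C).comap (Subtype.val : OuterBimod C → Bimod C))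

/-- The class in `Out(C)` of an outer bimodule category. -/
def Out.mk (M : OuterBimod C) : Out C := Quotient.mk _ M

end RelTensor

/-! ## Half-braidings from bimodule autoequivalences and from characters -/

section HalfBraidings

variable {C : Type u} [Category.{v} C] [Abelian C] [Linear ℂ C] [MonoidalCategory C]

/-- The half-braiding of `Z` is the one on the unit object given by the character `χ` of `U(C)`: up
to an isomorphism `Z ≅ 𝟙`, it is on each simple object `S` the canonical isomorphism
`𝟙 ⊗ S ≅ S ⊗ 𝟙` multiplied by the value of `χ` at the degree of `S`. -/
def IsCharacterBraiding (χ : UniversalGradingGroup C →* ℂˣ) (Z : Center C) : Prop :=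
  ∃ i : Z.1 ≅ 𝟙_ C, ∀ (S : C) [Simple S], (Z.2.β S).hom =
    (χ (univDeg S) : ℂ) • (i.hom ▷ S ≫ (λ_ S).hom ≫ (ρ_ S).inv ≫ S ◁ i.inv)

variable [MonoidalPreadditive C] [MonoidalLinear ℂ C] [IsFiniteSemisimple C]

/-- The image of the unit object under a bimodule autoequivalence of the regular bimodule. -/
def BimodAut.unitObj (φ : BimodAut (regular C)) : C := φ.toFunctor.obj (𝟙_ C : C)

/-- The morphism `φ(𝟙) ⊗ Y ≅ φ(𝟙 ⊗ Y) ≅ φ(Y ⊗ 𝟙) ≅ Y ⊗ φ(𝟙)`. -/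
def BimodAut.unitBraiding (φ : BimodAut (regular C)) (Y : C) :
    φ.unitObj ⊗ Y ⟶ Y ⊗ φ.unitObj :=
  CategoryStruct.comp (obj := C) (μᵣ φ.toFunctor (𝟙_ C : C) Y)
    (CategoryStruct.comp (obj := C)
      (φ.toFunctor.map ((λ_ Y).hom ≫ (ρ_ Y).inv)) (δₗ φ.toFunctor Y (𝟙_ C : C)))

/-- The object `Z` of the center is `φ(𝟙)`, with the half-braiding induced by the bimodule functor
structure of `φ`. -/
def BimodAut.CorrespondsTo (φ : BimodAut (regular C)) (Z : Center C) : Prop :=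
  ∃ i : φ.unitObj ≅ Z.1, ∀ Y : C,
    i.hom ▷ Y ≫ (Z.2.β Y).hom = φ.unitBraiding Y ≫ Y ◁ i.hom

end HalfBraidings

end

end FusionLES

open FusionLES

/-!
The proof rests on one notion. For a tensor functor `F : C ⥤ C` and a bimodule category `P`, an
object `p : P` is `F`-twisted central (`TwistedCentral`) if it comes with a natural, multiplicative
and unital isomorphism `p ⊙ᵣ y ≅ F(y) ⊙ₗ p`. Write `P_F` for `P` with its right action restricted
along `F` (`Bimod.restrict`). Bimodule functors `C_F ⟶ P` are the same as `F`-twisted central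
objects of `P`, by evaluation at `𝟙` (`BimodFunctor.twistedCentral`, `TwistedCentral.functor`). So
`C_F` is equivalent to `P` exactly if `P` has an `F`-twisted central generator, an object `p` for
which `c ↦ c ⊙ₗ p` is an equivalence `C ≌ P` (`IsTwistOf`, `equivalent_iff_isTwistOf`).

*The group `Out(C)` and the map `M`.* Let `N` have a `G`-twisted central generator, and let `c(n)`
be the coordinate of an object `n` of `N`, given by `c(n) ⊙ₗ n₀ ≅ n`. Then `(m, n) ↦ m ⊙ᵣ c(n)` is a
universal balanced functor `M × N ⟶ M`, so that `M ⊠_C N` is `M_G`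
(`IsTwistOf.isRelTensor_iff`). In particular `C_F ⊠_C C_G` is `C_{F ∘ G}`. Conversely, a bimodule
category `P` which is trivial as a left module category has a generator `p`, and
`p ⊙ᵣ y ≅ F(y) ⊙ₗ p` defines a tensor functor `F` for which `p` is twisted central
(`exists_isTwistOf`). If `P` is invertible, `F` is an equivalence, since its composites with the
functor attached to the inverse of `P` are conjugations by invertible objects
(`Bimod.IsOuter.exists_isTwistOf`). Hence `F ↦ C_F` is surjective onto `Out(C)`, its fibres form a
group congruence on `Eq(C)`, and `Out(C)` is the quotient group.

*Exactness at `Eq(C)`.* The twisted central generators of the regular bimodule category are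
invertible objects `g` of `C`, and `g` is `G`-twisted central exactly if `G` is isomorphic to the
inner autoequivalence `F_g` (`innerAut_iso_iff`).

*Exactness at `Inv(C)`.* For `F = 𝟭`, a twisted central structure on an object of `C` is a
half-braiding, whence `π₁ BrPic(C) ≅ Inv(Z(C))` (`PiOneBrPic.equivInvCenter`), and `F_g` is trivial
exactly if `g` has a half-braiding (`forgetInv_mulExact_toEq`).

*Exactness at `Hom(U(C), ℂˣ)` and `π₁ BrPic(C)`.* A half-braiding on `𝟙` is a monoidal natural
automorphism of the identity functor. By semisimplicity and Schur's lemma it is determined by its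
scalars on the simple objects, and multiplicativity says that these scalars form a grading of `C`
by `ℂˣ`, that is, a character of `U(C)` (`charEnd_tensor`, `exists_isCharacterBraiding`).
-/

namespace FusionLES

noncomputable section

attribute [local instance] Abelian.hasFiniteBiproducts

/-! ### Restriction of the right action along a tensor functor -/

section Restrict

/-- The right action `m ⊙ᵣ y ↦ m ⊙ᵣ F(y)` obtained by restriction along a monoidal functor `F`. -/
abbrev restrictRightAction {C D : Type*} [Category* C] [MonoidalCategory C] [Category* D]
    [MonoidalRightAction C D] (F : C ⥤ C) [F.Monoidal] : MonoidalRightAction C D where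
  actionObj m y := m ⊙ᵣ F.obj y
  actionHomLeft f y := f ⊵ᵣ F.obj y
  actionHomRight m _ _ f := m ⊴ᵣ F.map f
  actionHom f g := f ⊙ᵣₘ F.map g
  actionAssocIso m x y :=
    { hom := m ⊴ᵣ Functor.OplaxMonoidal.δ F x y ≫ (αᵣ m (F.obj x) (F.obj y)).hom
      inv := (αᵣ m (F.obj x) (F.obj y)).inv ≫ m ⊴ᵣ Functor.LaxMonoidal.μ F x y
      hom_inv_id := by
        simp [← MonoidalRightAction.actionHomRight_comp]
      inv_hom_id := by
        simp [← MonoidalRightAction.actionHomRight_comp_assoc] }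
  actionUnitIso m :=
    { hom := m ⊴ᵣ Functor.OplaxMonoidal.η F ≫ (ρᵣ m).hom
      inv := (ρᵣ m).inv ≫ m ⊴ᵣ Functor.LaxMonoidal.ε F
      hom_inv_id := by
        simp [← MonoidalRightAction.actionHomRight_comp]
      inv_hom_id := by
        simp [← MonoidalRightAction.actionHomRight_comp_assoc] }
  actionHom_def f g := MonoidalRightAction.actionHom_def f (F.map g)
  actionHomRight_id := by simp
  id_actionHomLeft := by simp
  actionHom_comp := by simp
  actionAssocIso_hom_naturality {m m' x x' y y'} f g h := by
    change (f ⊙ᵣₘ F.map (g ⊗ₘ h)) ≫ m' ⊴ᵣ Functor.OplaxMonoidal.δ F x' y' ≫ (αᵣ _ _ _).hom =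
      (m ⊴ᵣ Functor.OplaxMonoidal.δ F x y ≫ (αᵣ _ _ _).hom) ≫ ((f ⊙ᵣₘ F.map g) ⊙ᵣₘ F.map h)
    rw [Category.assoc, ← MonoidalRightAction.actionAssocIso_hom_naturality,
      ← MonoidalRightAction.id_actionHom, ← MonoidalRightAction.id_actionHom,
      ← MonoidalRightAction.actionHom_comp_assoc, ← MonoidalRightAction.actionHom_comp_assoc,
      Functor.OplaxMonoidal.δ_natural, Category.comp_id, Category.id_comp]
  actionUnitIso_hom_naturality {m m'} f := by
    change (m ⊴ᵣ Functor.OplaxMonoidal.η F ≫ (ρᵣ m).hom) ≫ f =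
      f ⊵ᵣ F.obj (𝟙_ C) ≫ m' ⊴ᵣ Functor.OplaxMonoidal.η F ≫ (ρᵣ m').hom
    rw [Category.assoc, MonoidalRightAction.actionUnitIso_hom_naturality,
      MonoidalRightAction.action_exchange_assoc]
  actionHomRight_whiskerRight f c d := by
    dsimp only
    rw [Category.assoc, ← MonoidalRightAction.actionHomRight_whiskerRight_assoc,
      ← MonoidalRightAction.actionHomRight_comp, ← MonoidalRightAction.actionHomRight_comp,
      Functor.LaxMonoidal.μ_natural_left, Functor.Monoidal.δ_μ_assoc]
  whiskerRight_actionHomLeft c _ _ f d := by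
    dsimp only
    have h := MonoidalRightAction.whiskerRight_actionHomLeft (F.obj c) (F.map f) d
    simp only [Category.assoc]
    rw [← reassoc_of% h, ← MonoidalRightAction.actionHomRight_comp,
      ← MonoidalRightAction.actionHomRight_comp, Functor.LaxMonoidal.μ_natural_right,
      Functor.Monoidal.δ_μ_assoc]
  actionHom_associator x y z d := by
    dsimp only
    have h := congrArg (fun t => d ⊴ᵣ t) (Functor.OplaxMonoidal.associativity F x y z)
    simp only [MonoidalRightAction.actionHomRight_comp] at h
    have h1 := MonoidalRightAction.actionHom_associator (F.obj x) (F.obj y) (F.obj z) d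
    have h2 := MonoidalRightAction.actionHomRight_whiskerRight
      (Functor.OplaxMonoidal.δ F x y) (F.obj z) d
    have h3 := MonoidalRightAction.whiskerRight_actionHomLeft (F.obj x)
      (Functor.OplaxMonoidal.δ F y z) d
    rw [MonoidalRightAction.comp_actionHomLeft]
    have h2' : (αᵣ d (F.obj (x ⊗ y)) (F.obj z)).hom ≫
        (d ⊴ᵣ Functor.OplaxMonoidal.δ F x y) ⊵ᵣ F.obj z =
        d ⊴ᵣ (Functor.OplaxMonoidal.δ F x y ▷ F.obj z) ≫ (αᵣ _ _ _).hom := by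
      rw [h2]; simp only [Category.assoc, Iso.inv_hom_id, Category.comp_id]
    have h3' : (αᵣ d (F.obj x) (F.obj (y ⊗ z))).hom ≫
        (d ⊙ᵣ F.obj x) ⊴ᵣ Functor.OplaxMonoidal.δ F y z =
        d ⊴ᵣ (F.obj x ◁ Functor.OplaxMonoidal.δ F y z) ≫ (αᵣ _ _ _).hom := by
      rw [h3]; simp only [Category.assoc, Iso.inv_hom_id, Category.comp_id]
    simp only [Category.assoc]
    rw [reassoc_of% h2', reassoc_of% h3', ← h1, reassoc_of% h]
  actionHom_leftUnitor c d := by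
    have h := congrArg (fun t => d ⊴ᵣ t) (Functor.Monoidal.map_leftUnitor F c)
    simp only [MonoidalRightAction.actionHomRight_comp] at h
    dsimp only
    rw [h, MonoidalRightAction.comp_actionHomLeft, MonoidalRightAction.actionHom_leftUnitor,
      MonoidalRightAction.actionHomRight_whiskerRight]
    simp only [Category.assoc, Iso.inv_hom_id_assoc]
  actionHom_rightUnitor c d := by
    have h := congrArg (fun t => d ⊴ᵣ t) (Functor.Monoidal.map_rightUnitor F c)
    simp only [MonoidalRightAction.actionHomRight_comp] at h
    dsimp only
    rw [h, MonoidalRightAction.actionHom_rightUnitor,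
      MonoidalRightAction.whiskerRight_actionHomLeft]
    simp only [Category.assoc, Iso.inv_hom_id_assoc]

variable {C : Type u} [Category.{v} C] [Abelian C] [Linear ℂ C] [MonoidalCategory C]

/-- The bimodule category `M_F`: the category `M` with the right action restricted along `F`. -/
def Bimod.restrict (M : Bimod C) (F : C ⥤ C) [F.Monoidal] [F.Additive] [F.Linear ℂ] :
    Bimod C where
  carrier := M
  left := M.left
  right := restrictRightAction F
  left_additive_left := M.left_additive_left
  left_linear_left := M.left_linear_left
  left_additive_right := M.left_additive_right
  left_linear_right := M.left_linear_right
  right_additive_right m x y f g := by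
    change m ⊴ᵣ F.map (f + g) = m ⊴ᵣ F.map f + m ⊴ᵣ F.map g
    rw [F.map_add, M.right_additive_right]
  right_linear_right m x y r f := by
    change m ⊴ᵣ F.map (r • f) = r • m ⊴ᵣ F.map f
    rw [F.map_smul, M.right_linear_right]
  right_additive_left m n f g x := M.right_additive_left m n f g (F.obj x)
  right_linear_left m n r f x := M.right_linear_left m n r f (F.obj x)
  mid x m y := M.mid x m (F.obj y)
  mid_naturality_left f m y := M.mid_naturality_left f m (F.obj y)
  mid_naturality_middle x _ _ f y := M.mid_naturality_middle x f (F.obj y)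
  mid_naturality_right x m _ _ f := M.mid_naturality_right x m (F.map f)
  mid_assoc_left x x' m y := M.mid_assoc_left x x' m (F.obj y)
  mid_assoc_right x m y y' := by
    change ((x ⊙ₗ m) ⊴ᵣ _ ≫ (αᵣ (x ⊙ₗ m) (F.obj y) (F.obj y')).hom) ≫
      (M.mid x m (F.obj y)).hom ⊵ᵣ F.obj y' ≫ (M.mid x (m ⊙ᵣ F.obj y) (F.obj y')).hom =
      (M.mid x m (F.obj (y ⊗ y'))).hom ≫ x ⊴ₗ (m ⊴ᵣ _ ≫ (αᵣ m (F.obj y) (F.obj y')).hom)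
    rw [Category.assoc, M.mid_assoc_right, MonoidalLeftAction.actionHomRight_comp,
      ← reassoc_of% (M.mid_naturality_right x m (Functor.OplaxMonoidal.δ F y y'))]
  mid_unit_left m y := M.mid_unit_left m (F.obj y)
  mid_unit_right x m := by
    change (M.mid x m (F.obj (𝟙_ C))).hom ≫ x ⊴ₗ (m ⊴ᵣ _ ≫ (ρᵣ m).hom) =
      (x ⊙ₗ m) ⊴ᵣ _ ≫ (ρᵣ (x ⊙ₗ m)).hom
    rw [MonoidalLeftAction.actionHomRight_comp,
      ← reassoc_of% (M.mid_naturality_right x m (Functor.OplaxMonoidal.η F)), M.mid_unit_right]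

end Restrict

/-! ### Twisted central objects of a bimodule category -/

section TwistedCentral

theorem actionAssocIso_inv_pentagon {C D : Type*} [Category* C] [MonoidalCategory C] [Category* D]
    [MonoidalLeftAction C D] (x y z : C) (p : D) :
    x ⊴ₗ (αₗ y z p).inv ≫ (αₗ x (y ⊗ z) p).inv ≫ (α_ x y z).inv ⊵ₗ p =
      (αₗ x y (z ⊙ₗ p)).inv ≫ (αₗ (x ⊗ y) z p).inv := by
  rw [← cancel_mono ((α_ x y z).hom ⊵ₗ p), ← cancel_mono (αₗ x (y ⊗ z) p).hom,
    ← cancel_mono (x ⊴ₗ (αₗ y z p).hom)]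
  simp only [Category.assoc, MonoidalLeftAction.associator_actionHom,
    MonoidalLeftAction.inv_hom_actionHomLeft_assoc, Iso.inv_hom_id_assoc, Iso.inv_hom_id,
    Category.id_comp, MonoidalLeftAction.actionHomRight_inv_hom]

variable {C : Type u} [Category.{v} C] [Abelian C] [Linear ℂ C] [MonoidalCategory C]

/-- An `F`-twisted central structure on an object `p` of a bimodule category `P`: a natural
isomorphism `p ⊙ᵣ y ≅ F(y) ⊙ₗ p` which is multiplicative and unital in `y`. For `P = C` and `F = 𝟭`
this is a half-braiding on `p`. -/
structure TwistedCentral (F : C ⥤ C) [F.Monoidal] (P : Bimod C) (p : P) where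
  /-- the commutation isomorphism -/
  iso : ∀ y : C, p ⊙ᵣ y ≅ F.obj y ⊙ₗ p
  naturality : ∀ {y y' : C} (f : y ⟶ y'),
    p ⊴ᵣ f ≫ (iso y').hom = (iso y).hom ≫ F.map f ⊵ₗ p
  hexagon : ∀ x y : C, (iso (x ⊗ y)).hom = (αᵣ p x y).hom ≫ (iso x).hom ⊵ᵣ y ≫
    (P.mid (F.obj x) p y).hom ≫ F.obj x ⊴ₗ (iso y).hom ≫ (αₗ (F.obj x) (F.obj y) p).inv ≫
      Functor.LaxMonoidal.μ F x y ⊵ₗ p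
  unit : (iso (𝟙_ C)).hom = (ρᵣ p).hom ≫ (λₗ p).inv ≫ Functor.LaxMonoidal.ε F ⊵ₗ p

theorem Bimod.mid_assoc_left_inv (P : Bimod C) (x x' : C) (m : P) (y : C) :
    (αₗ x x' m).inv ⊵ᵣ y ≫ (P.mid (x ⊗ x') m y).hom =
      (P.mid x (x' ⊙ₗ m) y).hom ≫ x ⊴ₗ (P.mid x' m y).hom ≫ (αₗ x x' (m ⊙ᵣ y)).inv := by
  rw [← cancel_epi ((αₗ x x' m).hom ⊵ᵣ y), ← cancel_mono (αₗ x x' (m ⊙ᵣ y)).hom]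
  simp only [Category.assoc, MonoidalRightAction.hom_inv_actionHomLeft_assoc, Iso.inv_hom_id,
    Category.comp_id, P.mid_assoc_left]

/-- The functor `c ↦ c ⊙ₗ p`. -/
@[simps]
def Bimod.orbit (P : Bimod C) (p : P) : C ⥤ P where
  obj c := c ⊙ₗ p
  map f := f ⊵ₗ p

instance (P : Bimod C) (p : P) : (P.orbit p).Additive where
  map_add {x y f g} := P.left_additive_left x y f g p

instance (P : Bimod C) (p : P) : (P.orbit p).Linear ℂ where
  map_smul {x y} f r := P.left_linear_left x y r f p

variable [MonoidalPreadditive C] [MonoidalLinear ℂ C] [IsFiniteSemisimple C]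

/-- The bimodule functor `C_F ⟶ P`, `c ↦ c ⊙ₗ p`, attached to a twisted central object `p`. -/
def TwistedCentral.functor {F : C ⥤ C} [F.Monoidal] [F.Additive] [F.Linear ℂ] {P : Bimod C} {p : P}
    (t : TwistedCentral F P p) : BimodFunctor ((regular C).restrict F) P :=
  let K : (regular C).restrict F ⥤ P := P.orbit p
  letI l : K.LaxLeftLinear C :=
    { μₗ := fun x (c : C) => (αₗ x c p).inv
      μₗ_naturality_left := fun {x x'} f (c : C) => by
        change f ⊵ₗ (c ⊙ₗ p) ≫ (αₗ x' c p).inv = (αₗ x c p).inv ≫ (f ▷ c) ⊵ₗ p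
        simp
      μₗ_naturality_right := fun x {c c' : C} (f : c ⟶ c') => by
        change x ⊴ₗ f ⊵ₗ p ≫ (αₗ x c' p).inv = (αₗ x c p).inv ≫ (x ◁ f) ⊵ₗ p
        simp
      μₗ_associativity := fun x y (c : C) => by
        change (αₗ (x ⊗ y) c p).inv ≫ (α_ x y c).hom ⊵ₗ p =
          (αₗ x y (c ⊙ₗ p)).hom ≫ x ⊴ₗ (αₗ y c p).inv ≫ (αₗ x (y ⊗ c) p).inv
        rw [Iso.inv_comp_eq, ← MonoidalLeftAction.associator_actionHom_assoc]
        simp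
      μₗ_unitality := fun (c : C) => by
        change (λₗ (c ⊙ₗ p)).hom = (αₗ (𝟙_ C) c p).inv ≫ (λ_ c).hom ⊵ₗ p
        simp }
  letI r : K.LaxRightLinear C :=
    { μᵣ := fun (c : C) y => (P.mid c p y).hom ≫ c ⊴ₗ (t.iso y).hom ≫ (αₗ c (F.obj y) p).inv
      μᵣ_naturality_right := fun (c : C) {y y'} f => by
        change (c ⊙ₗ p) ⊴ᵣ f ≫ (P.mid c p y').hom ≫ c ⊴ₗ (t.iso y').hom ≫ (αₗ c (F.obj y') p).inv =
          ((P.mid c p y).hom ≫ c ⊴ₗ (t.iso y).hom ≫ (αₗ c (F.obj y) p).inv) ≫ (c ◁ F.map f) ⊵ₗ p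
        rw [reassoc_of% P.mid_naturality_right, ← MonoidalLeftAction.actionHomRight_comp_assoc,
          t.naturality]
        simp
      μᵣ_naturality_left := fun {c c' : C} (f : c ⟶ c') y => by
        change (f ⊵ₗ p) ⊵ᵣ y ≫ (P.mid c' p y).hom ≫ c' ⊴ₗ (t.iso y).hom ≫
            (αₗ c' (F.obj y) p).inv =
          ((P.mid c p y).hom ≫ c ⊴ₗ (t.iso y).hom ≫ (αₗ c (F.obj y) p).inv) ≫ (f ▷ F.obj y) ⊵ₗ p
        rw [reassoc_of% P.mid_naturality_left, ← MonoidalLeftAction.action_exchange_assoc]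
        simp
      μᵣ_associativity := fun (c : C) x y => by
        change ((P.mid c p (x ⊗ y)).hom ≫ c ⊴ₗ (t.iso (x ⊗ y)).hom ≫
              (αₗ c (F.obj (x ⊗ y)) p).inv) ≫
            (c ◁ Functor.OplaxMonoidal.δ F x y ≫ (α_ c (F.obj x) (F.obj y)).inv) ⊵ₗ p =
          (αᵣ (c ⊙ₗ p) x y).hom ≫
            ((P.mid c p x).hom ≫ c ⊴ₗ (t.iso x).hom ≫ (αₗ c (F.obj x) p).inv) ⊵ᵣ y ≫
            (P.mid (c ⊗ F.obj x) p y).hom ≫ (c ⊗ F.obj x) ⊴ₗ (t.iso y).hom ≫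
            (αₗ (c ⊗ F.obj x) (F.obj y) p).inv
        have h1 := P.mid_naturality_middle c (t.iso x).hom y
        have h2 := P.mid_assoc_left_inv c (F.obj x) p y
        have h3 := P.mid_assoc_right c p x y
        have h4 := actionAssocIso_inv_pentagon c (F.obj x) (F.obj y) p
        have h5 : (αₗ c (F.obj (x ⊗ y)) p).inv ≫ (c ◁ Functor.OplaxMonoidal.δ F x y) ⊵ₗ p =
            c ⊴ₗ Functor.OplaxMonoidal.δ F x y ⊵ₗ p ≫ (αₗ c (F.obj x ⊗ F.obj y) p).inv := by simp
        simp only [MonoidalRightAction.comp_actionHomLeft, MonoidalLeftAction.comp_actionHomLeft,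
          Category.assoc, reassoc_of% h2, reassoc_of% h1, reassoc_of% h3, reassoc_of% h5,
          t.hexagon, MonoidalLeftAction.actionHomRight_comp,
          MonoidalLeftAction.tensor_actionHomRight, Iso.inv_hom_id_assoc]
        rw [← MonoidalLeftAction.actionHomRight_comp_assoc c
          (Functor.LaxMonoidal.μ F x y ⊵ₗ p), ← MonoidalLeftAction.comp_actionHomLeft]
        simp only [Functor.Monoidal.μ_δ, MonoidalLeftAction.id_actionHomLeft,
          MonoidalLeftAction.actionHomRight_id, Category.id_comp, h4]
      μᵣ_unitality := fun (c : C) => by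
        change (ρᵣ (c ⊙ₗ p)).hom = ((P.mid c p (𝟙_ C)).hom ≫ c ⊴ₗ (t.iso (𝟙_ C)).hom ≫
            (αₗ c (F.obj (𝟙_ C)) p).inv) ≫
            (c ◁ Functor.OplaxMonoidal.η F ≫ (ρ_ c).hom) ⊵ₗ p
        have h : (αₗ c (F.obj (𝟙_ C)) p).inv ≫ (c ◁ Functor.OplaxMonoidal.η F) ⊵ₗ p =
            c ⊴ₗ Functor.OplaxMonoidal.η F ⊵ₗ p ≫ (αₗ c (𝟙_ C) p).inv := by simp
        simp only [MonoidalLeftAction.comp_actionHomLeft, Category.assoc, reassoc_of% h, t.unit,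
          MonoidalLeftAction.actionHomRight_comp, ← P.mid_unit_right]
        rw [← MonoidalLeftAction.actionHomRight_comp_assoc c
          (Functor.LaxMonoidal.ε F ⊵ₗ p), ← MonoidalLeftAction.comp_actionHomLeft]
        simp }
  { toFunctor := K
    additive := inferInstanceAs (P.orbit p).Additive
    linear := inferInstanceAs ((P.orbit p).Linear ℂ)
    left := leftLinearOfIsIso _ fun x (c : C) => inferInstanceAs (IsIso (αₗ x c p).inv)
    right := rightLinearOfIsIso _ fun (c : C) y => inferInstanceAs
      (IsIso ((P.mid c p y).hom ≫ c ⊴ₗ (t.iso y).hom ≫ (αₗ c (F.obj y) p).inv))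
    mid_comm := fun x (c : C) y => by
      change (P.mid x (c ⊙ₗ p) y).hom ≫
          x ⊴ₗ ((P.mid c p y).hom ≫ c ⊴ₗ (t.iso y).hom ≫ (αₗ c (F.obj y) p).inv) ≫
          (αₗ x (c ⊗ F.obj y) p).inv =
        (αₗ x c p).inv ⊵ᵣ y ≫ ((P.mid (x ⊗ c) p y).hom ≫ (x ⊗ c) ⊴ₗ (t.iso y).hom ≫
          (αₗ (x ⊗ c) (F.obj y) p).inv) ≫ (α_ x c (F.obj y)).hom ⊵ₗ p
      have h := P.mid_assoc_left_inv x c p y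
      have h4 := actionAssocIso_inv_pentagon x c (F.obj y) p
      simp only [Category.assoc, reassoc_of% h, MonoidalLeftAction.actionHomRight_comp,
        MonoidalLeftAction.tensor_actionHomRight, Iso.inv_hom_id_assoc, ← reassoc_of% h4,
        MonoidalLeftAction.inv_hom_actionHomLeft, Category.comp_id] }

end TwistedCentral

/-! ### Bimodule functors out of `C_F` -/

section RegularFunctor

variable {C : Type u} [Category.{v} C] [Abelian C] [Linear ℂ C] [MonoidalCategory C]
  [MonoidalPreadditive C] [MonoidalLinear ℂ C] [IsFiniteSemisimple C]

variable {F : C ⥤ C} [F.Monoidal] [F.Additive] [F.Linear ℂ] {P : Bimod C}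

namespace BimodFunctor

variable (K : BimodFunctor ((regular C).restrict F) P)

/-- A bimodule functor out of `C_F`, viewed as a functor out of `C`. -/
def onC : C ⥤ P := K.toFunctor

/-- The left module structure of a bimodule functor out of `C_F`, in terms of `C`. -/
def lμ (x c : C) : x ⊙ₗ K.onC.obj c ≅ K.onC.obj (x ⊗ c) :=
  Functor.LeftLinear.μₗIso K.toFunctor x c

/-- The right module structure of a bimodule functor out of `C_F`, in terms of `C`. -/
def rμ (c y : C) : K.onC.obj c ⊙ᵣ y ≅ K.onC.obj (c ⊗ F.obj y) :=
  Functor.RightLinear.μᵣIso K.toFunctor c y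

theorem lμ_natural_left {x x' : C} (f : x ⟶ x') (c : C) :
    f ⊵ₗ K.onC.obj c ≫ (K.lμ x' c).hom = (K.lμ x c).hom ≫ K.onC.map (f ▷ c) :=
  μₗ_naturality_left K.toFunctor f c

theorem lμ_natural_right (x : C) {c c' : C} (f : c ⟶ c') :
    x ⊴ₗ K.onC.map f ≫ (K.lμ x c').hom = (K.lμ x c).hom ≫ K.onC.map (x ◁ f) :=
  μₗ_naturality_right K.toFunctor x (d := c) (d' := c') f

theorem lμ_assoc (x y c : C) :
    (K.lμ (x ⊗ y) c).hom ≫ K.onC.map (α_ x y c).hom =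
      (αₗ x y (K.onC.obj c)).hom ≫ x ⊴ₗ (K.lμ y c).hom ≫ (K.lμ x (y ⊗ c)).hom :=
  μₗ_associativity K.toFunctor x y c

theorem lμ_unit (c : C) :
    (λₗ (K.onC.obj c)).hom = (K.lμ (𝟙_ C) c).hom ≫ K.onC.map (λ_ c).hom :=
  μₗ_unitality K.toFunctor c

theorem rμ_natural_left {c c' : C} (f : c ⟶ c') (y : C) :
    K.onC.map f ⊵ᵣ y ≫ (K.rμ c' y).hom = (K.rμ c y).hom ≫ K.onC.map (f ▷ F.obj y) :=
  μᵣ_naturality_left K.toFunctor (d := c) (d' := c') f y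

theorem rμ_natural_right (c : C) {y y' : C} (f : y ⟶ y') :
    K.onC.obj c ⊴ᵣ f ≫ (K.rμ c y').hom = (K.rμ c y).hom ≫ K.onC.map (c ◁ F.map f) :=
  μᵣ_naturality_right K.toFunctor c f

theorem rμ_assoc (c x y : C) :
    (K.rμ c (x ⊗ y)).hom ≫
        K.onC.map (c ◁ Functor.OplaxMonoidal.δ F x y ≫ (α_ c (F.obj x) (F.obj y)).inv) =
      (αᵣ (K.onC.obj c) x y).hom ≫ (K.rμ c x).hom ⊵ᵣ y ≫ (K.rμ (c ⊗ F.obj x) y).hom :=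
  μᵣ_associativity K.toFunctor c x y

theorem rμ_unit (c : C) :
    (ρᵣ (K.onC.obj c)).hom =
      (K.rμ c (𝟙_ C)).hom ≫ K.onC.map (c ◁ Functor.OplaxMonoidal.η F ≫ (ρ_ c).hom) :=
  μᵣ_unitality K.toFunctor c

theorem lμ_rμ (x c y : C) :
    (P.mid x (K.onC.obj c) y).hom ≫ x ⊴ₗ (K.rμ c y).hom ≫ (K.lμ x (c ⊗ F.obj y)).hom =
      (K.lμ x c).hom ⊵ᵣ y ≫ (K.rμ (x ⊗ c) y).hom ≫ K.onC.map (α_ x c (F.obj y)).hom :=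
  K.mid_comm x c y

/-- The isomorphism `K(c) ≅ c ⊙ₗ K(𝟙)`. -/
def orbitIso (c : C) : K.onC.obj c ≅ c ⊙ₗ K.onC.obj (𝟙_ C) :=
  K.onC.mapIso (ρ_ c).symm ≪≫ (K.lμ c (𝟙_ C)).symm

theorem orbitIso_natural {c c' : C} (f : c ⟶ c') :
    K.onC.map f ≫ (K.orbitIso c').hom = (K.orbitIso c).hom ≫ f ⊵ₗ K.onC.obj (𝟙_ C) := by
  have h : K.onC.map (f ▷ 𝟙_ C) ≫ (K.lμ c' (𝟙_ C)).inv = (K.lμ c (𝟙_ C)).inv ≫ f ⊵ₗ _ := by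
    rw [Iso.comp_inv_eq, Category.assoc, lμ_natural_left, Iso.inv_hom_id_assoc]
  simp only [orbitIso, Iso.trans_hom, Functor.mapIso_hom, Iso.symm_hom, Category.assoc, ← h,
    ← Functor.map_comp_assoc, rightUnitor_inv_naturality]

theorem lμ_orbitIso (x c : C) :
    (K.lμ x c).hom ≫ (K.orbitIso (x ⊗ c)).hom =
      x ⊴ₗ (K.orbitIso c).hom ≫ (αₗ x c (K.onC.obj (𝟙_ C))).inv := by
  have h := K.lμ_assoc x c (𝟙_ C)
  have h2 := K.lμ_natural_right x (ρ_ c).inv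
  rw [← cancel_mono (αₗ x c _).hom, ← cancel_mono (x ⊴ₗ (K.lμ c (𝟙_ C)).hom),
    ← cancel_mono (K.lμ x (c ⊗ 𝟙_ C)).hom]
  simp only [orbitIso, Iso.trans_hom, Functor.mapIso_hom, Iso.symm_hom, Category.assoc, ← h,
    Iso.inv_hom_id_assoc, MonoidalLeftAction.actionHomRight_comp,
    MonoidalLeftAction.actionHomRight_inv_hom_assoc, h2, ← Functor.map_comp]
  simp

/-- The isomorphism `K(𝟙) ⊙ᵣ y ≅ K(𝟙 ⊗ F(y)) ≅ F(y) ⊙ₗ K(𝟙)`. -/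
def unitIso (y : C) : K.onC.obj (𝟙_ C) ⊙ᵣ y ≅ F.obj y ⊙ₗ K.onC.obj (𝟙_ C) :=
  K.rμ (𝟙_ C) y ≪≫ K.onC.mapIso (λ_ (F.obj y)) ≪≫ K.orbitIso (F.obj y)

theorem rμ_orbitIso (c y : C) :
    (K.rμ c y).hom ≫ (K.orbitIso (c ⊗ F.obj y)).hom = (K.orbitIso c).hom ⊵ᵣ y ≫
      (P.mid c (K.onC.obj (𝟙_ C)) y).hom ≫ c ⊴ₗ (K.unitIso y).hom ≫
        (αₗ c (F.obj y) (K.onC.obj (𝟙_ C))).inv := by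
  have h := K.lμ_rμ c (𝟙_ C) y
  have h1 := K.lμ_orbitIso c (F.obj y)
  have h2 := K.lμ_natural_right c (λ_ (F.obj y)).hom
  rw [← cancel_epi ((K.orbitIso c).inv ⊵ᵣ y)]
  simp only [unitIso, MonoidalRightAction.inv_hom_actionHomLeft_assoc, Iso.trans_hom,
    MonoidalLeftAction.actionHomRight_comp, Category.assoc, ← h1, Functor.mapIso_hom,
    reassoc_of% h2, reassoc_of% h]
  have h3 := K.rμ_natural_left (ρ_ c).hom y
  simp only [orbitIso, Iso.trans_inv, Functor.mapIso_inv, Iso.symm_inv, Category.assoc,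
    MonoidalRightAction.comp_actionHomLeft, reassoc_of% h3, ← Functor.map_comp_assoc,
    triangle]

/-- The value at the unit object of a bimodule functor out of `C_F` is `F`-twisted central. -/
def twistedCentral : TwistedCentral F P (K.onC.obj (𝟙_ C)) where
  iso := K.unitIso
  naturality f := by
    have h := K.rμ_natural_right (𝟙_ C) f
    simp only [unitIso, Iso.trans_hom, Functor.mapIso_hom, reassoc_of% h, Category.assoc,
      ← orbitIso_natural, ← Functor.map_comp_assoc, leftUnitor_naturality]
  hexagon x y := by
    have h := K.rμ_orbitIso (F.obj x) y
    have h1 := K.rμ_natural_left (λ_ (F.obj x)).hom y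
    have h2 := K.rμ_assoc (𝟙_ C) x y
    have h3 := K.orbitIso_natural (Functor.LaxMonoidal.μ F x y)
    have h4 : (K.unitIso x).hom ⊵ᵣ y = (K.rμ (𝟙_ C) x).hom ⊵ᵣ y ≫
        K.onC.map (λ_ (F.obj x)).hom ⊵ᵣ y ≫ (K.orbitIso (F.obj x)).hom ⊵ᵣ y := by
      simp [unitIso]
    rw [h4]
    simp only [Category.assoc, ← reassoc_of% h, reassoc_of% h1, ← reassoc_of% h2, ← h3]
    simp only [unitIso, Iso.trans_hom, Functor.mapIso_hom, ← Functor.map_comp_assoc]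
    congr 3
    rw [Category.assoc, ← leftUnitor_tensor_hom_assoc,
      leftUnitor_naturality_assoc, Functor.Monoidal.δ_μ, Category.comp_id]
  unit := by
    have h := K.rμ_unit (𝟙_ C)
    have h3 := K.orbitIso_natural (Functor.LaxMonoidal.ε F)
    have h4 := K.lμ_unit (𝟙_ C)
    have h5 : (λₗ (K.onC.obj (𝟙_ C))).inv = (K.orbitIso (𝟙_ C)).hom := by
      rw [← cancel_epi (λₗ[C] (K.onC.obj (𝟙_ C))).hom, Iso.hom_inv_id, h4]
      simp only [orbitIso, Iso.trans_hom, Functor.mapIso_hom, Iso.symm_hom, Category.assoc,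
        ← Functor.map_comp_assoc, unitors_equal, Iso.hom_inv_id]
      simp
    rw [h, h5, ← h3]
    simp only [unitIso, Iso.trans_hom, Functor.mapIso_hom, Category.assoc,
      ← Functor.map_comp_assoc]
    congr 3
    rw [← unitors_equal, leftUnitor_naturality_assoc, Functor.Monoidal.η_ε,
      Category.comp_id]

end BimodFunctor

end RegularFunctor

/-! ### Generators of bimodule categories and their coordinates -/

section Coordinates

variable {C : Type u} [Category.{v} C] [Abelian C] [Linear ℂ C] [MonoidalCategory C]

namespace TwistedCentral

variable {F : C ⥤ C} [F.Monoidal] {P : Bimod C} {p : P}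

/-- A twisted central structure can be transported along a monoidal isomorphism of the twisting
functors. -/
def ofTwistIso (t : TwistedCentral F P p) {F' : C ⥤ C} [F'.Monoidal] (e : F ≅ F')
    [NatTrans.IsMonoidal e.hom] : TwistedCentral F' P p where
  iso y :=
    { hom := (t.iso y).hom ≫ e.hom.app y ⊵ₗ p
      inv := e.inv.app y ⊵ₗ p ≫ (t.iso y).inv
      hom_inv_id := by simp [← MonoidalLeftAction.comp_actionHomLeft_assoc]
      inv_hom_id := by simp [← MonoidalLeftAction.comp_actionHomLeft] }
  naturality f := by
    rw [← Category.assoc, t.naturality, Category.assoc, Category.assoc,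
      ← MonoidalLeftAction.comp_actionHomLeft, ← MonoidalLeftAction.comp_actionHomLeft,
      e.hom.naturality]
  hexagon x y := by
    have h := NatTrans.IsMonoidal.tensor (τ := e.hom) x y
    have h1 := P.mid_naturality_left (e.hom.app x) p y
    have h2 : (e.hom.app x ⊵ₗ (F.obj y ⊙ₗ p)) ≫ F'.obj x ⊴ₗ (e.hom.app y ⊵ₗ p) ≫
        (αₗ (F'.obj x) (F'.obj y) p).inv = (αₗ (F.obj x) (F.obj y) p).inv ≫
          (e.hom.app x ⊗ₘ e.hom.app y) ⊵ₗ p := by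
      rw [MonoidalCategory.tensorHom_def, MonoidalLeftAction.comp_actionHomLeft,
        MonoidalLeftAction.whiskerLeft_actionHomLeft, MonoidalLeftAction.actionHomLeft_action]
      simp
    dsimp only
    rw [t.hexagon]
    simp only [MonoidalRightAction.comp_actionHomLeft, Category.assoc, reassoc_of% h1,
      MonoidalLeftAction.actionHomRight_comp, ← MonoidalLeftAction.action_exchange_assoc]
    rw [MonoidalLeftAction.action_exchange_assoc, reassoc_of% h2,
      ← MonoidalLeftAction.comp_actionHomLeft, ← MonoidalLeftAction.comp_actionHomLeft, h]
  unit := by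
    have h := NatTrans.IsMonoidal.unit (τ := e.hom)
    dsimp only
    rw [t.unit, Category.assoc, Category.assoc, ← MonoidalLeftAction.comp_actionHomLeft, h]

/-- An `F`-twisted central object of `P` is `F ∘ G`-twisted central in the restriction `P_G`. -/
def restrict (t : TwistedCentral F P p) (G : C ⥤ C) [G.Monoidal] [G.Additive] [G.Linear ℂ] :
    TwistedCentral (G ⋙ F) (P.restrict G) p where
  iso y := t.iso (G.obj y)
  naturality f := t.naturality (G.map f)
  hexagon x y := by
    change (t.iso (G.obj (x ⊗ y))).hom = (p ⊴ᵣ Functor.OplaxMonoidal.δ G x y ≫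
      (αᵣ p (G.obj x) (G.obj y)).hom) ≫ (t.iso (G.obj x)).hom ⊵ᵣ G.obj y ≫
      (P.mid (F.obj (G.obj x)) p (G.obj y)).hom ≫ F.obj (G.obj x) ⊴ₗ (t.iso (G.obj y)).hom ≫
      (αₗ (F.obj (G.obj x)) (F.obj (G.obj y)) p).inv ≫
      (Functor.LaxMonoidal.μ F (G.obj x) (G.obj y) ≫ F.map (Functor.LaxMonoidal.μ G x y)) ⊵ₗ p
    have h := t.hexagon (G.obj x) (G.obj y)
    rw [MonoidalLeftAction.comp_actionHomLeft, Category.assoc]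
    rw [← reassoc_of% h, ← t.naturality, ← MonoidalRightAction.actionHomRight_comp_assoc]
    simp
  unit := by
    change (t.iso (G.obj (𝟙_ C))).hom = (p ⊴ᵣ Functor.OplaxMonoidal.η G ≫ (ρᵣ p).hom) ≫
      (λₗ p).inv ≫ (Functor.LaxMonoidal.ε F ≫ F.map (Functor.LaxMonoidal.ε G)) ⊵ₗ p
    have h := t.unit
    rw [MonoidalLeftAction.comp_actionHomLeft, Category.assoc, ← reassoc_of% h, ← t.naturality,
      ← MonoidalRightAction.actionHomRight_comp_assoc]
    simp

end TwistedCentral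

/-- `P` is generated by a twisted central object: for some `F`-twisted central `p : P` the functor
`c ↦ c ⊙ₗ p` is an equivalence `C ≌ P`. -/
def IsTwistOf (F : C ⥤ C) [F.Monoidal] (P : Bimod C) : Prop :=
  ∃ (p : P) (_ : TwistedCentral F P p), (P.orbit p).IsEquivalence

theorem IsTwistOf.ofTwistIso {F F' : C ⥤ C} [F.Monoidal] [F'.Monoidal] {P : Bimod C}
    (h : IsTwistOf F P) (e : F ≅ F') [NatTrans.IsMonoidal e.hom] : IsTwistOf F' P :=
  let ⟨p, t, hp⟩ := h
  ⟨p, t.ofTwistIso e, hp⟩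

theorem IsTwistOf.restrict {F : C ⥤ C} [F.Monoidal] {P : Bimod C} (h : IsTwistOf F P)
    (G : C ⥤ C) [G.Monoidal] [G.Additive] [G.Linear ℂ] : IsTwistOf (G ⋙ F) (P.restrict G) :=
  let ⟨p, t, hp⟩ := h
  ⟨p, t.restrict G, hp⟩

variable [MonoidalPreadditive C] [MonoidalLinear ℂ C] [IsFiniteSemisimple C]

/-- `C_F` is equivalent to `P` if and only if `P` is generated by an `F`-twisted central object. -/
theorem equivalent_iff_isTwistOf {F : C ⥤ C} [F.Monoidal] [F.Additive] [F.Linear ℂ]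
    {P : Bimod C} : ((regular C).restrict F).Equivalent P ↔ IsTwistOf F P := by
  constructor
  · rintro ⟨K, hK⟩
    have : K.onC.IsEquivalence := hK
    exact ⟨_, K.twistedCentral,
      Functor.isEquivalence_of_iso (NatIso.ofComponents K.orbitIso K.orbitIso_natural)⟩
  · rintro ⟨p, t, hp⟩
    exact ⟨t.functor, hp⟩

theorem isTwistOf_self (F : C ⥤ C) [F.Monoidal] [F.Additive] [F.Linear ℂ] :
    IsTwistOf F ((regular C).restrict F) :=
  equivalent_iff_isTwistOf.1 ((Bimod.setoid C).iseqv.refl _)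

theorem IsTwistOf.of_equivalent {F : C ⥤ C} [F.Monoidal] [F.Additive] [F.Linear ℂ]
    {P Q : Bimod C} (h : IsTwistOf F P) (e : P.Equivalent Q) : IsTwistOf F Q :=
  equivalent_iff_isTwistOf.1 ((Bimod.setoid C).iseqv.trans (equivalent_iff_isTwistOf.2 h) e)

theorem IsTwistOf.equivalent {F : C ⥤ C} [F.Monoidal] [F.Additive] [F.Linear ℂ]
    {P Q : Bimod C} (h : IsTwistOf F P) (h' : IsTwistOf F Q) : P.Equivalent Q :=
  (Bimod.setoid C).iseqv.trans
    ((Bimod.setoid C).iseqv.symm (equivalent_iff_isTwistOf.2 h)) (equivalent_iff_isTwistOf.2 h')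

namespace TwistedCentral

variable {G : C ⥤ C} [G.Monoidal] [G.Additive] [G.Linear ℂ] {N : Bimod C} {n₀ : N}
  (t : TwistedCentral G N n₀) [hn : (N.orbit n₀).IsEquivalence]

instance : t.functor.toFunctor.IsEquivalence := hn

/-- The coordinate functor `N ⥤ C` with respect to a generator `n₀`: the quasi-inverse of
`c ↦ c ⊙ₗ n₀`. -/
def coord : N ⥤ C := t.functor.inverse.toFunctor

instance : t.coord.Additive := t.functor.inverse.additive

instance : t.coord.Linear ℂ := t.functor.inverse.linear

/-- The isomorphism which expresses an object through its coordinate. -/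
def coordIso (n : N) : t.coord.obj n ⊙ₗ n₀ ≅ n := t.functor.counit n

theorem coordIso_natural {n n' : N} (f : n ⟶ n') :
    t.coord.map f ⊵ₗ n₀ ≫ (t.coordIso n').hom = (t.coordIso n).hom ≫ f :=
  t.functor.counit_naturality f

/-- The left module structure of the coordinate functor. -/
def coordₗ (x : C) (n : N) : x ⊗ t.coord.obj n ≅ t.coord.obj (x ⊙ₗ n) :=
  Functor.LeftLinear.μₗIso t.functor.inverse.toFunctor x n

/-- The right module structure of the coordinate functor. -/
def coordᵣ (n : N) (y : C) : t.coord.obj n ⊗ G.obj y ≅ t.coord.obj (n ⊙ᵣ y) :=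
  Functor.RightLinear.μᵣIso t.functor.inverse.toFunctor n y

theorem coordₗ_natural_left {x x' : C} (f : x ⟶ x') (n : N) :
    f ▷ t.coord.obj n ≫ (t.coordₗ x' n).hom = (t.coordₗ x n).hom ≫ t.coord.map (f ⊵ₗ n) :=
  μₗ_naturality_left t.functor.inverse.toFunctor f n

theorem coordₗ_natural_right (x : C) {n n' : N} (f : n ⟶ n') :
    x ◁ t.coord.map f ≫ (t.coordₗ x n').hom = (t.coordₗ x n).hom ≫ t.coord.map (x ⊴ₗ f) :=
  μₗ_naturality_right t.functor.inverse.toFunctor x f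

theorem coordₗ_assoc (x y : C) (n : N) :
    (t.coordₗ (x ⊗ y) n).hom ≫ t.coord.map (αₗ x y n).hom =
      (α_ x y (t.coord.obj n)).hom ≫ x ◁ (t.coordₗ y n).hom ≫ (t.coordₗ x (y ⊙ₗ n)).hom :=
  μₗ_associativity t.functor.inverse.toFunctor x y n

theorem coordₗ_unit (n : N) :
    (λ_ (t.coord.obj n)).hom = (t.coordₗ (𝟙_ C) n).hom ≫ t.coord.map (λₗ n).hom :=
  μₗ_unitality (C := C) t.functor.inverse.toFunctor n

theorem coordᵣ_natural_left {n n' : N} (f : n ⟶ n') (y : C) :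
    t.coord.map f ▷ G.obj y ≫ (t.coordᵣ n' y).hom = (t.coordᵣ n y).hom ≫ t.coord.map (f ⊵ᵣ y) :=
  μᵣ_naturality_left t.functor.inverse.toFunctor f y

theorem coordᵣ_natural_right (n : N) {y y' : C} (f : y ⟶ y') :
    t.coord.obj n ◁ G.map f ≫ (t.coordᵣ n y').hom = (t.coordᵣ n y).hom ≫ t.coord.map (n ⊴ᵣ f) :=
  μᵣ_naturality_right t.functor.inverse.toFunctor n f

theorem coordᵣ_assoc (n : N) (x y : C) :
    (t.coordᵣ n (x ⊗ y)).hom ≫ t.coord.map (αᵣ n x y).hom =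
      (t.coord.obj n ◁ Functor.OplaxMonoidal.δ G x y ≫
        (α_ (t.coord.obj n) (G.obj x) (G.obj y)).inv) ≫
          (t.coordᵣ n x).hom ▷ G.obj y ≫ (t.coordᵣ (n ⊙ᵣ x) y).hom :=
  μᵣ_associativity t.functor.inverse.toFunctor n x y

theorem coordᵣ_unit (n : N) :
    t.coord.obj n ◁ Functor.OplaxMonoidal.η G ≫ (ρ_ (t.coord.obj n)).hom =
      (t.coordᵣ n (𝟙_ C)).hom ≫ t.coord.map (ρᵣ n).hom :=
  μᵣ_unitality (C := C) t.functor.inverse.toFunctor n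

theorem coord_mid (x : C) (n : N) (y : C) :
    (α_ x (t.coord.obj n) (G.obj y)).hom ≫ x ◁ (t.coordᵣ n y).hom ≫ (t.coordₗ x (n ⊙ᵣ y)).hom =
      (t.coordₗ x n).hom ▷ G.obj y ≫ (t.coordᵣ (x ⊙ₗ n) y).hom ≫ t.coord.map (N.mid x n y).hom :=
  t.functor.inverse.mid_comm x n y

theorem coordₗ_coordIso (x : C) (n : N) :
    (t.coordₗ x n).hom ⊵ₗ n₀ ≫ (t.coordIso (x ⊙ₗ n)).hom =
      (αₗ x (t.coord.obj n) n₀).hom ≫ x ⊴ₗ (t.coordIso n).hom := by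
  have h : (t.coordₗ x n).hom ⊵ₗ n₀ = CategoryTheory.inv (αₗ x (t.coord.obj n) n₀).inv ≫
      x ⊴ₗ (t.coordIso n).hom ≫ (t.coordIso (x ⊙ₗ n)).inv := t.functor.map_invμₗ x n
  rw [h]
  simp

/-- The generator has coordinate `𝟙`. -/
def coordUnit : 𝟙_ C ≅ t.coord.obj n₀ :=
  (N.orbit n₀).preimageIso (λₗ n₀ ≪≫ (t.coordIso n₀).symm)

theorem coordUnit_coordIso :
    t.coordUnit.hom ⊵ₗ n₀ ≫ (t.coordIso n₀).hom = (λₗ n₀).hom := by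
  have h : t.coordUnit.hom ⊵ₗ n₀ = (λₗ n₀).hom ≫ (t.coordIso n₀).inv :=
    (N.orbit n₀).map_preimage _
  rw [h]
  simp

theorem coord_triangle (n : N) :
    (ρ_ (t.coord.obj n)).inv ≫ t.coord.obj n ◁ t.coordUnit.hom ≫
      (t.coordₗ (t.coord.obj n) n₀).hom ≫ t.coord.map (t.coordIso n).hom = 𝟙 _ := by
  apply (N.orbit n₀).map_injective
  change _ ⊵ₗ n₀ = _ ⊵ₗ n₀
  rw [← cancel_mono (t.coordIso n).hom]
  simp only [MonoidalLeftAction.comp_actionHomLeft, Category.assoc, coordIso_natural]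
  have h := t.coordₗ_coordIso (t.coord.obj n) n₀
  rw [reassoc_of% h, MonoidalLeftAction.whiskerLeft_actionHomLeft]
  simp only [Category.assoc, Iso.inv_hom_id_assoc,
    ← MonoidalLeftAction.actionHomRight_comp_assoc, coordUnit_coordIso]
  rw [← MonoidalLeftAction.rightUnitor_actionHom_assoc,
    MonoidalLeftAction.inv_hom_actionHomLeft_assoc, MonoidalLeftAction.id_actionHomLeft,
    Category.id_comp]

end TwistedCentral

end Coordinates

/-! ### Universal balanced functors -/

section Universal

variable {C : Type u} [Category.{v} C] [Abelian C] [Linear ℂ C] [MonoidalCategory C]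

namespace BalancedFunctor

variable {M N : Bimod C} {A A' : Type u} [Category.{v} A] [Abelian A] [Linear ℂ A]
  [Category.{v} A'] [Abelian A'] [Linear ℂ A']

theorem IsHom.inv {B B' : BalancedFunctor M N A} {τ : B.toFunctor ≅ B'.toFunctor}
    (h : IsHom τ.hom) : IsHom τ.inv := by
  intro m x n
  have h := h m x n
  rw [← cancel_epi ((τ.hom.app (m ⊙ᵣ x)).app n), ← cancel_mono ((τ.hom.app m).app (x ⊙ₗ n))]
  simp [← NatTrans.comp_app, ← NatTrans.comp_app_assoc, h]

/-- A balanced natural isomorphism `T ∘ B ≅ T' ∘ B` comes from an isomorphism `T ≅ T'` if `B` is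
universal. -/
theorem IsUniversal.exists_iso {B : BalancedFunctor M N A} (hB : B.IsUniversal)
    [IsFiniteSemisimple A'] (T T' : A ⥤ A') [T.Additive] [T.Linear ℂ] [T'.Additive] [T'.Linear ℂ]
    (τ : (B.postcomp T).toFunctor ≅ (B.postcomp T').toFunctor) (hτ : IsHom τ.hom) :
    ∃ σ : T ≅ T', ∀ m n, (τ.hom.app m).app n = σ.hom.app ((B.toFunctor.obj m).obj n) := by
  obtain ⟨σ, hσ, -⟩ := (hB A').2 T T' τ.hom hτ
  obtain ⟨σ', hσ', -⟩ := (hB A').2 T' T τ.inv hτ.inv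
  refine ⟨⟨σ, σ', ?_, ?_⟩, hσ⟩
  · refine ((hB A').2 T T (𝟙 _) fun m x n => ?_).unique (fun m n => ?_) (fun m n => ?_)
    · simp
    · have h := congrArg (fun s => (s.app m).app n) τ.hom_inv_id
      exact h.symm.trans (congrArg₂ (· ≫ ·) (hσ m n) (hσ' m n))
    · rfl
  · refine ((hB A').2 T' T' (𝟙 _) fun m x n => ?_).unique (fun m n => ?_) (fun m n => ?_)
    · simp
    · have h := congrArg (fun s => (s.app m).app n) τ.inv_hom_id
      exact h.symm.trans (congrArg₂ (· ≫ ·) (hσ' m n) (hσ m n))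
    · rfl

/-- The components of a transformation `T ∘ B ⟶ B'`. -/
def postcompApp {B : BalancedFunctor M N A} {T : A ⥤ A'} [T.Additive] [T.Linear ℂ]
    {B' : BalancedFunctor M N A'} (τ : (B.postcomp T).toFunctor ⟶ B'.toFunctor) (m : M) (n : N) :
    T.obj ((B.toFunctor.obj m).obj n) ⟶ (B'.toFunctor.obj m).obj n :=
  (τ.app m).app n

theorem IsHom.postcompApp {B : BalancedFunctor M N A} {T : A ⥤ A'} [T.Additive] [T.Linear ℂ]
    {B' : BalancedFunctor M N A'} {τ : (B.postcomp T).toFunctor ⟶ B'.toFunctor} (h : IsHom τ)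
    (m : M) (x : C) (n : N) : postcompApp τ (m ⊙ᵣ x) n ≫ (B'.bal m x n).hom =
      T.map (B.bal m x n).hom ≫ postcompApp τ m (x ⊙ₗ n) :=
  h m x n

/-- The comparison functors between the targets of two balanced functors are inverse to each other
on the side of a universal one. -/
theorem IsUniversal.nonempty_comp_iso_id [IsFiniteSemisimple A] {B : BalancedFunctor M N A}
    (hB : B.IsUniversal) {B' : BalancedFunctor M N A'} (T : A ⥤ A') (T' : A' ⥤ A) [T.Additive]
    [T.Linear ℂ] [T'.Additive] [T'.Linear ℂ] (e : (B.postcomp T).toFunctor ≅ B'.toFunctor)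
    (he : IsHom e.hom) (e' : (B'.postcomp T').toFunctor ≅ B.toFunctor) (he' : IsHom e'.hom) :
    Nonempty (T ⋙ T' ≅ 𝟭 A) := by
  let τ : (B.postcomp (T ⋙ T')).toFunctor ≅ (B.postcomp (𝟭 A)).toFunctor :=
    Functor.isoWhiskerRight e ((Functor.whiskeringRight N A' A).obj T') ≪≫ e'
  refine (hB.exists_iso (T ⋙ T') (𝟭 A) τ fun m x n => ?_).nonempty
  change (T'.map (BalancedFunctor.postcompApp e.hom (m ⊙ᵣ x) n) ≫
      BalancedFunctor.postcompApp e'.hom (m ⊙ᵣ x) n) ≫ (B.bal m x n).hom =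
    T'.map (T.map (B.bal m x n).hom) ≫ T'.map (BalancedFunctor.postcompApp e.hom m (x ⊙ₗ n)) ≫
      BalancedFunctor.postcompApp e'.hom m (x ⊙ₗ n)
  rw [Category.assoc, he'.postcompApp, ← Functor.map_comp_assoc, ← Functor.map_comp_assoc,
    he.postcompApp]

/-- Universal balanced functors are unique up to an equivalence of their targets. -/
theorem IsUniversal.exists_equivalence [IsFiniteSemisimple A] [IsFiniteSemisimple A']
    {B : BalancedFunctor M N A} (hB : B.IsUniversal) {B' : BalancedFunctor M N A'}
    (hB' : B'.IsUniversal) : ∃ (T : A ⥤ A') (_ : T.Additive) (_ : T.Linear ℂ)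
      (_ : (B.postcomp T).toFunctor ≅ B'.toFunctor), T.IsEquivalence := by
  obtain ⟨T, _, _, e, he⟩ := (hB A').1 B'
  obtain ⟨T', _, _, e', he'⟩ := (hB' A).1 B
  obtain ⟨σ⟩ := hB.nonempty_comp_iso_id T T' e he e' he'
  obtain ⟨σ'⟩ := hB'.nonempty_comp_iso_id T' T e' he' e he
  exact ⟨T, inferInstance, inferInstance, e,
    (CategoryTheory.Equivalence.mk T T' σ.symm σ').isEquivalence_functor⟩

/-- The composite of a universal balanced functor with an equivalence is universal. -/
theorem IsUniversal.postcomp {B : BalancedFunctor M N A} (hB : B.IsUniversal) (T : A ⥤ A')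
    [T.Additive] [T.Linear ℂ] [T.IsEquivalence] : (B.postcomp T).IsUniversal := by
  intro D _ _ _ _
  refine ⟨fun B' => ?_, fun S S' _ _ _ _ τ hτ => ?_⟩
  · obtain ⟨S, _, _, e, he⟩ := (hB D).1 B'
    have : T.asEquivalence.functor.Additive := inferInstanceAs T.Additive
    have : T.asEquivalence.functor.Linear ℂ := inferInstanceAs (T.Linear ℂ)
    have : T.inv.Additive := inferInstanceAs T.asEquivalence.inverse.Additive
    have : T.inv.Linear ℂ := inferInstanceAs (T.asEquivalence.inverse.Linear ℂ)
    let ν : T ⋙ T.inv ⋙ S ≅ S := Functor.isoWhiskerRight T.asEquivalence.unitIso.symm S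
    let κ : ((B.postcomp T).postcomp (T.inv ⋙ S)).toFunctor ≅ (B.postcomp S).toFunctor :=
      Functor.isoWhiskerLeft B.toFunctor ((Functor.whiskeringRight N A D).mapIso ν)
    refine ⟨T.inv ⋙ S, inferInstance, inferInstance, κ ≪≫ e, fun m x n => ?_⟩
    change (ν.hom.app _ ≫ BalancedFunctor.postcompApp e.hom (m ⊙ᵣ x) n) ≫ (B'.bal m x n).hom =
      (T ⋙ T.inv ⋙ S).map (B.bal m x n).hom ≫ ν.hom.app _ ≫
        BalancedFunctor.postcompApp e.hom m (x ⊙ₗ n)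
    rw [Category.assoc, he.postcompApp, ν.hom.naturality_assoc]
  · obtain ⟨σ, hσ, huniq⟩ := (hB D).2 (T ⋙ S) (T ⋙ S') τ hτ
    obtain ⟨ρ, hρ⟩ := ((Functor.whiskeringLeft A A' D).obj T).map_surjective σ
    refine ⟨ρ, fun m n => ?_, fun ρ' hρ' => ?_⟩
    · rw [hσ, ← hρ]
      rfl
    · apply ((Functor.whiskeringLeft A A' D).obj T).map_injective
      rw [hρ]
      exact huniq _ hρ'

end BalancedFunctor

end Universal

section Restrict

theorem actionRightAssocIso_inv_pentagon {C D : Type*} [Category* C] [MonoidalCategory C]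
    [Category* D] [MonoidalRightAction C D] (m : D) (x y z : C) :
    (αᵣ m (x ⊗ y) z).inv ≫ m ⊴ᵣ (α_ x y z).hom =
      (αᵣ m x y).hom ⊵ᵣ z ≫ (αᵣ (m ⊙ᵣ x) y z).inv ≫ (αᵣ m x (y ⊗ z)).inv := by
  rw [Iso.inv_comp_eq, ← MonoidalRightAction.actionHom_associator_assoc]
  simp

variable {C : Type u} [Category.{v} C] [Abelian C] [Linear ℂ C] [MonoidalCategory C]
  [MonoidalPreadditive C] [MonoidalLinear ℂ C] [IsFiniteSemisimple C]
  {G : C ⥤ C} [G.Monoidal] [G.Additive] [G.Linear ℂ] {N : Bimod C} {n₀ : N}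

/-- The balanced functor `M × N ⟶ M`, `(m, n) ↦ m ⊙ᵣ c(n)`, where `c(n)` is the coordinate of `n`
with respect to a generator. -/
def TwistedCentral.balanced (t : TwistedCentral G N n₀) [(N.orbit n₀).IsEquivalence]
    (M : Bimod C) : BalancedFunctor M N M where
  toFunctor :=
    { obj m :=
        { obj n := m ⊙ᵣ t.coord.obj n
          map f := m ⊴ᵣ t.coord.map f }
      map f :=
        { app n := f ⊵ᵣ t.coord.obj n
          naturality n n' g := MonoidalRightAction.action_exchange f (t.coord.map g) } }
  additive_left n :=
    { map_add := fun {m m' f g} => M.right_additive_left m m' f g (t.coord.obj n) }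
  linear_left n :=
    { map_smul := fun {m m'} f r => M.right_linear_left m m' r f (t.coord.obj n) }
  additive_right m :=
    { map_add := fun {n n' f g} => by
        change m ⊴ᵣ t.coord.map (f + g) = m ⊴ᵣ t.coord.map f + m ⊴ᵣ t.coord.map g
        rw [Functor.map_add, M.right_additive_right] }
  linear_right m :=
    { map_smul := fun {n n'} f r => by
        change m ⊴ᵣ t.coord.map (r • f) = r • m ⊴ᵣ t.coord.map f
        rw [Functor.map_smul, M.right_linear_right] }
  bal m x n :=
    { hom := (αᵣ m x (t.coord.obj n)).inv ≫ m ⊴ᵣ (t.coordₗ x n).hom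
      inv := m ⊴ᵣ (t.coordₗ x n).inv ≫ (αᵣ m x (t.coord.obj n)).hom }
  bal_naturality_left f x n := by
    dsimp only
    rw [Category.assoc, MonoidalRightAction.action_exchange]
    simp
  bal_naturality_middle m x x' f n := by
    have h := t.coordₗ_natural_left f n
    dsimp only
    rw [Category.assoc, ← MonoidalRightAction.actionHomRight_comp, ← h]
    simp
  bal_naturality_right m x n n' f := by
    have h := t.coordₗ_natural_right x f
    dsimp only
    rw [Category.assoc, ← MonoidalRightAction.actionHomRight_comp, ← h]
    simp
  bal_assoc m x y n := by
    have h := t.coordₗ_assoc x y n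
    dsimp only
    rw [Category.assoc, ← MonoidalRightAction.actionHomRight_comp, h]
    simp [reassoc_of% actionRightAssocIso_inv_pentagon]
  bal_unit m n := by
    have h := t.coordₗ_unit n
    dsimp only
    rw [Category.assoc, ← MonoidalRightAction.actionHomRight_comp, ← h]
    simp

/-- The isomorphism `m ≅ m ⊙ᵣ c(n₀)`, which exists as `n₀` has coordinate `𝟙`. -/
def TwistedCentral.actCoordUnit (t : TwistedCentral G N n₀) [(N.orbit n₀).IsEquivalence]
    {M : Bimod C} (m : M) : m ≅ m ⊙ᵣ t.coord.obj n₀ where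
  hom := (ρᵣ m).inv ≫ m ⊴ᵣ t.coordUnit.hom
  inv := m ⊴ᵣ t.coordUnit.inv ≫ (ρᵣ m).hom

theorem TwistedCentral.actCoordUnit_natural (t : TwistedCentral G N n₀)
    [(N.orbit n₀).IsEquivalence] {M : Bimod C} {m m' : M} (f : m ⟶ m') :
    f ≫ (t.actCoordUnit m').hom = (t.actCoordUnit m).hom ≫ f ⊵ᵣ t.coord.obj n₀ := by
  dsimp only [actCoordUnit]
  rw [Category.assoc, MonoidalRightAction.action_exchange]
  simp

theorem TwistedCentral.actCoordUnit_triangle (t : TwistedCentral G N n₀)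
    [(N.orbit n₀).IsEquivalence] {M : Bimod C} (m : M) (n : N) :
    (t.actCoordUnit (m ⊙ᵣ t.coord.obj n)).hom ≫
      ((αᵣ m (t.coord.obj n) (t.coord.obj n₀)).inv ≫ m ⊴ᵣ (t.coordₗ (t.coord.obj n) n₀).hom) ≫
        m ⊴ᵣ t.coord.map (t.coordIso n).hom = 𝟙 _ := by
  have h := congrArg (fun s => m ⊴ᵣ s) (t.coord_triangle n)
  have h' : (ρᵣ (m ⊙ᵣ t.coord.obj n)).inv ≫ (αᵣ m (t.coord.obj n) (𝟙_ C)).inv =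
      m ⊴ᵣ (ρ_ (t.coord.obj n)).inv := by
    rw [← cancel_mono (m ⊴ᵣ (ρ_ (t.coord.obj n)).hom), MonoidalRightAction.actionHomRight_inv_hom]
    simp
  simp only [MonoidalRightAction.actionHomRight_comp, MonoidalRightAction.actionHomRight_id] at h
  dsimp only [actCoordUnit]
  rw [MonoidalRightAction.action_actionHomRight]
  simp only [Category.assoc, Iso.hom_inv_id_assoc, reassoc_of% h', h]

/-- A balanced functor `B'` on `M × N` is determined by its restriction to the generator, since
`B'(m, n) ≅ B'(m, c(n) ⊙ₗ n₀) ≅ B'(m ⊙ᵣ c(n), n₀)`. -/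
theorem TwistedCentral.balanced_isUniversal (t : TwistedCentral G N n₀)
    [(N.orbit n₀).IsEquivalence] (M : Bimod C) : (t.balanced M).IsUniversal := by
  intro D _ _ _ _
  refine ⟨fun B' => ?_, fun T T' _ _ _ _ τ hτ => ?_⟩
  · refine ⟨B'.toFunctor.flip.obj n₀, B'.additive_left n₀, B'.linear_left n₀,
      NatIso.ofComponents (fun m => NatIso.ofComponents (fun n =>
        B'.bal m (t.coord.obj n) n₀ ≪≫ (B'.toFunctor.obj m).mapIso (t.coordIso n)) ?_) ?_, ?_⟩
    · intro n n' f
      have h := B'.bal_naturality_middle m (t.coord.map f) n₀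
      change (B'.toFunctor.map (m ⊴ᵣ t.coord.map f)).app n₀ ≫ (B'.bal _ _ _).hom ≫
        (B'.toFunctor.obj m).map _ = ((B'.bal _ _ _).hom ≫
          (B'.toFunctor.obj m).map _) ≫ (B'.toFunctor.obj m).map f
      rw [reassoc_of% h, Category.assoc, ← Functor.map_comp, ← Functor.map_comp,
        t.coordIso_natural]
    · intro m m' f
      ext n
      have h := B'.bal_naturality_left f (t.coord.obj n) n₀
      change (B'.toFunctor.map (f ⊵ᵣ t.coord.obj n)).app n₀ ≫ (B'.bal _ _ _).hom ≫
        (B'.toFunctor.obj m').map _ = ((B'.bal _ _ _).hom ≫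
          (B'.toFunctor.obj m).map _) ≫ (B'.toFunctor.map f).app n
      rw [reassoc_of% h, Category.assoc, NatTrans.naturality]
    · intro m x n
      have h := B'.bal_assoc m x (t.coord.obj n) n₀
      have h1 := t.coordₗ_coordIso x n
      have h2 := B'.bal_naturality_right m x (t.coordIso n).hom
      have h3 := B'.bal_naturality_middle m (t.coordₗ x n).hom n₀
      change ((B'.bal _ _ _).hom ≫ (B'.toFunctor.obj (m ⊙ᵣ x)).map (t.coordIso n).hom) ≫
          (B'.bal m x n).hom =
        (B'.toFunctor.map ((αᵣ m x (t.coord.obj n)).inv ≫ m ⊴ᵣ (t.coordₗ x n).hom)).app n₀ ≫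
          (B'.bal _ _ _).hom ≫ (B'.toFunctor.obj m).map (t.coordIso (x ⊙ₗ n)).hom
      rw [Category.assoc, h2, Functor.map_comp, NatTrans.comp_app, Category.assoc,
        reassoc_of% h3, ← Functor.map_comp, h1, Functor.map_comp, reassoc_of% h,
        ← NatTrans.comp_app_assoc, ← Functor.map_comp]
      simp
  · let τ' (m : M) (n : N) : T.obj (m ⊙ᵣ t.coord.obj n) ⟶ T'.obj (m ⊙ᵣ t.coord.obj n) :=
      (τ.app m).app n
    have hτ₁ {m m' : M} (f : m ⟶ m') (n : N) :
        T.map (f ⊵ᵣ t.coord.obj n) ≫ τ' m' n = τ' m n ≫ T'.map (f ⊵ᵣ t.coord.obj n) :=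
      congrArg (fun s => s.app n) (τ.naturality f)
    have hτ₂ (m : M) {n n' : N} (f : n ⟶ n') :
        T.map (m ⊴ᵣ t.coord.map f) ≫ τ' m n' = τ' m n ≫ T'.map (m ⊴ᵣ t.coord.map f) :=
      (τ.app m).naturality f
    have hτ₃ (m : M) (x : C) (n : N) :
        τ' (m ⊙ᵣ x) n ≫ T'.map ((αᵣ m x (t.coord.obj n)).inv ≫ m ⊴ᵣ (t.coordₗ x n).hom) =
          T.map ((αᵣ m x (t.coord.obj n)).inv ≫ m ⊴ᵣ (t.coordₗ x n).hom) ≫ τ' m (x ⊙ₗ n) :=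
      hτ m x n
    have hω {m m' : M} (f : m ⟶ m') :
        f ⊵ᵣ t.coord.obj n₀ ≫ (t.actCoordUnit m').inv = (t.actCoordUnit m).inv ≫ f := by
      rw [Iso.comp_inv_eq, Category.assoc, t.actCoordUnit_natural, Iso.inv_hom_id_assoc]
    -- the balancing expresses `τ` in terms of its components at the generator
    have key (m : M) (n : N) : τ' m n = T.map (t.actCoordUnit _).hom ≫
        τ' (m ⊙ᵣ t.coord.obj n) n₀ ≫ T'.map (t.actCoordUnit _).inv := by
      have h0 := t.actCoordUnit_triangle m n
      have h1 := hτ₃ m (t.coord.obj n) n₀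
      have h2 := hτ₂ m (t.coordIso n).hom
      have h3 : (t.actCoordUnit (m ⊙ᵣ t.coord.obj n)).inv =
          ((αᵣ m (t.coord.obj n) (t.coord.obj n₀)).inv ≫
            m ⊴ᵣ (t.coordₗ (t.coord.obj n) n₀).hom) ≫ m ⊴ᵣ t.coord.map (t.coordIso n).hom := by
        rw [← cancel_epi (t.actCoordUnit (m ⊙ᵣ t.coord.obj n)).hom, Iso.hom_inv_id, h0]
      rw [h3, Functor.map_comp T', reassoc_of% h1, ← h2, ← Functor.map_comp_assoc,
        ← Functor.map_comp_assoc, Category.assoc, h0, CategoryTheory.Functor.map_id,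
        Category.id_comp]
    refine ⟨{ app := fun m => T.map (t.actCoordUnit m).hom ≫ τ' m n₀ ≫
                T'.map (t.actCoordUnit m).inv
              naturality := fun m m' f => ?_ }, key, fun σ hσ => ?_⟩
    · rw [← Functor.map_comp_assoc, t.actCoordUnit_natural, Functor.map_comp, Category.assoc,
        reassoc_of% hτ₁, ← Functor.map_comp, hω, Functor.map_comp]
      simp only [Category.assoc]
    · ext m
      have h : τ' m n₀ = σ.app (m ⊙ᵣ t.coord.obj n₀) := hσ m n₀
      have h' := σ.naturality (t.actCoordUnit m).inv
      dsimp only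
      rw [h, ← h', ← Functor.map_comp_assoc, Iso.hom_inv_id,
        CategoryTheory.Functor.map_id, Category.id_comp]

end Restrict

/-! ### The relative tensor product with a bimodule category `C_G` -/

section RelTensorTwist

theorem actionRightAssocIso_inv_pentagon' {C D : Type*} [Category* C] [MonoidalCategory C]
    [Category* D] [MonoidalRightAction C D] (m : D) (x y z : C) :
    (αᵣ m x (y ⊗ z)).inv ≫ m ⊴ᵣ (α_ x y z).inv =
      (αᵣ (m ⊙ᵣ x) y z).hom ≫ (αᵣ m x y).inv ⊵ᵣ z ≫ (αᵣ m (x ⊗ y) z).inv := by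
  rw [← cancel_mono (m ⊴ᵣ (α_ x y z).hom)]
  simp [actionRightAssocIso_inv_pentagon]

theorem actionRightAssocIso_inv_natural {C D : Type*} [Category* C] [MonoidalCategory C]
    [Category* D] [MonoidalRightAction C D] (m : D) {x x' : C} (f : x ⟶ x') (y : C) :
    (m ⊴ᵣ f) ⊵ᵣ y ≫ (αᵣ m x' y).inv = (αᵣ m x y).inv ≫ m ⊴ᵣ (f ▷ y) := by
  rw [MonoidalRightAction.actionHomRight_whiskerRight]
  simp

variable {C : Type u} [Category.{v} C] [Abelian C] [Linear ℂ C] [MonoidalCategory C]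

section

variable (M : Bimod C)

theorem Bimod.mid_inv_naturality_left {x x' : C} (f : x ⟶ x') (m : M) (y : C) :
    f ⊵ₗ (m ⊙ᵣ y) ≫ (M.mid x' m y).inv = (M.mid x m y).inv ≫ (f ⊵ₗ m) ⊵ᵣ y := by
  rw [Iso.comp_inv_eq, Category.assoc, M.mid_naturality_left, Iso.inv_hom_id_assoc]

theorem Bimod.mid_inv_naturality_middle (x : C) {m m' : M} (f : m ⟶ m') (y : C) :
    x ⊴ₗ (f ⊵ᵣ y) ≫ (M.mid x m' y).inv = (M.mid x m y).inv ≫ (x ⊴ₗ f) ⊵ᵣ y := by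
  rw [Iso.comp_inv_eq, Category.assoc, M.mid_naturality_middle, Iso.inv_hom_id_assoc]

theorem Bimod.mid_inv_naturality_right (x : C) (m : M) {y y' : C} (f : y ⟶ y') :
    x ⊴ₗ (m ⊴ᵣ f) ≫ (M.mid x m y').inv = (M.mid x m y).inv ≫ (x ⊙ₗ m) ⊴ᵣ f := by
  rw [Iso.comp_inv_eq, Category.assoc, M.mid_naturality_right, Iso.inv_hom_id_assoc]

theorem Bimod.mid_assoc_right_inv (x : C) (m : M) (y y' : C) :
    (M.mid x (m ⊙ᵣ y) y').inv ≫ (M.mid x m y).inv ⊵ᵣ y' ≫ (αᵣ (x ⊙ₗ m) y y').inv =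
      x ⊴ₗ (αᵣ m y y').inv ≫ (M.mid x m (y ⊗ y')).inv := by
  rw [← cancel_mono (αᵣ (x ⊙ₗ m) y y').hom, ← cancel_mono ((M.mid x m y).hom ⊵ᵣ y'),
    ← cancel_mono (M.mid x (m ⊙ᵣ y) y').hom]
  simp only [Category.assoc, Iso.inv_hom_id, Category.comp_id, Iso.inv_hom_id_assoc,
    M.mid_assoc_right, MonoidalLeftAction.actionHomRight_inv_hom,
    MonoidalRightAction.inv_hom_actionHomLeft_assoc]

end

variable [MonoidalPreadditive C] [MonoidalLinear ℂ C] [IsFiniteSemisimple C]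
  {G : C ⥤ C} [G.Monoidal] [G.Additive] [G.Linear ℂ] {N : Bimod C} {n₀ : N}

/-- If `N` is generated by a `G`-twisted central object, then `M ⊠_C N` is the bimodule category
`M_G`, by means of `(m, n) ↦ m ⊙ᵣ c(n)`. -/
def TwistedCentral.relTensor (t : TwistedCentral G N n₀) [(N.orbit n₀).IsEquivalence]
    (M : Bimod C) : RelTensor M N (M.restrict G) where
  toBalancedFunctor := t.balanced M
  universal := t.balanced_isUniversal M
  left n :=
    let K : M ⥤ M.restrict G := (t.balanced M).toFunctor.flip.obj n
    letI l : K.LaxLeftLinear C :=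
      { μₗ := fun x m => (M.mid x m (t.coord.obj n)).inv
        μₗ_naturality_left := fun f m => M.mid_inv_naturality_left f m (t.coord.obj n)
        μₗ_naturality_right := fun x _ _ f => M.mid_inv_naturality_middle x f (t.coord.obj n)
        μₗ_associativity := fun x y m => by
          have h := M.mid_assoc_left x y m (t.coord.obj n)
          change (M.mid (x ⊗ y) m (t.coord.obj n)).inv ≫ (αₗ x y m).hom ⊵ᵣ t.coord.obj n =
            (αₗ x y (m ⊙ᵣ t.coord.obj n)).hom ≫ x ⊴ₗ (M.mid y m (t.coord.obj n)).inv ≫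
              (M.mid x (y ⊙ₗ m) (t.coord.obj n)).inv
          rw [Iso.inv_comp_eq, ← reassoc_of% h]
          simp
        μₗ_unitality := fun m => by
          change (λₗ (m ⊙ᵣ t.coord.obj n)).hom =
            (M.mid (𝟙_ C) m (t.coord.obj n)).inv ≫ (λₗ m).hom ⊵ᵣ t.coord.obj n
          rw [← M.mid_unit_left, Iso.inv_hom_id_assoc] }
    leftLinearOfIsIso K fun x m => inferInstanceAs (IsIso (M.mid x m (t.coord.obj n)).inv)
  right m :=
    let K : N ⥤ M.restrict G := (t.balanced M).toFunctor.obj m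
    letI r : K.LaxRightLinear C :=
      { μᵣ := fun n y => (αᵣ m (t.coord.obj n) (G.obj y)).inv ≫ m ⊴ᵣ (t.coordᵣ n y).hom
        μᵣ_naturality_right := fun n y y' f => by
          have h := t.coordᵣ_natural_right n f
          change (m ⊙ᵣ t.coord.obj n) ⊴ᵣ G.map f ≫ (αᵣ _ _ _).inv ≫ m ⊴ᵣ (t.coordᵣ n y').hom =
            ((αᵣ _ _ _).inv ≫ m ⊴ᵣ (t.coordᵣ n y).hom) ≫ m ⊴ᵣ t.coord.map (n ⊴ᵣ f)
          rw [Category.assoc, ← MonoidalRightAction.actionHomRight_comp, ← h]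
          simp
        μᵣ_naturality_left := fun {n n'} f y => by
          have h := t.coordᵣ_natural_left f y
          change (m ⊴ᵣ t.coord.map f) ⊵ᵣ G.obj y ≫ (αᵣ _ _ _).inv ≫ m ⊴ᵣ (t.coordᵣ n' y).hom =
            ((αᵣ _ _ _).inv ≫ m ⊴ᵣ (t.coordᵣ n y).hom) ≫ m ⊴ᵣ t.coord.map (f ⊵ᵣ y)
          rw [Category.assoc, ← MonoidalRightAction.actionHomRight_comp, ← h]
          simp
        μᵣ_associativity := fun n x y => by
          have h := t.coordᵣ_assoc n x y
          have h2 := actionRightAssocIso_inv_pentagon' m (t.coord.obj n) (G.obj x) (G.obj y)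
          have h3 := actionRightAssocIso_inv_natural m (t.coordᵣ n x).hom (G.obj y)
          change ((αᵣ m (t.coord.obj n) (G.obj (x ⊗ y))).inv ≫ m ⊴ᵣ (t.coordᵣ n (x ⊗ y)).hom) ≫
              m ⊴ᵣ t.coord.map (αᵣ n x y).hom =
            ((m ⊙ᵣ t.coord.obj n) ⊴ᵣ Functor.OplaxMonoidal.δ G x y ≫
              (αᵣ (m ⊙ᵣ t.coord.obj n) (G.obj x) (G.obj y)).hom) ≫
              ((αᵣ m (t.coord.obj n) (G.obj x)).inv ≫ m ⊴ᵣ (t.coordᵣ n x).hom) ⊵ᵣ G.obj y ≫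
              (αᵣ m (t.coord.obj (n ⊙ᵣ x)) (G.obj y)).inv ≫ m ⊴ᵣ (t.coordᵣ (n ⊙ᵣ x) y).hom
          rw [Category.assoc, ← MonoidalRightAction.actionHomRight_comp, h]
          simp only [MonoidalRightAction.actionHomRight_comp, Category.assoc, reassoc_of% h3,
            MonoidalRightAction.comp_actionHomLeft, ← reassoc_of% h2,
            MonoidalRightAction.action_actionHomRight, Iso.hom_inv_id_assoc]
        μᵣ_unitality := fun n => by
          have h := t.coordᵣ_unit n
          change (m ⊙ᵣ t.coord.obj n) ⊴ᵣ Functor.OplaxMonoidal.η G ≫ (ρᵣ _).hom =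
            ((αᵣ m (t.coord.obj n) (G.obj (𝟙_ C))).inv ≫ m ⊴ᵣ (t.coordᵣ n (𝟙_ C)).hom) ≫
              m ⊴ᵣ t.coord.map (ρᵣ n).hom
          rw [Category.assoc, ← MonoidalRightAction.actionHomRight_comp, ← h]
          simp }
    rightLinearOfIsIso K fun n y => inferInstanceAs
      (IsIso ((αᵣ m (t.coord.obj n) (G.obj y)).inv ≫ m ⊴ᵣ (t.coordᵣ n y).hom))
  left_naturality x m {n n'} f := M.mid_inv_naturality_right x m (t.coord.map f)
  right_naturality {m m'} f n y := by
    change (f ⊵ᵣ t.coord.obj n) ⊵ᵣ G.obj y ≫ (αᵣ _ _ _).inv ≫ m' ⊴ᵣ (t.coordᵣ n y).hom =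
      ((αᵣ _ _ _).inv ≫ m ⊴ᵣ (t.coordᵣ n y).hom) ≫ f ⊵ᵣ t.coord.obj (n ⊙ᵣ y)
    rw [Category.assoc, MonoidalRightAction.action_exchange]
    simp
  left_bal x m y n := by
    change (M.mid x (m ⊙ᵣ y) (t.coord.obj n)).inv ≫ (M.mid x m y).inv ⊵ᵣ t.coord.obj n ≫
        (αᵣ (x ⊙ₗ m) y (t.coord.obj n)).inv ≫ (x ⊙ₗ m) ⊴ᵣ (t.coordₗ y n).hom =
      x ⊴ₗ ((αᵣ m y (t.coord.obj n)).inv ≫ m ⊴ᵣ (t.coordₗ y n).hom) ≫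
        (M.mid x m (t.coord.obj (y ⊙ₗ n))).inv
    have h := M.mid_assoc_right_inv x m y (t.coord.obj n)
    rw [reassoc_of% h, ← M.mid_inv_naturality_right, MonoidalLeftAction.actionHomRight_comp,
      Category.assoc]
  right_bal m x n y := by
    change ((αᵣ (m ⊙ᵣ x) (t.coord.obj n) (G.obj y)).inv ≫ (m ⊙ᵣ x) ⊴ᵣ (t.coordᵣ n y).hom) ≫
        (αᵣ m x (t.coord.obj (n ⊙ᵣ y))).inv ≫ m ⊴ᵣ (t.coordₗ x (n ⊙ᵣ y)).hom =
      ((αᵣ m x (t.coord.obj n)).inv ≫ m ⊴ᵣ (t.coordₗ x n).hom) ⊵ᵣ G.obj y ≫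
        ((αᵣ m (t.coord.obj (x ⊙ₗ n)) (G.obj y)).inv ≫ m ⊴ᵣ (t.coordᵣ (x ⊙ₗ n) y).hom) ≫
        m ⊴ᵣ t.coord.map (N.mid x n y).hom
    have h := t.coord_mid x n y
    have h2 := actionRightAssocIso_inv_pentagon m x (t.coord.obj n) (G.obj y)
    have h3 := actionRightAssocIso_inv_natural m (t.coordₗ x n).hom (G.obj y)
    have h4 : (αᵣ m x (t.coord.obj n ⊗ G.obj y)).inv ≫ m ⊴ᵣ (x ◁ (t.coordᵣ n y).hom) =
        (m ⊙ᵣ x) ⊴ᵣ (t.coordᵣ n y).hom ≫ (αᵣ m x (t.coord.obj (n ⊙ᵣ y))).inv := by simp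
    have h5 := congrArg (fun s => m ⊴ᵣ s) h
    simp only [MonoidalRightAction.actionHomRight_comp] at h5
    simp only [MonoidalRightAction.comp_actionHomLeft, Category.assoc, reassoc_of% h3, ← h5,
      reassoc_of% h2, MonoidalRightAction.inv_hom_actionHomLeft_assoc]
    rw [reassoc_of% h4]
  mid_comm x m n y := by
    change (M.mid x (m ⊙ᵣ t.coord.obj n) (G.obj y)).hom ≫
        x ⊴ₗ ((αᵣ m (t.coord.obj n) (G.obj y)).inv ≫ m ⊴ᵣ (t.coordᵣ n y).hom) ≫
        (M.mid x m (t.coord.obj (n ⊙ᵣ y))).inv =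
      (M.mid x m (t.coord.obj n)).inv ⊵ᵣ G.obj y ≫
        (αᵣ (x ⊙ₗ m) (t.coord.obj n) (G.obj y)).inv ≫ (x ⊙ₗ m) ⊴ᵣ (t.coordᵣ n y).hom
    have h := M.mid_assoc_right_inv x m (t.coord.obj n) (G.obj y)
    rw [MonoidalLeftAction.actionHomRight_comp, Category.assoc, M.mid_inv_naturality_right,
      ← reassoc_of% h, Iso.hom_inv_id_assoc]

end RelTensorTwist

section ModuleFunctors

variable {C : Type*} [Category* C] [MonoidalCategory C] {D D' D'' : Type*} [Category* D]
  [Category* D'] [Category* D'']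

/-- The composite of left module functors. -/
abbrev leftLinearComp [MonoidalLeftAction C D] [MonoidalLeftAction C D']
    [MonoidalLeftAction C D''] (K : D ⥤ D') (E : D' ⥤ D'') [K.LeftLinear C] [E.LeftLinear C] :
    (K ⋙ E).LeftLinear C :=
  letI l : (K ⋙ E).LaxLeftLinear C :=
    { μₗ := fun x m => μₗ E x (K.obj m) ≫ E.map (μₗ K x m)
      μₗ_naturality_left := fun f d => by simp [← Functor.map_comp]
      μₗ_naturality_right := fun x _ _ f => by simp [← Functor.map_comp]
      μₗ_associativity := fun x y d => by
        simp [← Functor.map_comp]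
        rw [Functor.map_comp, μₗ_associativity_assoc]
      μₗ_unitality := fun d => by simp [← Functor.map_comp] }
  leftLinearOfIsIso _ fun x m => inferInstanceAs (IsIso (μₗ E x (K.obj m) ≫ E.map (μₗ K x m)))

/-- The composite of right module functors. -/
abbrev rightLinearComp [MonoidalRightAction C D] [MonoidalRightAction C D']
    [MonoidalRightAction C D''] (K : D ⥤ D') (E : D' ⥤ D'') [K.RightLinear C]
    [E.RightLinear C] : (K ⋙ E).RightLinear C :=
  letI r : (K ⋙ E).LaxRightLinear C :=
    { μᵣ := fun m x => μᵣ E (K.obj m) x ≫ E.map (μᵣ K m x)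
      μᵣ_naturality_left := fun f d => by simp [← Functor.map_comp]
      μᵣ_naturality_right := fun x _ _ f => by simp [← Functor.map_comp]
      μᵣ_associativity := fun d x y => by
        simp [← Functor.map_comp]
        rw [Functor.map_comp, μᵣ_associativity_assoc]
      μᵣ_unitality := fun d => by simp [← Functor.map_comp] }
  rightLinearOfIsIso _ fun m x => inferInstanceAs (IsIso (μᵣ E (K.obj m) x ≫ E.map (μᵣ K m x)))

end ModuleFunctors

section RelTensor

variable {C : Type u} [Category.{v} C] [Abelian C] [Linear ℂ C] [MonoidalCategory C]

attribute [instance] RelTensor.left RelTensor.right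

namespace RelTensor

variable {M N P : Bimod C} (R : RelTensor M N P)

/-- The isomorphism `x ⊙ₗ B(m, n) ≅ B(x ⊙ₗ m, n)`. -/
def lμ (x : C) (m : M) (n : N) :
    x ⊙ₗ (R.toFunctor.obj m).obj n ≅ (R.toFunctor.obj (x ⊙ₗ m)).obj n :=
  Functor.LeftLinear.μₗIso (R.toFunctor.flip.obj n) x m

/-- The isomorphism `B(m, n) ⊙ᵣ y ≅ B(m, n ⊙ᵣ y)`. -/
def rμ (m : M) (n : N) (y : C) :
    (R.toFunctor.obj m).obj n ⊙ᵣ y ≅ (R.toFunctor.obj m).obj (n ⊙ᵣ y) :=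
  Functor.RightLinear.μᵣIso (R.toFunctor.obj m) n y

theorem lμ_natural_right (x : C) (m : M) {n n' : N} (f : n ⟶ n') :
    x ⊴ₗ (R.toFunctor.obj m).map f ≫ (R.lμ x m n').hom =
      (R.lμ x m n).hom ≫ (R.toFunctor.obj (x ⊙ₗ m)).map f :=
  R.left_naturality x m f

theorem rμ_natural_left {m m' : M} (f : m ⟶ m') (n : N) (y : C) :
    (R.toFunctor.map f).app n ⊵ᵣ y ≫ (R.rμ m' n y).hom =
      (R.rμ m n y).hom ≫ (R.toFunctor.map f).app (n ⊙ᵣ y) :=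
  R.right_naturality f n y

theorem rμ_natural_middle (m : M) {n n' : N} (f : n ⟶ n') (y : C) :
    (R.toFunctor.obj m).map f ⊵ᵣ y ≫ (R.rμ m n' y).hom =
      (R.rμ m n y).hom ≫ (R.toFunctor.obj m).map (f ⊵ᵣ y) :=
  μᵣ_naturality_left (R.toFunctor.obj m) f y

theorem rμ_natural_right (m : M) (n : N) {y y' : C} (f : y ⟶ y') :
    (R.toFunctor.obj m).obj n ⊴ᵣ f ≫ (R.rμ m n y').hom =
      (R.rμ m n y).hom ≫ (R.toFunctor.obj m).map (n ⊴ᵣ f) :=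
  μᵣ_naturality_right (R.toFunctor.obj m) n f

theorem rμ_assoc (m : M) (n : N) (x y : C) :
    (R.rμ m n (x ⊗ y)).hom ≫ (R.toFunctor.obj m).map (αᵣ n x y).hom =
      (αᵣ ((R.toFunctor.obj m).obj n) x y).hom ≫ (R.rμ m n x).hom ⊵ᵣ y ≫
        (R.rμ m (n ⊙ᵣ x) y).hom :=
  μᵣ_associativity (R.toFunctor.obj m) n x y

theorem rμ_unit (m : M) (n : N) :
    (ρᵣ ((R.toFunctor.obj m).obj n)).hom =
      (R.rμ m n (𝟙_ C)).hom ≫ (R.toFunctor.obj m).map (ρᵣ n).hom :=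
  μᵣ_unitality (C := C) (R.toFunctor.obj m) n

theorem lμ_bal (x : C) (m : M) (y : C) (n : N) :
    (R.lμ x (m ⊙ᵣ y) n).hom ≫ (R.toFunctor.map (M.mid x m y).inv).app n ≫
      (R.bal (x ⊙ₗ m) y n).hom = x ⊴ₗ (R.bal m y n).hom ≫ (R.lμ x m (y ⊙ₗ n)).hom :=
  R.left_bal x m y n

theorem rμ_bal (m : M) (x : C) (n : N) (y : C) :
    (R.rμ (m ⊙ᵣ x) n y).hom ≫ (R.bal m x (n ⊙ᵣ y)).hom =
      (R.bal m x n).hom ⊵ᵣ y ≫ (R.rμ m (x ⊙ₗ n) y).hom ≫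
        (R.toFunctor.obj m).map (N.mid x n y).hom :=
  R.right_bal m x n y

theorem lμ_rμ (x : C) (m : M) (n : N) (y : C) :
    (P.mid x ((R.toFunctor.obj m).obj n) y).hom ≫ x ⊴ₗ (R.rμ m n y).hom ≫
      (R.lμ x m (n ⊙ᵣ y)).hom = (R.lμ x m n).hom ⊵ᵣ y ≫ (R.rμ (x ⊙ₗ m) n y).hom :=
  R.mid_comm x m n y

end RelTensor

/-- A relative tensor product may be replaced by an equivalent bimodule category. -/
theorem IsRelTensor.of_equivalent {M N P P' : Bimod C} (h : IsRelTensor M N P)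
    (e : P.Equivalent P') : IsRelTensor M N P' := by
  obtain ⟨R⟩ := h
  obtain ⟨E, hE⟩ := e
  exact ⟨{
    toBalancedFunctor := R.toBalancedFunctor.postcomp E.toFunctor
    universal := R.universal.postcomp E.toFunctor
    left := fun n => leftLinearComp (R.toFunctor.flip.obj n) E.toFunctor
    right := fun m => rightLinearComp (R.toFunctor.obj m) E.toFunctor
    left_naturality := fun x m n n' f => by
      change x ⊴ₗ E.toFunctor.map ((R.toFunctor.obj m).map f) ≫
          μₗ E.toFunctor x ((R.toFunctor.obj m).obj n') ≫ E.toFunctor.map (R.lμ x m n').hom =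
        (μₗ E.toFunctor x ((R.toFunctor.obj m).obj n) ≫ E.toFunctor.map (R.lμ x m n).hom) ≫
          E.toFunctor.map ((R.toFunctor.obj (x ⊙ₗ m)).map f)
      rw [μₗ_naturality_right_assoc, Category.assoc, ← Functor.map_comp, ← Functor.map_comp,
        R.lμ_natural_right]
    right_naturality := fun {m m'} f n y => by
      change E.toFunctor.map ((R.toFunctor.map f).app n) ⊵ᵣ y ≫
          μᵣ E.toFunctor ((R.toFunctor.obj m').obj n) y ≫ E.toFunctor.map (R.rμ m' n y).hom =
        (μᵣ E.toFunctor ((R.toFunctor.obj m).obj n) y ≫ E.toFunctor.map (R.rμ m n y).hom) ≫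
          E.toFunctor.map ((R.toFunctor.map f).app (n ⊙ᵣ y))
      rw [μᵣ_naturality_left_assoc, Category.assoc, ← Functor.map_comp, ← Functor.map_comp,
        R.rμ_natural_left]
    left_bal := fun x m y n => by
      change (μₗ E.toFunctor x _ ≫ E.toFunctor.map (R.lμ x (m ⊙ᵣ y) n).hom) ≫
          E.toFunctor.map ((R.toFunctor.map (M.mid x m y).inv).app n) ≫
          E.toFunctor.map (R.bal (x ⊙ₗ m) y n).hom =
        x ⊴ₗ E.toFunctor.map (R.bal m y n).hom ≫
          μₗ E.toFunctor x _ ≫ E.toFunctor.map (R.lμ x m (y ⊙ₗ n)).hom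
      rw [μₗ_naturality_right_assoc, Category.assoc, ← Functor.map_comp, ← Functor.map_comp,
        ← Functor.map_comp, R.lμ_bal]
    right_bal := fun m x n y => by
      change (μᵣ E.toFunctor _ y ≫ E.toFunctor.map (R.rμ (m ⊙ᵣ x) n y).hom) ≫
          E.toFunctor.map (R.bal m x (n ⊙ᵣ y)).hom =
        E.toFunctor.map (R.bal m x n).hom ⊵ᵣ y ≫
          (μᵣ E.toFunctor _ y ≫ E.toFunctor.map (R.rμ m (x ⊙ₗ n) y).hom) ≫
            E.toFunctor.map ((R.toFunctor.obj m).map (N.mid x n y).hom)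
      rw [Category.assoc, Category.assoc, μᵣ_naturality_left_assoc, ← Functor.map_comp,
        ← Functor.map_comp, ← Functor.map_comp, R.rμ_bal]
    mid_comm := fun x m n y => by
      have h := E.mid_comm x ((R.toFunctor.obj m).obj n) y
      have h1 := R.lμ_rμ x m n y
      change (P'.mid x (E.toFunctor.obj ((R.toFunctor.obj m).obj n)) y).hom ≫
          x ⊴ₗ (μᵣ E.toFunctor ((R.toFunctor.obj m).obj n) y ≫
            E.toFunctor.map (R.rμ m n y).hom) ≫
          μₗ E.toFunctor x ((R.toFunctor.obj m).obj (n ⊙ᵣ y)) ≫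
            E.toFunctor.map (R.lμ x m (n ⊙ᵣ y)).hom =
        (μₗ E.toFunctor x ((R.toFunctor.obj m).obj n) ≫ E.toFunctor.map (R.lμ x m n).hom) ⊵ᵣ y ≫
          μᵣ E.toFunctor ((R.toFunctor.obj (x ⊙ₗ m)).obj n) y ≫
            E.toFunctor.map (R.rμ (x ⊙ₗ m) n y).hom
      rw [MonoidalLeftAction.actionHomRight_comp, Category.assoc, μₗ_naturality_right_assoc,
        reassoc_of% h, ← Functor.map_comp, ← Functor.map_comp, h1,
        MonoidalRightAction.comp_actionHomLeft, Category.assoc, μᵣ_naturality_left_assoc,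
        ← Functor.map_comp] }⟩

variable {G : C ⥤ C} [G.Monoidal] {M N P : Bimod C} {n₀ : N}

/-- The isomorphism `B(m, n₀) ⊙ᵣ y ≅ B(m ⊙ᵣ G(y), n₀)` for a `G`-twisted central object `n₀`. -/
def TwistedCentral.evalᵣ (t : TwistedCentral G N n₀) (R : RelTensor M N P) (m : M) (y : C) :
    (R.toFunctor.obj m).obj n₀ ⊙ᵣ y ≅ (R.toFunctor.obj (m ⊙ᵣ G.obj y)).obj n₀ :=
  R.rμ m n₀ y ≪≫ (R.toFunctor.obj m).mapIso (t.iso y) ≪≫ (R.bal m (G.obj y) n₀).symm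

theorem TwistedCentral.evalᵣ_bal (t : TwistedCentral G N n₀) (R : RelTensor M N P) (m : M)
    (y : C) : (t.evalᵣ R m y).hom ≫ (R.bal m (G.obj y) n₀).hom =
      (R.rμ m n₀ y).hom ≫ (R.toFunctor.obj m).map (t.iso y).hom := by
  simp [evalᵣ]

variable [G.Additive] [G.Linear ℂ]

/-- The bimodule functor `M_G ⟶ M ⊠_C N`, `m ↦ B(m, n₀)`, for a `G`-twisted central `n₀`. -/
def TwistedCentral.eval (t : TwistedCentral G N n₀) (R : RelTensor M N P) :
    BimodFunctor (M.restrict G) P :=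
  let K : M.restrict G ⥤ P := R.toFunctor.flip.obj n₀
  letI l : (R.toFunctor.flip.obj n₀).LeftLinear C := R.left n₀
  letI r : K.LaxRightLinear C :=
    { μᵣ := fun (m : M) y => (t.evalᵣ R m y).hom
      μᵣ_naturality_right := fun (m : M) {y y'} f => by
        change (R.toFunctor.obj m).obj n₀ ⊴ᵣ f ≫ (t.evalᵣ R m y').hom =
          (t.evalᵣ R m y).hom ≫ (R.toFunctor.map (m ⊴ᵣ G.map f)).app n₀
        have h := R.rμ_natural_right m n₀ f
        have h1 := R.bal_naturality_middle m (G.map f) n₀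
        rw [← cancel_mono (R.bal m (G.obj y') n₀).hom, Category.assoc, Category.assoc, h1,
          reassoc_of% t.evalᵣ_bal R m y, t.evalᵣ_bal, reassoc_of% h, ← Functor.map_comp,
          ← Functor.map_comp, t.naturality]
      μᵣ_naturality_left := fun {m m' : M} (f : m ⟶ m') y => by
        change (R.toFunctor.map f).app n₀ ⊵ᵣ y ≫ (t.evalᵣ R m' y).hom =
          (t.evalᵣ R m y).hom ≫ (R.toFunctor.map (f ⊵ᵣ G.obj y)).app n₀
        have h := R.rμ_natural_left f n₀ y
        have h1 := R.bal_naturality_left f (G.obj y) n₀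
        rw [← cancel_mono (R.bal m' (G.obj y) n₀).hom, Category.assoc, Category.assoc, h1,
          reassoc_of% t.evalᵣ_bal R m y, t.evalᵣ_bal, reassoc_of% h, NatTrans.naturality]
      μᵣ_associativity := fun (m : M) x y => by
        change (t.evalᵣ R m (x ⊗ y)).hom ≫ (R.toFunctor.map (m ⊴ᵣ Functor.OplaxMonoidal.δ G x y ≫
            (αᵣ m (G.obj x) (G.obj y)).hom)).app n₀ =
          (αᵣ ((R.toFunctor.obj m).obj n₀) x y).hom ≫ (t.evalᵣ R m x).hom ⊵ᵣ y ≫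
            (t.evalᵣ R (m ⊙ᵣ G.obj x) y).hom
        have h := R.bal_assoc m (G.obj x) (G.obj y) n₀
        have h1 := R.bal_naturality_middle m (Functor.OplaxMonoidal.δ G x y) n₀
        have h2 := R.bal_naturality_right m (G.obj x) (t.iso y).hom
        have h3 := R.rμ_bal m (G.obj x) n₀ y
        have h4 : (t.evalᵣ R m x).hom ⊵ᵣ y ≫ (R.bal m (G.obj x) n₀).hom ⊵ᵣ y =
            (R.rμ m n₀ x).hom ⊵ᵣ y ≫ (R.toFunctor.obj m).map (t.iso x).hom ⊵ᵣ y := by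
          rw [← MonoidalRightAction.comp_actionHomLeft, t.evalᵣ_bal,
            MonoidalRightAction.comp_actionHomLeft]
        have h5 := R.rμ_natural_middle m (t.iso x).hom y
        have h6 := R.rμ_assoc m n₀ x y
        rw [← cancel_mono (R.bal (m ⊙ᵣ G.obj x) (G.obj y) n₀).hom,
          ← cancel_mono (R.bal m (G.obj x) (G.obj y ⊙ₗ n₀)).hom]
        simp only [Functor.map_comp, NatTrans.comp_app, Category.assoc, ← h,
          reassoc_of% t.evalᵣ_bal R (m ⊙ᵣ G.obj x) y, h2, reassoc_of% h3, reassoc_of% h4,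
          reassoc_of% h5, ← reassoc_of% h6, reassoc_of% h1, reassoc_of% t.evalᵣ_bal R m (x ⊗ y)]
        simp only [← Functor.map_comp, t.hexagon, Category.assoc]
        rw [← MonoidalLeftAction.comp_actionHomLeft_assoc, Functor.Monoidal.μ_δ]
        simp
      μᵣ_unitality := fun (m : M) => by
        change (ρᵣ ((R.toFunctor.obj m).obj n₀)).hom = (t.evalᵣ R m (𝟙_ C)).hom ≫
          (R.toFunctor.map (m ⊴ᵣ Functor.OplaxMonoidal.η G ≫ (ρᵣ m).hom)).app n₀
        have h := R.bal_unit m n₀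
        have h1 := R.bal_naturality_middle m (Functor.OplaxMonoidal.η G) n₀
        rw [Functor.map_comp, NatTrans.comp_app, ← h, reassoc_of% h1,
          reassoc_of% t.evalᵣ_bal R m (𝟙_ C), R.rμ_unit, t.unit]
        simp only [← Functor.map_comp, Category.assoc]
        rw [← MonoidalLeftAction.comp_actionHomLeft_assoc, Functor.Monoidal.ε_η]
        simp }
  { toFunctor := K
    additive := R.additive_left n₀
    linear := R.linear_left n₀
    left := l
    right := rightLinearOfIsIso _ fun (m : M) y => inferInstanceAs (IsIso (t.evalᵣ R m y).hom)
    mid_comm := fun x (m : M) y => by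
      change (P.mid x ((R.toFunctor.obj m).obj n₀) y).hom ≫ x ⊴ₗ (t.evalᵣ R m y).hom ≫
          (R.lμ x (m ⊙ᵣ G.obj y) n₀).hom =
        (R.lμ x m n₀).hom ⊵ᵣ y ≫ (t.evalᵣ R (x ⊙ₗ m) y).hom ≫
          (R.toFunctor.map (M.mid x m (G.obj y)).hom).app n₀
      have h := R.lμ_bal x m (G.obj y) n₀
      have h1 : (R.toFunctor.map (M.mid x m (G.obj y)).hom).app n₀ ≫
          (R.toFunctor.map (M.mid x m (G.obj y)).inv).app n₀ = 𝟙 _ := by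
        rw [← NatTrans.comp_app, ← Functor.map_comp]
        simp
      have h2 := R.lμ_natural_right x m (t.iso y).hom
      have h3 := R.lμ_rμ x m n₀ y
      rw [← cancel_mono ((R.toFunctor.map (M.mid x m (G.obj y)).inv).app n₀),
        ← cancel_mono (R.bal (x ⊙ₗ m) (G.obj y) n₀).hom]
      simp only [Category.assoc, h, reassoc_of% h1, t.evalᵣ_bal,
        ← MonoidalLeftAction.actionHomRight_comp_assoc]
      rw [MonoidalLeftAction.actionHomRight_comp_assoc, h2, reassoc_of% h3] }

variable [MonoidalPreadditive C] [MonoidalLinear ℂ C] [IsFiniteSemisimple C]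

/-- If `N` is generated by a `G`-twisted central object `n₀`, every relative tensor product
`M ⊠_C N` is equivalent to `M_G`, by means of `m ↦ B(m, n₀)`. -/
theorem TwistedCentral.restrict_equivalent (t : TwistedCentral G N n₀)
    [(N.orbit n₀).IsEquivalence] (R : RelTensor M N P) : (M.restrict G).Equivalent P := by
  obtain ⟨T, _, _, e, hT⟩ := (t.balanced_isUniversal M).exists_equivalence R.universal
  refine ⟨t.eval R, ?_⟩
  let τ (m : M) : T.obj (m ⊙ᵣ t.coord.obj n₀) ≅ (R.toFunctor.obj m).obj n₀ :=
    (e.app m).app n₀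
  have i : T ≅ R.toFunctor.flip.obj n₀ :=
    NatIso.ofComponents (fun m => T.mapIso (t.actCoordUnit m) ≪≫ τ m) fun {m m'} f => by
      have h : T.map (f ⊵ᵣ t.coord.obj n₀) ≫ (τ m').hom =
          (τ m).hom ≫ (R.toFunctor.map f).app n₀ :=
        congrArg (fun s => s.app n₀) (e.hom.naturality f)
      change T.map f ≫ T.map _ ≫ _ = (T.map _ ≫ _) ≫ (R.toFunctor.map f).app n₀
      rw [Category.assoc, ← h, ← Functor.map_comp_assoc, ← Functor.map_comp_assoc,
        t.actCoordUnit_natural]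
  exact (Functor.isEquivalence_of_iso i : (R.toFunctor.flip.obj n₀).IsEquivalence)

/-- If `N` is generated by a `G`-twisted central object, the relative tensor products `M ⊠_C N`
are the bimodule categories equivalent to `M_G`. -/
theorem IsTwistOf.isRelTensor_iff (h : IsTwistOf G N) :
    IsRelTensor M N P ↔ (M.restrict G).Equivalent P := by
  obtain ⟨n₀, t, _⟩ := h
  exact ⟨fun ⟨R⟩ => t.restrict_equivalent R, IsRelTensor.of_equivalent ⟨t.relTensor M⟩⟩

end RelTensor

/-! ### The tensor functor attached to a left trivial bimodule category -/

section TwistFunctor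

variable {C : Type u} [Category.{v} C] [Abelian C] [Linear ℂ C] [MonoidalCategory C]

namespace Bimod

variable (P : Bimod C) (p : P) [(P.orbit p).IsEquivalence]

theorem orbit_map_injective {a b : C} {f g : a ⟶ b} (h : f ⊵ₗ p = g ⊵ₗ p) : f = g :=
  (P.orbit p).map_injective h

/-- The morphism `F(f)`, for `F` with `F(y) ⊙ₗ p ≅ p ⊙ᵣ y`. -/
def twistMap {y y' : C} (f : y ⟶ y') :
    (P.orbit p).objPreimage (p ⊙ᵣ y) ⟶ (P.orbit p).objPreimage (p ⊙ᵣ y') :=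
  (P.orbit p).preimage (((P.orbit p).objObjPreimageIso (p ⊙ᵣ y)).hom ≫ p ⊴ᵣ f ≫
    ((P.orbit p).objObjPreimageIso (p ⊙ᵣ y')).inv)

theorem orbit_map_twistMap {y y' : C} (f : y ⟶ y') : (P.orbit p).map (P.twistMap p f) =
    ((P.orbit p).objObjPreimageIso (p ⊙ᵣ y)).hom ≫ p ⊴ᵣ f ≫
      ((P.orbit p).objObjPreimageIso (p ⊙ᵣ y')).inv :=
  (P.orbit p).map_preimage _

/-- The functor `F` with `F(y) ⊙ₗ p ≅ p ⊙ᵣ y`. -/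
def twistFunctor : C ⥤ C where
  obj y := (P.orbit p).objPreimage (p ⊙ᵣ y)
  map f := P.twistMap p f
  map_id y := (P.orbit p).map_injective <| by
    rw [orbit_map_twistMap, CategoryTheory.Functor.map_id, MonoidalRightAction.actionHomRight_id,
      Category.id_comp, Iso.hom_inv_id]
  map_comp f g := (P.orbit p).map_injective <| by
    rw [CategoryTheory.Functor.map_comp, orbit_map_twistMap, orbit_map_twistMap,
      orbit_map_twistMap, MonoidalRightAction.actionHomRight_comp]
    simp only [Category.assoc, Iso.inv_hom_id_assoc]

/-- The isomorphism `p ⊙ᵣ y ≅ F(y) ⊙ₗ p`. -/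
def twistIso (y : C) : p ⊙ᵣ y ≅ (P.twistFunctor p).obj y ⊙ₗ p :=
  ((P.orbit p).objObjPreimageIso (p ⊙ᵣ y)).symm

theorem twistFunctor_map {y y' : C} (f : y ⟶ y') :
    (P.twistFunctor p).map f ⊵ₗ p = (P.twistIso p y).inv ≫ p ⊴ᵣ f ≫ (P.twistIso p y').hom :=
  (P.orbit p).map_preimage _

/-- The unit isomorphism of `F`. -/
def twistε : 𝟙_ C ≅ (P.twistFunctor p).obj (𝟙_ C) :=
  (P.orbit p).preimageIso (λₗ p ≪≫ (ρᵣ p).symm ≪≫ P.twistIso p (𝟙_ C))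

theorem twistε_hom : (P.twistε p).hom ⊵ₗ p =
    (λₗ p).hom ≫ (ρᵣ p).inv ≫ (P.twistIso p (𝟙_ C)).hom :=
  (P.orbit p).map_preimage _

/-- The isomorphism `(F(x) ⊗ F(y)) ⊙ₗ p ≅ (p ⊙ᵣ x) ⊙ᵣ y ≅ F(x ⊗ y) ⊙ₗ p`. -/
def twistμAction (x y : C) :
    ((P.twistFunctor p).obj x ⊗ (P.twistFunctor p).obj y) ⊙ₗ p ≅
      (P.twistFunctor p).obj (x ⊗ y) ⊙ₗ p where
  hom := (αₗ _ _ p).hom ≫ _ ⊴ₗ (P.twistIso p y).inv ≫ (P.mid _ p y).inv ≫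
    (P.twistIso p x).inv ⊵ᵣ y ≫ (αᵣ p x y).inv ≫ (P.twistIso p (x ⊗ y)).hom
  inv := (P.twistIso p (x ⊗ y)).inv ≫ (αᵣ p x y).hom ≫ (P.twistIso p x).hom ⊵ᵣ y ≫
    (P.mid _ p y).hom ≫ _ ⊴ₗ (P.twistIso p y).hom ≫ (αₗ _ _ p).inv

/-- The tensorator of `F`. -/
def twistμ (x y : C) : (P.twistFunctor p).obj x ⊗ (P.twistFunctor p).obj y ≅
    (P.twistFunctor p).obj (x ⊗ y) :=
  (P.orbit p).preimageIso (P.twistμAction p x y)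

theorem twistμ_hom (x y : C) : (P.twistμ p x y).hom ⊵ₗ p =
    (αₗ _ _ p).hom ≫ _ ⊴ₗ (P.twistIso p y).inv ≫ (P.mid _ p y).inv ≫
      (P.twistIso p x).inv ⊵ᵣ y ≫ (αᵣ p x y).inv ≫ (P.twistIso p (x ⊗ y)).hom :=
  (P.orbit p).map_preimage _

theorem mid_assoc_left_inv' (x x' : C) (m : P) (y : C) :
    (αₗ x x' (m ⊙ᵣ y)).inv ≫ (P.mid (x ⊗ x') m y).inv ≫ (αₗ x x' m).hom ⊵ᵣ y =
      x ⊴ₗ (P.mid x' m y).inv ≫ (P.mid x (x' ⊙ₗ m) y).inv := by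
  rw [← cancel_mono (P.mid x (x' ⊙ₗ m) y).hom, ← cancel_mono (x ⊴ₗ (P.mid x' m y).hom)]
  simp only [Category.assoc, P.mid_assoc_left]
  simp

theorem action_pentagon_inv (m : P) (x y z : C) :
    (αᵣ (m ⊙ᵣ x) y z).hom ≫ (αᵣ m x y).inv ⊵ᵣ z ≫ (αᵣ m (x ⊗ y) z).inv ≫
      m ⊴ᵣ (α_ x y z).hom = (αᵣ m x (y ⊗ z)).inv := by
  rw [actionRightAssocIso_inv_pentagon, MonoidalRightAction.inv_hom_actionHomLeft_assoc,
    Iso.hom_inv_id_assoc]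

/-- The monoidal structure of `F`. -/
def twistCore : (P.twistFunctor p).CoreMonoidal where
  εIso := P.twistε p
  μIso := P.twistμ p
  μIso_hom_natural_left {x x'} f y := P.orbit_map_injective p <| by
    simp only [MonoidalLeftAction.comp_actionHomLeft, twistμ_hom, twistFunctor_map,
      MonoidalLeftAction.whiskerRight_actionHomLeft,
      MonoidalRightAction.actionHomRight_whiskerRight, Category.assoc, Iso.inv_hom_id_assoc,
      Iso.hom_inv_id_assoc]
    rw [← MonoidalLeftAction.action_exchange_assoc, reassoc_of% P.mid_inv_naturality_left,
      twistFunctor_map]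
    simp
  μIso_hom_natural_right x f := P.orbit_map_injective p <| by
    simp only [MonoidalLeftAction.comp_actionHomLeft, twistμ_hom, twistFunctor_map,
      MonoidalLeftAction.whiskerLeft_actionHomLeft, MonoidalLeftAction.actionHomRight_comp,
      MonoidalRightAction.whiskerRight_actionHomLeft, Category.assoc, Iso.inv_hom_id_assoc,
      Iso.hom_inv_id_assoc, MonoidalLeftAction.actionHomRight_hom_inv_assoc]
    rw [reassoc_of% P.mid_inv_naturality_right, MonoidalRightAction.action_exchange_assoc]
  associativity x y z := P.orbit_map_injective p <| by
    have h1 := P.mid_inv_naturality_left (P.twistμ p x y).hom p z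
    have h2 := P.mid_assoc_left_inv' ((P.twistFunctor p).obj x) ((P.twistFunctor p).obj y) p z
    have h3 := P.mid_inv_naturality_middle ((P.twistFunctor p).obj x) (P.twistIso p y).inv z
    have h4 := P.mid_assoc_right_inv ((P.twistFunctor p).obj x) p y z
    have h5 := P.action_pentagon_inv p x y z
    simp only [MonoidalLeftAction.comp_actionHomLeft, twistμ_hom, twistFunctor_map,
      MonoidalLeftAction.whiskerLeft_actionHomLeft, MonoidalLeftAction.whiskerRight_actionHomLeft,
      MonoidalLeftAction.actionHomRight_comp, Category.assoc, Iso.inv_hom_id_assoc,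
      Iso.hom_inv_id_assoc, MonoidalLeftAction.actionHomRight_hom_inv_assoc]
    rw [← MonoidalLeftAction.action_exchange_assoc, reassoc_of% h1, twistμ_hom]
    have h6 : ((P.twistIso p x).inv ⊵ᵣ y) ⊵ᵣ z =
        (αᵣ _ y z).inv ≫ (P.twistIso p x).inv ⊵ᵣ (y ⊗ z) ≫ (αᵣ (p ⊙ᵣ x) y z).hom := by
      rw [MonoidalRightAction.actionHomLeft_tensor]
      simp
    simp only [MonoidalRightAction.comp_actionHomLeft, Category.assoc,
      MonoidalRightAction.hom_inv_actionHomLeft_assoc, MonoidalLeftAction.tensor_actionHomRight,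
      reassoc_of% h2, ← reassoc_of% h3, h6, reassoc_of% h4, reassoc_of% h5]
    rw [MonoidalLeftAction.associator_actionHom_assoc]
  left_unitality x := P.orbit_map_injective p <| by
    have h1 := P.mid_inv_naturality_left (P.twistε p).hom p x
    have h2 := P.mid_unit_left p x
    simp only [MonoidalLeftAction.comp_actionHomLeft, twistμ_hom, twistFunctor_map,
      MonoidalLeftAction.whiskerRight_actionHomLeft, Category.assoc, Iso.inv_hom_id_assoc,
      Iso.hom_inv_id_assoc, MonoidalLeftAction.leftUnitor_actionHom,
      MonoidalRightAction.actionHom_leftUnitor]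
    rw [← MonoidalLeftAction.action_exchange_assoc, reassoc_of% h1, twistε_hom]
    simp [← h2]
  right_unitality x := P.orbit_map_injective p <| by
    have h2 := P.mid_unit_right ((P.twistFunctor p).obj x) p
    simp only [MonoidalLeftAction.comp_actionHomLeft, twistμ_hom, twistFunctor_map, twistε_hom,
      MonoidalLeftAction.whiskerLeft_actionHomLeft, Category.assoc, Iso.inv_hom_id_assoc,
      Iso.hom_inv_id_assoc, MonoidalLeftAction.rightUnitor_actionHom,
      MonoidalLeftAction.actionHomRight_comp, MonoidalRightAction.actionHom_rightUnitor,
      MonoidalRightAction.unit_actionHomRight, ← h2,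
      MonoidalLeftAction.actionHomRight_hom_inv_assoc]
    simp

instance : (P.twistFunctor p).Monoidal := (P.twistCore p).toMonoidal

instance : (P.twistFunctor p).Additive where
  map_add {x y f g} := (P.orbit p).map_injective <| by
    change (P.twistFunctor p).map (f + g) ⊵ₗ p =
      ((P.twistFunctor p).map f + (P.twistFunctor p).map g) ⊵ₗ p
    simp only [twistFunctor_map, P.left_additive_left, P.right_additive_right,
      Preadditive.add_comp, Preadditive.comp_add]

instance : (P.twistFunctor p).Linear ℂ where
  map_smul {x y} f r := (P.orbit p).map_injective <| by
    change (P.twistFunctor p).map (r • f) ⊵ₗ p = (r • (P.twistFunctor p).map f) ⊵ₗ p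
    simp only [twistFunctor_map, P.left_linear_left, P.right_linear_right,
      Linear.smul_comp, Linear.comp_smul]

/-- The generator `p` is `F`-twisted central. -/
def twistCentral : TwistedCentral (P.twistFunctor p) P p where
  iso := P.twistIso p
  naturality f := by
    rw [twistFunctor_map, Iso.hom_inv_id_assoc]
  hexagon x y := by
    change _ = _ ≫ _ ≫ _ ≫ _ ≫ _ ≫ (P.twistμ p x y).hom ⊵ₗ p
    rw [twistμ_hom]
    simp
  unit := by
    change _ = _ ≫ _ ≫ (P.twistε p).hom ⊵ₗ p
    rw [twistε_hom]
    simp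

end Bimod

variable [MonoidalPreadditive C] [MonoidalLinear ℂ C] [IsFiniteSemisimple C]

/-- A bimodule category which is equivalent to `C` as a left module category is generated by a
twisted central object, namely the image of `𝟙`. -/
theorem exists_isTwistOf {P : Bimod C} (K : regular C ⥤ P) [K.IsEquivalence] [K.LeftLinear C] :
    ∃ (F : C ⥤ C) (_ : F.Monoidal) (_ : F.Additive) (_ : F.Linear ℂ), IsTwistOf F P := by
  let K' : C ⥤ P := K
  let p : P := K'.obj (𝟙_ C)
  have : K'.IsEquivalence := ‹K.IsEquivalence›
  let l (x c : C) : x ⊙ₗ K'.obj c ≅ K'.obj (x ⊗ c) := Functor.LeftLinear.μₗIso K x c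
  have hl {x x' : C} (f : x ⟶ x') (c : C) :
      f ⊵ₗ K'.obj c ≫ (l x' c).hom = (l x c).hom ≫ K'.map (f ▷ c) := μₗ_naturality_left K f c
  have i : P.orbit p ≅ K' := NatIso.ofComponents (fun c => l c (𝟙_ C) ≪≫ K'.mapIso (ρ_ c))
    fun {c c'} f => by
      change f ⊵ₗ p ≫ (l c' (𝟙_ C)).hom ≫ K'.map (ρ_ c').hom =
        ((l c (𝟙_ C)).hom ≫ K'.map (ρ_ c).hom) ≫ K'.map f
      rw [reassoc_of% hl f (𝟙_ C), Category.assoc, ← Functor.map_comp, ← Functor.map_comp,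
        rightUnitor_naturality]
  have : (P.orbit p).IsEquivalence := Functor.isEquivalence_of_iso i.symm
  exact ⟨P.twistFunctor p, inferInstance, inferInstance, inferInstance, p, P.twistCentral p, this⟩

end TwistFunctor

/-! ### Outer bimodule categories and the group `Out(C)` -/

section Invertible

theorem isEquivalence_of_comp_isEquivalence {C D : Type*} [Category* C] [Category* D]
    (F : C ⥤ D) (G : D ⥤ C) [(F ⋙ G).IsEquivalence] [(G ⋙ F).IsEquivalence] : F.IsEquivalence := by
  have : F.Faithful := Functor.Faithful.of_comp F G
  have : G.Faithful := Functor.Faithful.of_comp G F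
  have : F.Full := Functor.Full.of_comp_faithful F G
  have : F.EssSurj := ⟨fun Y => ⟨G.obj ((G ⋙ F).objPreimage Y),
    ⟨(G ⋙ F).objObjPreimageIso Y⟩⟩⟩
  exact { }

variable {C : Type u} [Category.{v} C] [MonoidalCategory C]

/-- An object `p` for which `- ⊗ p` is an equivalence is invertible. -/
theorem exists_inverse_of_isEquivalence_tensorRight (p : C) [(tensorRight p).IsEquivalence] :
    ∃ q : C, Nonempty (q ⊗ p ≅ 𝟙_ C) ∧ Nonempty (p ⊗ q ≅ 𝟙_ C) := by
  let q := (tensorRight p).objPreimage (𝟙_ C)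
  let i : q ⊗ p ≅ 𝟙_ C := (tensorRight p).objObjPreimageIso (𝟙_ C)
  exact ⟨q, ⟨i⟩, ⟨(tensorRight p).preimageIso
    (α_ p q p ≪≫ whiskerLeftIso p i ≪≫ ρ_ p ≪≫ (λ_ p).symm)⟩⟩

end Invertible

section Outer

variable {C : Type u} [Category.{v} C] [Abelian C] [Linear ℂ C] [MonoidalCategory C]

theorem IsTwistOf.of_iso {F F' : TensorAut C} {P : Bimod C} (h : IsTwistOf F.toFunctor P)
    (e : F.Iso F') : IsTwistOf F'.toFunctor P := by
  obtain ⟨e, _⟩ := e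
  exact h.ofTwistIso e

theorem TensorAut.comp_inverse (F : TensorAut C) : (F.comp F.inverse).Iso TensorAut.id := by
  have h : EqGroup.mk F.inverse * EqGroup.mk F = 1 := Quotient.sound F.inverse_comp
  exact Quotient.exact (mul_eq_one_comm.1 h : EqGroup.mk F * EqGroup.mk F.inverse = 1)

variable [MonoidalPreadditive C] [MonoidalLinear ℂ C] [IsFiniteSemisimple C]

theorem isTwistOf_regular : IsTwistOf (𝟭 C) (regular C) := by
  refine ⟨(𝟙_ C : C),
    { iso := fun y => (λ_ y ≪≫ (ρ_ y).symm : 𝟙_ C ⊗ y ≅ y ⊗ 𝟙_ C)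
      naturality := fun {y y'} f => ?_
      hexagon := fun x y => ?_
      unit := ?_ }, ?_⟩
  · change 𝟙_ C ◁ f ≫ (λ_ y').hom ≫ (ρ_ y').inv = ((λ_ y).hom ≫ (ρ_ y).inv) ≫ f ▷ 𝟙_ C
    simp
  · change (λ_ (x ⊗ y)).hom ≫ (ρ_ (x ⊗ y)).inv = (α_ _ _ _).inv ≫
      ((λ_ x).hom ≫ (ρ_ x).inv) ▷ y ≫ (α_ _ _ _).hom ≫ x ◁ ((λ_ y).hom ≫ (ρ_ y).inv) ≫
        (α_ _ _ _).inv ≫ 𝟙 _ ▷ 𝟙_ C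
    simp
  · change (λ_ (𝟙_ C)).hom ≫ (ρ_ (𝟙_ C)).inv = (ρ_ (𝟙_ C)).hom ≫ (λ_ (𝟙_ C)).inv ≫ 𝟙 _ ▷ 𝟙_ C
    simp [unitors_equal, unitors_inv_equal]
  · have i : 𝟭 C ≅ tensorRight (𝟙_ C) := NatIso.ofComponents (fun c => (ρ_ c).symm)
      fun f => rightUnitor_inv_naturality f
    exact (Functor.isEquivalence_of_iso i : (tensorRight (𝟙_ C)).IsEquivalence)

/-- If the regular bimodule category is generated by an `F`-twisted central object, then `F` is an
equivalence: it is conjugation by an invertible object. -/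
theorem IsTwistOf.isEquivalence {F : C ⥤ C} [F.Monoidal] (h : IsTwistOf F (regular C)) :
    F.IsEquivalence := by
  obtain ⟨(p : C), t, hp⟩ := h
  have : (tensorRight p).IsEquivalence := hp
  obtain ⟨q, ⟨i⟩, ⟨j⟩⟩ := exists_inverse_of_isEquivalence_tensorRight p
  have := isEquivalence_tensorLeft j i
  let e (y : C) : p ⊗ y ≅ F.obj y ⊗ p := t.iso y
  have he {y y' : C} (f : y ⟶ y') : p ◁ f ≫ (e y').hom = (e y).hom ≫ F.map f ▷ p :=
    t.naturality f
  have e' : tensorLeft p ≅ F ⋙ tensorRight p := NatIso.ofComponents e he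
  have : (F ⋙ tensorRight p).IsEquivalence := Functor.isEquivalence_of_iso e'
  exact Functor.isEquivalence_of_comp_right F (tensorRight p)

theorem IsTwistOf.exists_leftLinear {F : C ⥤ C} [F.Monoidal] [F.Additive] [F.Linear ℂ]
    {P : Bimod C} (h : IsTwistOf F P) : ∃ K : regular C ⥤ P, K.Additive ∧ K.Linear ℂ ∧
      K.IsEquivalence ∧ Nonempty (K.LeftLinear C) := by
  obtain ⟨p, t, hp⟩ := h
  exact ⟨t.functor.toFunctor, t.functor.additive, t.functor.linear, hp, ⟨t.functor.left⟩⟩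

/-- Every outer bimodule category `M` is a bimodule category `C_F` for a tensor autoequivalence `F`.
Left triviality gives a tensor functor `F`, and invertibility of `M` makes it an equivalence. -/
theorem Bimod.IsOuter.exists_isTwistOf {M : Bimod C} (hM : M.IsOuter) :
    ∃ F : TensorAut C, IsTwistOf F.toFunctor M := by
  obtain ⟨⟨N, hMN, hNM⟩, K, -, -, hK, ⟨hl⟩⟩ := hM
  obtain ⟨F, _, _, _, hF⟩ := FusionLES.exists_isTwistOf K
  -- `N_F` is the regular bimodule category, with the same left action as `N`
  have hNF : (N.restrict F).Equivalent (regular C) := hF.isRelTensor_iff.1 hNM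
  obtain ⟨E, hE⟩ := (Bimod.setoid C).iseqv.symm hNF
  let K' : regular C ⥤ N := E.toFunctor
  have : K'.IsEquivalence := hE
  let _ : K'.LeftLinear C := E.left
  obtain ⟨G, _, _, _, hG⟩ := FusionLES.exists_isTwistOf K'
  have hMG : (M.restrict G).Equivalent (regular C) := hG.isRelTensor_iff.1 hMN
  -- both composites twist the regular bimodule category into itself
  have h1 : (F ⋙ G).IsEquivalence := ((hG.restrict F).of_equivalent hNF).isEquivalence
  have h2 : (G ⋙ F).IsEquivalence := ((hF.restrict G).of_equivalent hMG).isEquivalence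
  have : F.IsEquivalence := isEquivalence_of_comp_isEquivalence F G
  exact ⟨{ toFunctor := F }, hF⟩

theorem isTwistOf_twisted (F : TensorAut C) : IsTwistOf F.toFunctor (twisted F) :=
  isTwistOf_self F.toFunctor

theorem twisted_equivalent_iff {F : TensorAut C} {P : Bimod C} :
    (twisted F).Equivalent P ↔ IsTwistOf F.toFunctor P :=
  equivalent_iff_isTwistOf

/-- `C_F ⊠_C C_G` is `C_{F ∘ G}`, for bimodule categories given by twisted central generators. -/
theorem IsTwistOf.isRelTensor_iff_comp {F G : TensorAut C} {M N P : Bimod C}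
    (hM : IsTwistOf F.toFunctor M) (hN : IsTwistOf G.toFunctor N) :
    IsRelTensor M N P ↔ IsTwistOf (F.comp G).toFunctor P :=
  hN.isRelTensor_iff.trans
    ⟨fun h => (hM.restrict G.toFunctor).of_equivalent h, fun h =>
      (hM.restrict G.toFunctor).equivalent (F := G.toFunctor ⋙ F.toFunctor) h⟩

theorem isRelTensor_twisted_regular {F G : TensorAut C} (h : (F.comp G).Iso TensorAut.id) :
    IsRelTensor (twisted F) (twisted G) (regular C) :=
  ((isTwistOf_twisted F).isRelTensor_iff_comp (isTwistOf_twisted G)).2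
    (IsTwistOf.of_iso (F := TensorAut.id) isTwistOf_regular ((TensorAut.setoid C).iseqv.symm h))

theorem isOuter_twisted (F : TensorAut C) : (twisted F).IsOuter where
  invertible := ⟨twisted F.inverse, isRelTensor_twisted_regular F.comp_inverse,
    isRelTensor_twisted_regular F.inverse_comp⟩
  left_trivial := (isTwistOf_twisted F).exists_leftLinear

variable (C) in
/-- The map `Eq(C) → Out(C)`, `F ↦ C_F`. -/
def EqGroup.toOut : EqGroup C → Out C :=
  Quotient.map (fun F => ⟨twisted F, isOuter_twisted F⟩) fun _ _ h =>
    twisted_equivalent_iff.2 (((isTwistOf_twisted _).of_iso ((TensorAut.setoid C).iseqv.symm h)))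

theorem EqGroup.toOut_mk_eq_iff {F : TensorAut C} {P : OuterBimod C} :
    toOut C (mk F) = Out.mk P ↔ IsTwistOf F.toFunctor P.1 :=
  ⟨fun h => twisted_equivalent_iff.1 (Quotient.exact h), fun h =>
    Quotient.sound (s := (Bimod.setoid C).comap (Subtype.val : OuterBimod C → Bimod C))
      (twisted_equivalent_iff.2 h)⟩

variable (C) in
theorem EqGroup.toOut_surjective : Function.Surjective (toOut C) := by
  rintro ⟨P⟩
  obtain ⟨F, hF⟩ := P.2.exists_isTwistOf
  exact ⟨mk F, toOut_mk_eq_iff.2 hF⟩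

theorem EqGroup.toOut_mk_mul_eq_iff {F G : TensorAut C} {M N P : OuterBimod C}
    (hM : toOut C (mk F) = Out.mk M) (hN : toOut C (mk G) = Out.mk N) :
    toOut C (mk F * mk G) = Out.mk P ↔ IsRelTensor M.1 N.1 P.1 :=
  (toOut_mk_eq_iff (F := F.comp G)).trans
    ((toOut_mk_eq_iff.1 hM).isRelTensor_iff_comp (toOut_mk_eq_iff.1 hN)).symm

variable (C) in
/-- The fibres of `Eq(C) → Out(C)` form a group congruence, because `C_{F ∘ G}` is the relative
tensor product of `C_F` and `C_G`. -/
def EqGroup.outCon : Con (EqGroup C) where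
  toSetoid := Setoid.ker (toOut C)
  mul' := by
    rintro ⟨F⟩ ⟨F'⟩ ⟨G⟩ ⟨G'⟩ (h : toOut C (mk F) = toOut C (mk F'))
      (h' : toOut C (mk G) = toOut C (mk G'))
    change toOut C (mk F * mk G) = toOut C (mk F' * mk G')
    exact (toOut_mk_mul_eq_iff h h').2 ((toOut_mk_mul_eq_iff (P := ⟨_, isOuter_twisted _⟩)
      (rfl : toOut C (mk F') = Out.mk ⟨_, isOuter_twisted F'⟩)
      (rfl : toOut C (mk G') = Out.mk ⟨_, isOuter_twisted G'⟩)).1 rfl)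

variable (C) in
/-- `Out(C)` is the quotient of `Eq(C)` by the fibres of `F ↦ C_F`. -/
def outEquiv : (EqGroup.outCon C).Quotient ≃ Out C :=
  Setoid.quotientKerEquivOfSurjective (EqGroup.toOut C) (EqGroup.toOut_surjective C)

/-- The group structure on `Out(C)`. -/
instance : Group (Out C) := (outEquiv C).symm.group

variable (C) in
/-- The homomorphism `Eq(C) → Out(C)`, `F ↦ C_F`. -/
def EqGroup.toOutHom : EqGroup C →* Out C where
  toFun := toOut C
  map_one' := rfl
  map_mul' x y := by
    have h (z : EqGroup C) : (outEquiv C).symm (toOut C z) = (EqGroup.outCon C).mk' z :=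
      (outEquiv C).symm_apply_eq.2 rfl
    apply (outEquiv C).symm.injective
    refine Eq.trans ?_ ((outEquiv C).symm.mulEquiv.map_mul _ _).symm
    change _ = (outEquiv C).symm _ * (outEquiv C).symm _
    rw [h, h, h, map_mul]

theorem Out.mk_mul_mk_eq_iff (M N P : OuterBimod C) :
    Out.mk M * Out.mk N = Out.mk P ↔ IsRelTensor M.1 N.1 P.1 := by
  obtain ⟨F, hF⟩ := M.2.exists_isTwistOf
  obtain ⟨G, hG⟩ := N.2.exists_isTwistOf
  have h := EqGroup.toOut_mk_eq_iff.2 hF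
  have h' := EqGroup.toOut_mk_eq_iff.2 hG
  have hmul : EqGroup.toOut C (EqGroup.mk F * EqGroup.mk G) =
      EqGroup.toOut C (EqGroup.mk F) * EqGroup.toOut C (EqGroup.mk G) :=
    (EqGroup.toOutHom C).map_mul (EqGroup.mk F) (EqGroup.mk G)
  rw [← EqGroup.toOut_mk_mul_eq_iff h h', hmul, h, h']

end Outer

/-! ### Inner autoequivalences and twisted central objects of `C` -/

section InvGroup

variable {C : Type u} [Category.{v} C] [MonoidalCategory C] [RigidCategory C]

theorem InvGroup.exists_mk_eq {g h : C} (i : g ⊗ h ≅ 𝟙_ C) (j : h ⊗ g ≅ 𝟙_ C) :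
    ∃ (g' : C) (_ : IsInvertibleObj g'), Nonempty (g ≅ g') := by
  let x : InvGroup C :=
    { val := toSkeleton g
      inv := toSkeleton h
      val_inv := by
        rw [← Skeleton.toSkeleton_tensorObj]
        exact Quotient.sound ⟨i⟩
      inv_val := by
        rw [← Skeleton.toSkeleton_tensorObj]
        exact Quotient.sound ⟨j⟩ }
  obtain ⟨g', hg', h⟩ := InvGroup.mk_surjective x
  exact ⟨g', hg', Quotient.exact (congrArg Units.val h).symm⟩

theorem InvGroup.mk_eq_mk_iff {g h : C} {hg : IsInvertibleObj g} {hh : IsInvertibleObj h} :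
    InvGroup.mk g hg = InvGroup.mk h hh ↔ Nonempty (g ≅ h) :=
  Units.ext_iff.trans ⟨Quotient.exact, fun i => Quotient.sound i⟩

end InvGroup

section Inner

variable {C : Type u} [Category.{v} C] [Abelian C] [Linear ℂ C] [MonoidalCategory C]

namespace TwistedCentral

variable {F F' : C ⥤ C} [F.Monoidal] [F'.Monoidal] {P : Bimod C} {p p' : P}

/-- A twisted central structure can be transported along an isomorphism of objects. -/
def ofIso (t : TwistedCentral F P p) (e : p ≅ p') : TwistedCentral F P p' where
  iso y :=
    { hom := e.inv ⊵ᵣ y ≫ (t.iso y).hom ≫ F.obj y ⊴ₗ e.hom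
      inv := F.obj y ⊴ₗ e.inv ≫ (t.iso y).inv ≫ e.hom ⊵ᵣ y }
  naturality {y y'} f := by
    dsimp only
    rw [Category.assoc, Category.assoc, MonoidalLeftAction.action_exchange,
      ← reassoc_of% t.naturality f, MonoidalRightAction.action_exchange_assoc]
  hexagon x y := by
    have h1 := P.mid_naturality_middle (F.obj x) e.hom y
    have h2 : F.obj x ⊴ₗ (e.hom ⊵ᵣ y) ≫ F.obj x ⊴ₗ (e.inv ⊵ᵣ y) = 𝟙 _ := by
      simp [← MonoidalLeftAction.actionHomRight_comp]
    have h3 : (αₗ (F.obj x) (F.obj y) p).inv ≫ (F.obj x ⊗ F.obj y) ⊴ₗ e.hom =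
        F.obj x ⊴ₗ F.obj y ⊴ₗ e.hom ≫ (αₗ (F.obj x) (F.obj y) p').inv := by
      simp
    dsimp only
    rw [t.hexagon]
    simp only [MonoidalRightAction.comp_actionHomLeft, MonoidalLeftAction.actionHomRight_comp,
      Category.assoc, reassoc_of% h1, reassoc_of% h2, ← reassoc_of% h3,
      MonoidalRightAction.actionHomLeft_tensor, Iso.inv_hom_id_assoc,
      MonoidalLeftAction.action_exchange]
  unit := by
    dsimp only
    rw [t.unit]
    simp only [Category.assoc, ← MonoidalLeftAction.action_exchange,
      MonoidalRightAction.unit_actionHomRight, MonoidalLeftAction.unit_actionHomRight,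
      Iso.inv_hom_id_assoc]

/-- The twist of a generator is determined up to monoidal isomorphism. -/
theorem exists_monoidal_iso [(P.orbit p).IsEquivalence] (t : TwistedCentral F P p)
    (t' : TwistedCentral F' P p) : ∃ e : F ≅ F', NatTrans.IsMonoidal e.hom := by
  let s (y : C) : F.obj y ≅ F'.obj y := (P.orbit p).preimageIso ((t.iso y).symm ≪≫ t'.iso y)
  have hs (y : C) : (s y).hom ⊵ₗ p = (t.iso y).inv ≫ (t'.iso y).hom :=
    (P.orbit p).map_preimage _
  have hs' (y : C) : (t.iso y).hom ≫ (s y).hom ⊵ₗ p = (t'.iso y).hom := by simp [hs]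
  refine ⟨NatIso.ofComponents s fun {y y'} f => P.orbit_map_injective p ?_, ?_, fun x y => ?_⟩
  · rw [MonoidalLeftAction.comp_actionHomLeft, MonoidalLeftAction.comp_actionHomLeft,
      ← cancel_epi (t.iso y).hom, reassoc_of% hs' y, ← t'.naturality, ← hs',
      ← reassoc_of% t.naturality f]
  · apply P.orbit_map_injective p
    change (_ ≫ (s (𝟙_ C)).hom) ⊵ₗ p = _
    have h := hs' (𝟙_ C)
    rw [t.unit, t'.unit] at h
    rw [MonoidalLeftAction.comp_actionHomLeft]
    simpa using h
  · apply P.orbit_map_injective p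
    change (_ ≫ (s (x ⊗ y)).hom) ⊵ₗ p = (((s x).hom ⊗ₘ (s y).hom) ≫ _) ⊵ₗ p
    have h := hs' (x ⊗ y)
    have h1 := P.mid_naturality_left (s x).hom p y
    have h2 : (s x).hom ⊵ₗ (F.obj y ⊙ₗ p) ≫ F'.obj x ⊴ₗ ((s y).hom ⊵ₗ p) ≫
        (αₗ (F'.obj x) (F'.obj y) p).inv = (αₗ (F.obj x) (F.obj y) p).inv ≫
          ((s x).hom ⊗ₘ (s y).hom) ⊵ₗ p := by
      rw [MonoidalCategory.tensorHom_def, MonoidalLeftAction.comp_actionHomLeft,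
        MonoidalLeftAction.whiskerLeft_actionHomLeft, MonoidalLeftAction.actionHomLeft_action]
      simp
    rw [t.hexagon, t'.hexagon, ← hs' x, ← hs' y] at h
    simp only [MonoidalRightAction.comp_actionHomLeft, MonoidalLeftAction.actionHomRight_comp,
      Category.assoc, reassoc_of% h1] at h
    rw [← MonoidalLeftAction.action_exchange_assoc, reassoc_of% h2] at h
    rw [MonoidalLeftAction.comp_actionHomLeft, MonoidalLeftAction.comp_actionHomLeft,
      ← cancel_epi ((αᵣ p x y).hom ≫ (t.iso x).hom ⊵ᵣ y ≫ (P.mid (F.obj x) p y).hom ≫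
        F.obj x ⊴ₗ (t.iso y).hom ≫ (αₗ (F.obj x) (F.obj y) p).inv)]
    simpa only [Category.assoc] using h

end TwistedCentral

variable [MonoidalPreadditive C] [MonoidalLinear ℂ C] [IsFiniteSemisimple C]

/-- The product of an `F`-twisted and a `G`-twisted central object of `C` is `F ∘ G`-twisted
central. -/
def TwistedCentral.tensor {F G : C ⥤ C} [F.Monoidal] [G.Monoidal] {g h : C}
    (t : TwistedCentral F (regular C) g) (s : TwistedCentral G (regular C) h) :
    TwistedCentral (G ⋙ F) (regular C) (g ⊗ h : C) :=
  let t' (y : C) : g ⊗ y ≅ F.obj y ⊗ g := t.iso y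
  let s' (y : C) : h ⊗ y ≅ G.obj y ⊗ h := s.iso y
  { iso := fun y => (α_ g h y ≪≫ whiskerLeftIso g (s' y) ≪≫ (α_ g (G.obj y) h).symm ≪≫
      whiskerRightIso (t' (G.obj y)) h ≪≫ α_ (F.obj (G.obj y)) g h :
        (g ⊗ h) ⊗ y ≅ F.obj (G.obj y) ⊗ (g ⊗ h))
    naturality := fun {y y'} f => by
      have ht : g ◁ G.map f ≫ (t' (G.obj y')).hom = (t' (G.obj y)).hom ≫ F.map (G.map f) ▷ g :=
        t.naturality (G.map f)
      have hs : h ◁ f ≫ (s' y').hom = (s' y).hom ≫ G.map f ▷ h := s.naturality f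
      change (g ⊗ h) ◁ f ≫ (α_ g h y').hom ≫ g ◁ (s' y').hom ≫ (α_ g (G.obj y') h).inv ≫
          (t' (G.obj y')).hom ▷ h ≫ (α_ (F.obj (G.obj y')) g h).hom =
        ((α_ g h y).hom ≫ g ◁ (s' y).hom ≫ (α_ g (G.obj y) h).inv ≫
          (t' (G.obj y)).hom ▷ h ≫ (α_ (F.obj (G.obj y)) g h).hom) ≫
            F.map (G.map f) ▷ (g ⊗ h)
      calc
        _ = (α_ g h y).hom ≫ g ◁ (h ◁ f ≫ (s' y').hom) ≫ (α_ g (G.obj y') h).inv ≫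
          (t' (G.obj y')).hom ▷ h ≫ (α_ (F.obj (G.obj y')) g h).hom := by simp
        _ = (α_ g h y).hom ≫ g ◁ (s' y).hom ≫ (α_ g (G.obj y) h).inv ≫
          (g ◁ G.map f ≫ (t' (G.obj y')).hom) ▷ h ≫ (α_ (F.obj (G.obj y')) g h).hom := by
            rw [hs]; simp
        _ = _ := by rw [ht]; simp
    hexagon := fun x y => by
      have ht : (t' (G.obj x ⊗ G.obj y)).hom = (α_ g (G.obj x) (G.obj y)).inv ≫
          (t' (G.obj x)).hom ▷ G.obj y ≫ (α_ _ _ _).hom ≫ F.obj (G.obj x) ◁ (t' (G.obj y)).hom ≫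
            (α_ _ _ _).inv ≫ Functor.LaxMonoidal.μ F (G.obj x) (G.obj y) ▷ g :=
        t.hexagon (G.obj x) (G.obj y)
      have ht' : g ◁ Functor.LaxMonoidal.μ G x y ≫ (t' (G.obj (x ⊗ y))).hom =
          (t' (G.obj x ⊗ G.obj y)).hom ≫ F.map (Functor.LaxMonoidal.μ G x y) ▷ g :=
        t.naturality (Functor.LaxMonoidal.μ G x y)
      have hs : (s' (x ⊗ y)).hom = (α_ h x y).inv ≫ (s' x).hom ▷ y ≫ (α_ _ _ _).hom ≫
          G.obj x ◁ (s' y).hom ≫ (α_ _ _ _).inv ≫ Functor.LaxMonoidal.μ G x y ▷ h :=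
        s.hexagon x y
      change (α_ g h (x ⊗ y)).hom ≫ g ◁ (s' (x ⊗ y)).hom ≫ (α_ g (G.obj (x ⊗ y)) h).inv ≫
          (t' (G.obj (x ⊗ y))).hom ▷ h ≫ (α_ (F.obj (G.obj (x ⊗ y))) g h).hom =
        (α_ (g ⊗ h) x y).inv ≫ ((α_ g h x).hom ≫ g ◁ (s' x).hom ≫ (α_ g (G.obj x) h).inv ≫
          (t' (G.obj x)).hom ▷ h ≫ (α_ (F.obj (G.obj x)) g h).hom) ▷ y ≫ (α_ _ _ _).hom ≫
          F.obj (G.obj x) ◁ ((α_ g h y).hom ≫ g ◁ (s' y).hom ≫ (α_ g (G.obj y) h).inv ≫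
            (t' (G.obj y)).hom ▷ h ≫ (α_ (F.obj (G.obj y)) g h).hom) ≫ (α_ _ _ _).inv ≫
          (Functor.LaxMonoidal.μ F (G.obj x) (G.obj y) ≫
            F.map (Functor.LaxMonoidal.μ G x y)) ▷ (g ⊗ h)
      calc
        _ = 𝟙 _ ⊗≫ g ◁ (s' x).hom ▷ y ⊗≫ g ◁ G.obj x ◁ (s' y).hom ⊗≫
          (g ◁ Functor.LaxMonoidal.μ G x y ≫ (t' (G.obj (x ⊗ y))).hom) ▷ h ⊗≫ 𝟙 _ := by
            rw [hs]; monoidal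
        _ = 𝟙 _ ⊗≫ g ◁ (s' x).hom ▷ y ⊗≫ ((g ⊗ G.obj x) ◁ (s' y).hom ≫
              (t' (G.obj x)).hom ▷ (G.obj y ⊗ h)) ⊗≫
            F.obj (G.obj x) ◁ (t' (G.obj y)).hom ▷ h ⊗≫
              (Functor.LaxMonoidal.μ F (G.obj x) (G.obj y) ≫
                F.map (Functor.LaxMonoidal.μ G x y)) ▷ (g ⊗ h) ⊗≫ 𝟙 _ := by
            rw [ht', ht]; monoidal
        _ = _ := by rw [whisker_exchange]; monoidal
    unit := by
      have ht : (t' (𝟙_ C)).hom = (ρ_ g).hom ≫ (λ_ g).inv ≫ Functor.LaxMonoidal.ε F ▷ g := t.unit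
      have ht' : g ◁ Functor.LaxMonoidal.ε G ≫ (t' (G.obj (𝟙_ C))).hom =
          (t' (𝟙_ C)).hom ≫ F.map (Functor.LaxMonoidal.ε G) ▷ g :=
        t.naturality (Functor.LaxMonoidal.ε G)
      have hs : (s' (𝟙_ C)).hom = (ρ_ h).hom ≫ (λ_ h).inv ≫ Functor.LaxMonoidal.ε G ▷ h := s.unit
      change (α_ g h (𝟙_ C)).hom ≫ g ◁ (s' (𝟙_ C)).hom ≫ (α_ g (G.obj (𝟙_ C)) h).inv ≫
          (t' (G.obj (𝟙_ C))).hom ▷ h ≫ (α_ (F.obj (G.obj (𝟙_ C))) g h).hom =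
        (ρ_ (g ⊗ h)).hom ≫ (λ_ (g ⊗ h)).inv ≫
          (Functor.LaxMonoidal.ε F ≫ F.map (Functor.LaxMonoidal.ε G)) ▷ (g ⊗ h)
      calc
        _ = 𝟙 _ ⊗≫ (g ◁ Functor.LaxMonoidal.ε G ≫ (t' (G.obj (𝟙_ C))).hom) ▷ h ⊗≫ 𝟙 _ := by
            rw [hs]; monoidal
        _ = _ := by rw [ht', ht]; monoidal }

variable [RigidCategory C]

/-- An invertible object `g` is twisted central for the inner autoequivalence `F_g`. -/
def innerTwistedCentral (g : C) (hg : IsInvertibleObj g) :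
    TwistedCentral (innerAut g hg).toFunctor (regular C) g :=
  haveI := hg.ev
  let s (y : C) : g ⊗ y ≅ ((g ⊗ y) ⊗ gᘁ) ⊗ g :=
    (α_ (g ⊗ y) gᘁ g ≪≫ whiskerLeftIso (g ⊗ y) (asIso (ε_ g gᘁ)) ≪≫ ρ_ (g ⊗ y)).symm
  have hs (y : C) : (s y).inv = (α_ (g ⊗ y) gᘁ g).hom ≫ (g ⊗ y) ◁ ε_ g gᘁ ≫ (ρ_ (g ⊗ y)).hom :=
    rfl
  { iso := s
    naturality := fun {y y'} f => by
      change g ◁ f ≫ (s y').hom = (s y).hom ≫ ((g ◁ f) ▷ gᘁ) ▷ g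
      rw [← Iso.inv_comp_eq, ← Category.assoc, ← Iso.eq_comp_inv, hs, hs]
      calc
        _ = (α_ (g ⊗ y) gᘁ g).hom ≫ ((g ⊗ y) ◁ ε_ g gᘁ ≫ (g ◁ f) ▷ 𝟙_ C) ≫
            (ρ_ (g ⊗ y')).hom := by simp
        _ = _ := by rw [whisker_exchange]; simp
    hexagon := fun x y => by
      change (s (x ⊗ y)).hom = (α_ g x y).inv ≫ (s x).hom ▷ y ≫ (α_ _ _ _).hom ≫
        ((g ⊗ x) ⊗ gᘁ) ◁ (s y).hom ≫ (α_ _ _ _).inv ≫ (conjμ g hg x y).hom ▷ g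
      have key : (α_ _ _ _).hom ≫ ((g ⊗ x) ⊗ gᘁ) ◁ (s y).inv ≫ (α_ _ _ _).inv ≫ (s x).inv ▷ y ≫
          (α_ g x y).hom = (conjμ g hg x y).hom ▷ g ≫ (s (x ⊗ y)).inv := by
        rw [hs, hs, hs, conjμ_hom]
        calc
          _ = 𝟙 _ ⊗≫ (g ⊗ x) ◁ ((gᘁ ⊗ g) ◁ (y ◁ ε_ g gᘁ) ≫ ε_ g gᘁ ▷ (y ⊗ 𝟙_ C)) ⊗≫ 𝟙 _ := by
            monoidal
          _ = _ := by rw [whisker_exchange]; monoidal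
      rw [← cancel_mono (s (x ⊗ y)).inv, Iso.hom_inv_id]
      simp only [Category.assoc]
      rw [← key]
      simp
    unit := by
      change (s (𝟙_ C)).hom = (ρ_ g).hom ≫ (λ_ g).inv ≫ (η_ g gᘁ ≫ (ρ_ g).inv ▷ gᘁ) ▷ g
      rw [← cancel_mono (s (𝟙_ C)).inv, Iso.hom_inv_id, hs]
      have h := ExactPairing.evaluation_coevaluation g gᘁ
      calc
        _ = 𝟙 _ ⊗≫ ((λ_ g).hom ≫ (ρ_ g).inv) ⊗≫ 𝟙 _ := by monoidal
        _ = _ := by rw [← h]; monoidal }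

/-- `g` is `G`-twisted central if and only if `G` is isomorphic to the inner autoequivalence
`F_g`. -/
theorem innerAut_iso_iff {g : C} {hg : IsInvertibleObj g} {G : TensorAut C} :
    (innerAut g hg).Iso G ↔ Nonempty (TwistedCentral G.toFunctor (regular C) g) := by
  have h1 := hg.ev
  have h2 := hg.coev
  have : (tensorRight g).IsEquivalence :=
    isEquivalence_tensorRight (asIso (ε_ g gᘁ)) (asIso (η_ g gᘁ)).symm
  have : ((regular C).orbit g).IsEquivalence := this
  exact ⟨fun ⟨e, _⟩ => ⟨(innerTwistedCentral g hg).ofTwistIso e⟩, fun ⟨t⟩ =>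
    (innerTwistedCentral g hg).exists_monoidal_iso t⟩

theorem innerAut_iso_of_iso {g h : C} (hg : IsInvertibleObj g) (hh : IsInvertibleObj h)
    (i : g ≅ h) : (innerAut g hg).Iso (innerAut h hh) :=
  innerAut_iso_iff.2 ⟨(innerTwistedCentral h hh).ofIso i.symm⟩

variable (C) in
/-- The homomorphism `Inv(C) → Eq(C)`, `g ↦ F_g`. -/
def InvGroup.toEq : InvGroup C →* EqGroup C :=
  MonoidHom.mk' (fun x => EqGroup.mk (innerAut _ (InvGroup.mk_surjective x).choose_spec.choose))
    fun x y => by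
      have hx := (InvGroup.mk_surjective x).choose_spec.choose_spec
      have hy := (InvGroup.mk_surjective y).choose_spec.choose_spec
      have hxy := (InvGroup.mk_surjective (x * y)).choose_spec.choose_spec
      set hg := (InvGroup.mk_surjective x).choose_spec.choose
      set hh := (InvGroup.mk_surjective y).choose_spec.choose
      set hk := (InvGroup.mk_surjective (x * y)).choose_spec.choose
      have h := hxy.trans (congrArg₂ (· * ·) hx hy).symm
      have h' := congrArg Units.val h
      obtain ⟨i⟩ : Nonempty (_ ≅ _ ⊗ _) := Quotient.exact
        (h'.trans (Skeleton.toSkeleton_tensorObj _ _).symm)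
      exact Quotient.sound (innerAut_iso_iff (G := (innerAut _ hg).comp (innerAut _ hh)).2
        ⟨(((innerTwistedCentral _ hg).tensor (innerTwistedCentral _ hh))).ofIso i.symm⟩)

theorem InvGroup.toEq_mk (g : C) (hg : IsInvertibleObj g) :
    InvGroup.toEq C (InvGroup.mk g hg) = EqGroup.mk (innerAut g hg) := by
  have h := (InvGroup.mk_surjective (InvGroup.mk g hg)).choose_spec.choose_spec
  obtain ⟨i⟩ := InvGroup.mk_eq_mk_iff.1 h
  exact Quotient.sound (innerAut_iso_of_iso _ _ i)

/-- `C_G` is equivalent to the regular bimodule category if and only if `G` is inner. -/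
theorem InvGroup.toEq_mulExact_toOutHom :
    Function.MulExact (InvGroup.toEq C) (EqGroup.toOutHom C) := by
  rintro ⟨G⟩
  change EqGroup.toOut C (EqGroup.mk G) = Out.mk ⟨twisted TensorAut.id, isOuter_twisted _⟩ ↔ _
  rw [EqGroup.toOut_mk_eq_iff]
  have hid : (twisted TensorAut.id).Equivalent (regular C) :=
    (isTwistOf_twisted (TensorAut.id (C := C))).equivalent (F := 𝟭 C) isTwistOf_regular
  constructor
  · intro h
    obtain ⟨(p : C), t, hp⟩ := h.of_equivalent hid
    have : (tensorRight p).IsEquivalence := hp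
    obtain ⟨q, ⟨i⟩, ⟨j⟩⟩ := exists_inverse_of_isEquivalence_tensorRight p
    obtain ⟨g, hg, ⟨k⟩⟩ := InvGroup.exists_mk_eq j i
    refine ⟨InvGroup.mk g hg, ?_⟩
    rw [InvGroup.toEq_mk]
    exact Quotient.sound (innerAut_iso_iff.2 ⟨t.ofIso k⟩)
  · rintro ⟨x, hx⟩
    obtain ⟨g, hg, rfl⟩ := InvGroup.mk_surjective x
    rw [InvGroup.toEq_mk] at hx
    obtain ⟨t⟩ := innerAut_iso_iff.1 (Quotient.exact hx)
    have h1 := hg.ev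
    have h2 := hg.coev
    have : (tensorRight g).IsEquivalence :=
      isEquivalence_tensorRight (asIso (ε_ g gᘁ)) (asIso (η_ g gᘁ)).symm
    have ht : IsTwistOf G.toFunctor (regular C) := ⟨(g : C), t, this⟩
    exact ht.of_equivalent ((Bimod.setoid C).iseqv.symm hid)

end Inner

/-! ### Bimodule autoequivalences of `C` and invertible objects of the center -/

section CenterLemmas

variable {C : Type u} [Category.{v} C] [MonoidalCategory C]

theorem nonempty_center_iso_iff {Z Z' : Center C} : Nonempty (Z ≅ Z') ↔
    ∃ i : Z.1 ≅ Z'.1, ∀ U, i.hom ▷ U ≫ (Z'.2.β U).hom = (Z.2.β U).hom ≫ U ◁ i.hom := by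
  constructor
  · rintro ⟨e⟩
    exact ⟨⟨e.hom.f, e.inv.f, congrArg Center.Hom.f e.hom_inv_id,
      congrArg Center.Hom.f e.inv_hom_id⟩, e.hom.comm⟩
  · rintro ⟨i, hi⟩
    have : IsIso (⟨i.hom, hi⟩ : Z ⟶ Z').f := inferInstanceAs (IsIso i.hom)
    exact ⟨Center.isoMk ⟨i.hom, hi⟩⟩

/-- The unit axiom of a half-braiding. -/
theorem halfBraiding_unit {X : C} (b : HalfBraiding X) :
    (b.β (𝟙_ C)).hom = (ρ_ X).hom ≫ (λ_ X).inv := by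
  -- the braiding with `𝟙` differs from the canonical one by an idempotent automorphism `c`
  obtain ⟨c, hb⟩ : ∃ c : X ≅ X, (b.β (𝟙_ C)).hom = (ρ_ X).hom ≫ c.hom ≫ (λ_ X).inv :=
    ⟨(ρ_ X).symm ≪≫ b.β (𝟙_ C) ≪≫ λ_ X, by simp⟩
  have h1 := b.monoidal (𝟙_ C) (𝟙_ C)
  have h2 := b.naturality (λ_ (𝟙_ C)).hom
  rw [h1, hb] at h2
  have h3 : c.hom ≫ c.hom = c.hom := by
    generalize c.hom = d at h2 ⊢
    have h4 := congrArg (fun s => (ρ_ X).inv ≫ X ◁ (λ_ (𝟙_ C)).inv ≫ s ≫ (λ_ X).hom) h2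
    calc
      _ = (ρ_ X).inv ≫ X ◁ (λ_ (𝟙_ C)).inv ≫ (((α_ _ _ _).inv ≫
          ((ρ_ X).hom ≫ d ≫ (λ_ X).inv) ▷ 𝟙_ C ≫ (α_ _ _ _).hom ≫
            𝟙_ C ◁ ((ρ_ X).hom ≫ d ≫ (λ_ X).inv) ≫ (α_ _ _ _).inv) ≫
              (λ_ (𝟙_ C)).hom ▷ X) ≫ (λ_ X).hom := by monoidal
      _ = _ := by rw [← h4]; simp
  have h4 : c.hom = 𝟙 X := by
    rw [← cancel_epi c.hom, h3, Category.comp_id]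
  rw [hb, h4, Category.id_comp]

end CenterLemmas

section UnitObject

variable {C : Type u} [Category.{v} C] [Abelian C] [Linear ℂ C] [MonoidalCategory C]

/-- The identity functor as a bimodule functor `M_𝟭 ⟶ M`. -/
def Bimod.restrictId (M : Bimod C) : BimodFunctor (M.restrict (𝟭 C)) M :=
  let K : M.restrict (𝟭 C) ⥤ M := 𝟭 M
  letI l : K.LaxLeftLinear C :=
    { μₗ := fun x (m : M) => 𝟙 (x ⊙ₗ m)
      μₗ_naturality_left := fun {x x'} f (m : M) => by
        change f ⊵ₗ m ≫ 𝟙 _ = 𝟙 _ ≫ f ⊵ₗ m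
        simp
      μₗ_naturality_right := fun x {m m' : M} (f : m ⟶ m') => by
        change x ⊴ₗ f ≫ 𝟙 _ = 𝟙 _ ≫ x ⊴ₗ f
        simp
      μₗ_associativity := fun x y (m : M) => by
        change 𝟙 _ ≫ (αₗ x y m).hom = (αₗ x y m).hom ≫ x ⊴ₗ 𝟙 _ ≫ 𝟙 _
        simp
      μₗ_unitality := fun (m : M) => by
        change (λₗ m).hom = 𝟙 _ ≫ (λₗ m).hom
        simp }
  letI r : K.LaxRightLinear C :=
    { μᵣ := fun (m : M) y => 𝟙 (m ⊙ᵣ y)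
      μᵣ_naturality_left := fun {m m' : M} (f : m ⟶ m') y => by
        change f ⊵ᵣ y ≫ 𝟙 _ = 𝟙 _ ≫ f ⊵ᵣ y
        simp
      μᵣ_naturality_right := fun (m : M) {y y'} f => by
        change m ⊴ᵣ f ≫ 𝟙 _ = 𝟙 _ ≫ m ⊴ᵣ f
        simp
      μᵣ_associativity := fun (m : M) x y => by
        change 𝟙 _ ≫ m ⊴ᵣ 𝟙 _ ≫ (αᵣ m x y).hom = (αᵣ m x y).hom ≫ 𝟙 _ ⊵ᵣ y ≫ 𝟙 _
        simp
      μᵣ_unitality := fun (m : M) => by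
        change (ρᵣ m).hom = 𝟙 _ ≫ m ⊴ᵣ 𝟙 _ ≫ (ρᵣ m).hom
        simp }
  { toFunctor := K
    additive := inferInstanceAs (𝟭 M : M ⥤ M).Additive
    linear := inferInstanceAs ((𝟭 M : M ⥤ M).Linear ℂ)
    left := leftLinearOfIsIso K fun x (m : M) => inferInstanceAs (IsIso (𝟙 (x ⊙ₗ m)))
    right := rightLinearOfIsIso K fun (m : M) y => inferInstanceAs (IsIso (𝟙 (m ⊙ᵣ y)))
    mid_comm := fun x (m : M) y => by
      change (M.mid x m y).hom ≫ x ⊴ₗ 𝟙 _ ≫ 𝟙 _ = 𝟙 _ ⊵ᵣ y ≫ 𝟙 _ ≫ (M.mid x m y).hom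
      simp }

/-- The identity functor as a bimodule functor `M ⟶ M_𝟭`. -/
def Bimod.toRestrictId (M : Bimod C) : BimodFunctor M (M.restrict (𝟭 C)) :=
  let K : M ⥤ M.restrict (𝟭 C) := 𝟭 M
  letI l : K.LaxLeftLinear C :=
    { μₗ := fun x (m : M) => 𝟙 (x ⊙ₗ m)
      μₗ_naturality_left := fun {x x'} f (m : M) => by
        change f ⊵ₗ m ≫ 𝟙 _ = 𝟙 _ ≫ f ⊵ₗ m
        simp
      μₗ_naturality_right := fun x {m m' : M} (f : m ⟶ m') => by
        change x ⊴ₗ f ≫ 𝟙 _ = 𝟙 _ ≫ x ⊴ₗ f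
        simp
      μₗ_associativity := fun x y (m : M) => by
        change 𝟙 _ ≫ (αₗ x y m).hom = (αₗ x y m).hom ≫ x ⊴ₗ 𝟙 _ ≫ 𝟙 _
        simp
      μₗ_unitality := fun (m : M) => by
        change (λₗ m).hom = 𝟙 _ ≫ (λₗ m).hom
        simp }
  letI r : K.LaxRightLinear C :=
    { μᵣ := fun (m : M) y => 𝟙 (m ⊙ᵣ y)
      μᵣ_naturality_left := fun {m m' : M} (f : m ⟶ m') y => by
        change f ⊵ᵣ y ≫ 𝟙 _ = 𝟙 _ ≫ f ⊵ᵣ y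
        simp
      μᵣ_naturality_right := fun (m : M) {y y'} f => by
        change m ⊴ᵣ f ≫ 𝟙 _ = 𝟙 _ ≫ m ⊴ᵣ f
        simp
      μᵣ_associativity := fun (m : M) x y => by
        change 𝟙 _ ≫ (αᵣ m x y).hom = (m ⊴ᵣ 𝟙 _ ≫ (αᵣ m x y).hom) ≫ 𝟙 _ ⊵ᵣ y ≫ 𝟙 _
        simp
      μᵣ_unitality := fun (m : M) => by
        change m ⊴ᵣ 𝟙 _ ≫ (ρᵣ m).hom = 𝟙 _ ≫ (ρᵣ m).hom
        simp }
  { toFunctor := K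
    additive := inferInstanceAs (𝟭 M : M ⥤ M).Additive
    linear := inferInstanceAs ((𝟭 M : M ⥤ M).Linear ℂ)
    left := leftLinearOfIsIso K fun x (m : M) => inferInstanceAs (IsIso (𝟙 (x ⊙ₗ m)))
    right := rightLinearOfIsIso K fun (m : M) y => inferInstanceAs (IsIso (𝟙 (m ⊙ᵣ y)))
    mid_comm := fun x (m : M) y => by
      change (M.mid x m y).hom ≫ x ⊴ₗ 𝟙 _ ≫ 𝟙 _ = 𝟙 _ ⊵ᵣ y ≫ 𝟙 _ ≫ (M.mid x m y).hom
      simp }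

variable [MonoidalPreadditive C] [MonoidalLinear ℂ C] [IsFiniteSemisimple C]

namespace BimodAut

variable (φ ψ : BimodAut (regular C))

/-- A bimodule autoequivalence of `C`, viewed as a functor `C ⥤ C`. -/
def onC : C ⥤ C := φ.toFunctor

/-- The isomorphism `x ⊗ φ(c) ≅ φ(x ⊗ c)`. -/
def lμ (x c : C) : x ⊗ φ.onC.obj c ≅ φ.onC.obj (x ⊗ c) :=
  Functor.LeftLinear.μₗIso φ.toFunctor x (c : C)

/-- The isomorphism `φ(c) ⊗ y ≅ φ(c ⊗ y)`. -/
def rμ (c y : C) : φ.onC.obj c ⊗ y ≅ φ.onC.obj (c ⊗ y) :=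
  Functor.RightLinear.μᵣIso φ.toFunctor (c : C) y

/-- A bimodule autoequivalence of `C`, viewed as a bimodule functor out of `C_𝟭`. -/
def ofRestrict : BimodFunctor ((regular C).restrict (𝟭 C)) (regular C) :=
  (regular C).restrictId.comp φ.toBimodFunctor

/-- The isomorphism `φ(𝟙) ⊗ y ≅ φ(𝟙 ⊗ y) ≅ φ(y ⊗ 𝟙) ≅ y ⊗ φ(𝟙)`. -/
def braiding (y : C) : φ.onC.obj (𝟙_ C) ⊗ y ≅ y ⊗ φ.onC.obj (𝟙_ C) :=
  φ.rμ (𝟙_ C) y ≪≫ φ.onC.mapIso (λ_ y ≪≫ (ρ_ y).symm) ≪≫ (φ.lμ y (𝟙_ C)).symm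

theorem ofRestrict_lμ (x c : C) : φ.ofRestrict.lμ x c = φ.lμ x c := by
  ext
  change (φ.lμ x c).hom ≫ φ.onC.map (𝟙 _) = _
  simp

theorem ofRestrict_rμ (c y : C) : φ.ofRestrict.rμ c y = φ.rμ c y := by
  ext
  change (φ.rμ c y).hom ≫ φ.onC.map (𝟙 _) = _
  simp

/-- The isomorphism `φ(c) ≅ c ⊗ φ(𝟙)`. -/
def orbitIso (c : C) : φ.onC.obj c ≅ c ⊗ φ.onC.obj (𝟙_ C) := φ.ofRestrict.orbitIso c

theorem orbitIso_eq (c : C) :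
    φ.orbitIso c = φ.onC.mapIso (ρ_ c).symm ≪≫ (φ.lμ c (𝟙_ C)).symm := by
  rw [← ofRestrict_lμ]
  rfl

theorem ofRestrict_unitIso (y : C) : φ.ofRestrict.unitIso y = φ.braiding y := by
  have h1 := φ.ofRestrict_rμ (𝟙_ C) y
  have h2 := φ.orbitIso_eq y
  change φ.ofRestrict.rμ (𝟙_ C) y ≪≫ φ.onC.mapIso (λ_ y) ≪≫ φ.orbitIso y =
    φ.rμ (𝟙_ C) y ≪≫ φ.onC.mapIso (λ_ y ≪≫ (ρ_ y).symm) ≪≫ (φ.lμ y (𝟙_ C)).symm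
  rw [h2, h1, Functor.mapIso_trans, Iso.trans_assoc]
  rfl

theorem orbitIso_natural {c c' : C} (f : c ⟶ c') :
    φ.onC.map f ≫ (φ.orbitIso c').hom = (φ.orbitIso c).hom ≫ f ▷ φ.onC.obj (𝟙_ C) :=
  φ.ofRestrict.orbitIso_natural f

theorem lμ_orbitIso (x c : C) : (φ.lμ x c).hom ≫ (φ.orbitIso (x ⊗ c)).hom =
    x ◁ (φ.orbitIso c).hom ≫ (α_ x c (φ.onC.obj (𝟙_ C))).inv := by
  rw [← ofRestrict_lμ]
  exact φ.ofRestrict.lμ_orbitIso x c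

theorem rμ_orbitIso (c y : C) : (φ.rμ c y).hom ≫ (φ.orbitIso (c ⊗ y)).hom =
    (φ.orbitIso c).hom ▷ y ≫ (α_ c (φ.onC.obj (𝟙_ C)) y).hom ≫ c ◁ (φ.braiding y).hom ≫
      (α_ c y (φ.onC.obj (𝟙_ C))).inv := by
  rw [← ofRestrict_rμ, ← ofRestrict_unitIso]
  exact φ.ofRestrict.rμ_orbitIso c y

theorem braiding_natural {y y' : C} (f : y ⟶ y') :
    φ.onC.obj (𝟙_ C) ◁ f ≫ (φ.braiding y').hom =
      (φ.braiding y).hom ≫ f ▷ φ.onC.obj (𝟙_ C) := by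
  rw [← ofRestrict_unitIso, ← ofRestrict_unitIso]
  exact φ.ofRestrict.twistedCentral.naturality f

theorem braiding_tensor (x y : C) : (φ.braiding (x ⊗ y)).hom =
    (α_ (φ.onC.obj (𝟙_ C)) x y).inv ≫ (φ.braiding x).hom ▷ y ≫
      (α_ x (φ.onC.obj (𝟙_ C)) y).hom ≫ x ◁ (φ.braiding y).hom ≫
        (α_ x y (φ.onC.obj (𝟙_ C))).inv := by
  have h := φ.ofRestrict.twistedCentral.hexagon x y
  have h1 (y : C) : φ.ofRestrict.twistedCentral.iso y = φ.braiding y := φ.ofRestrict_unitIso y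
  rw [h1, h1, h1] at h
  have h2 : (φ.braiding (x ⊗ y)).hom =
    (α_ (φ.onC.obj (𝟙_ C)) x y).inv ≫ (φ.braiding x).hom ▷ y ≫
      (α_ x (φ.onC.obj (𝟙_ C)) y).hom ≫ x ◁ (φ.braiding y).hom ≫
        (α_ x y (φ.onC.obj (𝟙_ C))).inv ≫ 𝟙 (x ⊗ y) ▷ φ.onC.obj (𝟙_ C) := h
  simpa using h2

/-- The object `φ(𝟙)` with the half-braiding induced by the bimodule structure of `φ`. -/
def centerObj : Center C :=
  ⟨φ.onC.obj (𝟙_ C),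
    { β := φ.braiding
      monoidal := φ.braiding_tensor
      naturality := φ.braiding_natural }⟩

theorem nonempty_centerObj_iso_iff (Z : Center C) : Nonempty (φ.centerObj ≅ Z) ↔
    ∃ i : φ.onC.obj (𝟙_ C) ≅ Z.1, ∀ y, i.hom ▷ y ≫ (Z.2.β y).hom =
      (φ.braiding y).hom ≫ y ◁ i.hom :=
  nonempty_center_iso_iff

theorem correspondsTo_iff (Z : Center C) : φ.CorrespondsTo Z ↔ Nonempty (φ.centerObj ≅ Z) :=
  (nonempty_centerObj_iso_iff φ Z).symm

/-- A bimodule autoequivalence is determined by the central object `φ(𝟙)`, since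
`φ(c) ≅ c ⊗ φ(𝟙)`. -/
theorem iso_iff : φ.toBimodFunctor.Iso ψ.toBimodFunctor ↔
    Nonempty (φ.centerObj ≅ ψ.centerObj) := by
  rw [nonempty_centerObj_iso_iff]
  constructor
  · rintro ⟨e, hl, hr⟩
    let e' : φ.onC ≅ ψ.onC := e
    have hl' (x c : C) : (φ.lμ x c).hom ≫ e'.hom.app (x ⊗ c) =
      x ◁ e'.hom.app c ≫ (ψ.lμ x c).hom := hl x (c : C)
    have hr' (c y : C) : (φ.rμ c y).hom ≫ e'.hom.app (c ⊗ y) =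
      e'.hom.app c ▷ y ≫ (ψ.rμ c y).hom := hr (c : C) y
    refine ⟨e'.app (𝟙_ C), fun y => ?_⟩
    have h1 : (φ.lμ y (𝟙_ C)).inv ≫ y ◁ e'.hom.app (𝟙_ C) =
        e'.hom.app (y ⊗ 𝟙_ C) ≫ (ψ.lμ y (𝟙_ C)).inv := by
      rw [Iso.inv_comp_eq, ← Category.assoc, Iso.eq_comp_inv, hl']
    change e'.hom.app (𝟙_ C) ▷ y ≫ (ψ.braiding y).hom =
      (φ.braiding y).hom ≫ y ◁ e'.hom.app (𝟙_ C)
    simp only [braiding, Iso.trans_hom, Functor.mapIso_hom, Iso.symm_hom, Category.assoc, h1,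
      ← reassoc_of% hr' (𝟙_ C) y, NatTrans.naturality_assoc]
  · rintro ⟨i, hi⟩
    replace hi : ∃ i : φ.onC.obj (𝟙_ C) ≅ ψ.onC.obj (𝟙_ C), ∀ y : C,
      i.hom ▷ y ≫ (ψ.braiding y).hom = (φ.braiding y).hom ≫ y ◁ i.hom := ⟨i, hi⟩
    clear i
    obtain ⟨i, hi⟩ := hi
    obtain ⟨s, hs⟩ : ∃ s : ∀ c, φ.onC.obj c ≅ ψ.onC.obj c, ∀ c,
        (s c).hom ≫ (ψ.orbitIso c).hom = (φ.orbitIso c).hom ≫ c ◁ i.hom :=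
      ⟨fun c => φ.orbitIso c ≪≫ whiskerLeftIso c i ≪≫ (ψ.orbitIso c).symm, fun c => by simp⟩
    let e : φ.onC ≅ ψ.onC := NatIso.ofComponents s fun {c c'} f => by
      rw [← cancel_mono (ψ.orbitIso c').hom, Category.assoc, Category.assoc, hs,
        reassoc_of% φ.orbitIso_natural f, ψ.orbitIso_natural, reassoc_of% hs, whisker_exchange]
    refine ⟨e, fun x (c : C) => ?_, fun (c : C) y => ?_⟩
    · change (φ.lμ x c).hom ≫ (s (x ⊗ c)).hom = x ◁ (s c).hom ≫ (ψ.lμ x c).hom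
      rw [← cancel_mono (ψ.orbitIso (x ⊗ c)).hom, Category.assoc, Category.assoc, hs,
        reassoc_of% φ.lμ_orbitIso x c, ψ.lμ_orbitIso, ← whiskerLeft_comp_assoc, hs]
      simp
    · change (φ.rμ c y).hom ≫ (s (c ⊗ y)).hom = (s c).hom ▷ y ≫ (ψ.rμ c y).hom
      rw [← cancel_mono (ψ.orbitIso (c ⊗ y)).hom, Category.assoc, Category.assoc, hs,
        reassoc_of% φ.rμ_orbitIso c y, ψ.rμ_orbitIso, ← comp_whiskerRight_assoc, hs]
      have h := congrArg (fun t => c ◁ t) (hi y)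
      simp only [whiskerLeft_comp] at h
      simp [reassoc_of% h]

theorem braiding_comp (y : C) : ((φ.comp ψ).braiding y).hom =
    (φ.rμ (ψ.onC.obj (𝟙_ C)) y).hom ≫ φ.onC.map (ψ.braiding y).hom ≫
      (φ.lμ y (ψ.onC.obj (𝟙_ C))).inv := by
  have hr : (φ.comp ψ).rμ (𝟙_ C) y =
      φ.rμ (ψ.onC.obj (𝟙_ C)) y ≪≫ φ.onC.mapIso (ψ.rμ (𝟙_ C) y) := by
    ext
    rfl
  have hl : (φ.comp ψ).lμ y (𝟙_ C) =
      φ.lμ y (ψ.onC.obj (𝟙_ C)) ≪≫ φ.onC.mapIso (ψ.lμ y (𝟙_ C)) := by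
    ext
    rfl
  rw [braiding, hr, hl]
  change ((φ.rμ (ψ.onC.obj (𝟙_ C)) y).hom ≫ φ.onC.map (ψ.rμ (𝟙_ C) y).hom) ≫
    φ.onC.map (ψ.onC.map ((λ_ y).hom ≫ (ρ_ y).inv)) ≫
      φ.onC.map (ψ.lμ y (𝟙_ C)).inv ≫ (φ.lμ y (ψ.onC.obj (𝟙_ C))).inv = _
  simp [braiding]

theorem braiding_id (y : C) : 𝟙 (𝟙_ C) ▷ y ≫ (λ_ y ≪≫ (ρ_ y).symm).hom =
    ((BimodAut.id (regular C)).braiding y).hom ≫ y ◁ 𝟙 (𝟙_ C) := by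
  have hl : (BimodAut.id (regular C)).lμ y (𝟙_ C) = Iso.refl (y ⊗ 𝟙_ C) := by
    ext
    rfl
  rw [braiding, hl]
  change _ = (𝟙 (𝟙_ C ⊗ y) ≫ ((λ_ y).hom ≫ (ρ_ y).inv) ≫ 𝟙 (y ⊗ 𝟙_ C)) ≫ y ◁ 𝟙 (𝟙_ C)
  simp

/-- `φ(ψ(𝟙)) ≅ ψ(𝟙) ⊗ φ(𝟙) ≅ φ(𝟙) ⊗ ψ(𝟙)` in the center, by the braiding. -/
theorem centerObj_comp : Nonempty ((φ.comp ψ).centerObj ≅ φ.centerObj ⊗ ψ.centerObj) := by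
  suffices h : Nonempty ((φ.comp ψ).centerObj ≅ ψ.centerObj ⊗ φ.centerObj) from
    h.map fun i => i ≪≫ β_ _ _
  refine (nonempty_centerObj_iso_iff _ _).2 ⟨φ.orbitIso (ψ.onC.obj (𝟙_ C)), fun y => ?_⟩
  let p := ψ.onC.obj (𝟙_ C)
  let q := φ.onC.obj (𝟙_ C)
  have h : ((ψ.centerObj ⊗ φ.centerObj).2.β y).hom = (α_ p q y).hom ≫
      p ◁ (φ.braiding y).hom ≫ (α_ p y q).inv ≫ (ψ.braiding y).hom ▷ q ≫ (α_ y p q).hom := rfl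
  have h1 : (φ.lμ y p).inv ≫ y ◁ (φ.orbitIso p).hom =
      (φ.orbitIso (y ⊗ p)).hom ≫ (α_ y p q).hom := by
    rw [Iso.inv_comp_eq, reassoc_of% φ.lμ_orbitIso y p]
    simp [q]
  have h2 : φ.onC.map (ψ.braiding y).hom ≫ (φ.orbitIso (y ⊗ p)).hom =
    (φ.orbitIso (p ⊗ y)).hom ≫ (ψ.braiding y).hom ▷ q := φ.orbitIso_natural (ψ.braiding y).hom
  have h3 : (φ.rμ p y).hom ≫ (φ.orbitIso (p ⊗ y)).hom =
    (φ.orbitIso p).hom ▷ y ≫ (α_ p q y).hom ≫ p ◁ (φ.braiding y).hom ≫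
      (α_ p y q).inv := φ.rμ_orbitIso p y
  rw [h, braiding_comp]
  change (φ.orbitIso p).hom ▷ y ≫ (α_ p q y).hom ≫
      p ◁ (φ.braiding y).hom ≫ (α_ p y q).inv ≫ (ψ.braiding y).hom ▷ q ≫ (α_ y p q).hom =
    ((φ.rμ p y).hom ≫ φ.onC.map (ψ.braiding y).hom ≫ (φ.lμ y p).inv) ≫
      y ◁ (φ.orbitIso p).hom
  simp only [Category.assoc, h1, reassoc_of% h2, reassoc_of% h3]

end BimodAut

/-- A half-braiding is a central structure. -/
def halfBraidingTwistedCentral {X : C} (b : HalfBraiding X) :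
    TwistedCentral (𝟭 C) (regular C) X where
  iso := b.β
  naturality := b.naturality
  hexagon x y := by
    change (b.β (x ⊗ y)).hom = (α_ X x y).inv ≫ (b.β x).hom ▷ y ≫ (α_ x X y).hom ≫
      x ◁ (b.β y).hom ≫ (α_ x y X).inv ≫ 𝟙 (x ⊗ y) ▷ X
    simp [b.monoidal]
  unit := by
    change (b.β (𝟙_ C)).hom = (ρ_ X).hom ≫ (λ_ X).inv ≫ 𝟙 (𝟙_ C) ▷ X
    simp [halfBraiding_unit]

/-- A central structure on an invertible object `g` defines a bimodule autoequivalence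
`c ↦ c ⊗ g`. -/
def TwistedCentral.bimodAut {g : C} (t : TwistedCentral (𝟭 C) (regular C) g)
    (hg : (tensorRight g).IsEquivalence) : BimodAut (regular C) :=
  { (regular C).toRestrictId.comp t.functor with isEquivalence := hg }

theorem TwistedCentral.bimodAut_braiding {g : C} (t : TwistedCentral (𝟭 C) (regular C) g)
    (hg : (tensorRight g).IsEquivalence) (s : ∀ y : C, g ⊗ y ≅ y ⊗ g) (hs : s = t.iso) (y : C) :
    (λ_ g).hom ▷ y ≫ (s y).hom = ((t.bimodAut hg).braiding y).hom ≫ y ◁ (λ_ g).hom := by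
  subst hs
  obtain ⟨s, hs⟩ : ∃ s : ∀ y : C, g ⊗ y ≅ y ⊗ g, s = t.iso := ⟨_, rfl⟩
  have hr : ((t.bimodAut hg).rμ (𝟙_ C) y).hom =
      ((α_ (𝟙_ C) g y).hom ≫ (𝟙_ C) ◁ (s y).hom ≫ (α_ (𝟙_ C) y g).inv) ≫
        𝟙 (𝟙_ C ⊗ y) ▷ g := by
    subst hs
    rfl
  have hl : ((t.bimodAut hg).lμ y (𝟙_ C)).hom = (α_ y (𝟙_ C) g).inv ≫ 𝟙 (y ⊗ 𝟙_ C) ▷ g := rfl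
  have hl : (t.bimodAut hg).lμ y (𝟙_ C) = (α_ y (𝟙_ C) g).symm := by
    ext
    rw [hl]
    simp
    rfl
  rw [← hs, BimodAut.braiding, hl]
  change (λ_ g).hom ▷ y ≫ (s y).hom = (((t.bimodAut hg).rμ (𝟙_ C) y).hom ≫
    ((λ_ y).hom ≫ (ρ_ y).inv) ▷ g ≫ (α_ y (𝟙_ C) g).hom) ≫ y ◁ (λ_ g).hom
  rw [hr]
  monoidal

/-- Every central object with invertible underlying object comes from a bimodule
autoequivalence. -/
theorem BimodAut.exists_centerObj_iso (Z : Center C) (hZ : (tensorRight Z.1).IsEquivalence) :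
    ∃ φ : BimodAut (regular C), Nonempty (φ.centerObj ≅ Z) := by
  refine ⟨(halfBraidingTwistedCentral Z.2).bimodAut hZ,
    (BimodAut.nonempty_centerObj_iso_iff _ _).2 ⟨λ_ Z.1, fun y => ?_⟩⟩
  exact (halfBraidingTwistedCentral Z.2).bimodAut_braiding hZ Z.2.β rfl y

variable (C) in
/-- The homomorphism `π₁ BrPic(C) → Inv(Z(C))`, `φ ↦ φ(𝟙)`. -/
def PiOneBrPic.toInvCenter : PiOneBrPic C →* InvGroup (Center C) :=
  MonoidHom.toHomUnits
    { toFun := Quotient.lift (fun φ => toSkeleton φ.centerObj)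
        fun φ ψ h => Quotient.sound ((BimodAut.iso_iff φ ψ).1 h)
      map_one' := Quotient.sound ((BimodAut.nonempty_centerObj_iso_iff _ _).2
        ⟨Iso.refl _, (BimodAut.braiding_id ·)⟩)
      map_mul' := by
        rintro ⟨φ⟩ ⟨ψ⟩
        change toSkeleton (φ.comp ψ).centerObj = toSkeleton φ.centerObj * toSkeleton ψ.centerObj
        rw [← Skeleton.toSkeleton_tensorObj]
        exact Quotient.sound (φ.centerObj_comp ψ) }

theorem PiOneBrPic.val_toInvCenter_mk (φ : BimodAut (regular C)) :
    (toInvCenter C (BimodAutGroup.mk φ)).val = toSkeleton φ.centerObj := rfl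

theorem PiOneBrPic.val_toInvCenter_mk_eq_iff (φ : BimodAut (regular C)) (Z : Center C) :
    (toInvCenter C (BimodAutGroup.mk φ)).val = toSkeleton Z ↔ φ.CorrespondsTo Z := by
  rw [φ.correspondsTo_iff]
  exact ⟨Quotient.exact, fun h => Quotient.sound h⟩

theorem exists_inverse_of_mem_units {D : Type*} [Category* D] [MonoidalCategory D] {X : D}
    (x : (Skeleton D)ˣ) (hx : x.val = toSkeleton X) :
    ∃ Y : D, Nonempty (X ⊗ Y ≅ 𝟙_ D) ∧ Nonempty (Y ⊗ X ≅ 𝟙_ D) := by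
  obtain ⟨Y, hY⟩ : ∃ Y : D, toSkeleton Y = x.inv := Quotient.exists_rep x.inv
  have h1 := x.val_inv
  have h2 := x.inv_val
  rw [hx, ← hY, ← Skeleton.toSkeleton_tensorObj] at h1 h2
  exact ⟨Y, Quotient.exact h1, Quotient.exact h2⟩

theorem PiOneBrPic.toInvCenter_bijective : Function.Bijective (toInvCenter C) := by
  constructor
  · rintro ⟨φ⟩ ⟨ψ⟩ h
    exact Quotient.sound ((φ.iso_iff ψ).2 (Quotient.exact (congrArg Units.val h)))
  · intro x
    obtain ⟨Z, hZ⟩ : ∃ Z : Center C, toSkeleton Z = x.val := Quotient.exists_rep x.val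
    obtain ⟨Y, ⟨i⟩, ⟨j⟩⟩ := exists_inverse_of_mem_units x hZ.symm
    obtain ⟨φ, hφ⟩ := BimodAut.exists_centerObj_iso Z
      (isEquivalence_tensorRight ((Center.forget C).mapIso j) ((Center.forget C).mapIso i))
    refine ⟨BimodAutGroup.mk φ, Units.ext ?_⟩
    rw [← hZ, val_toInvCenter_mk]
    exact Quotient.sound hφ

variable (C) in
/-- The isomorphism `π₁ BrPic(C) ≅ Inv(Z(C))`, `φ ↦ φ(𝟙)`. -/
def PiOneBrPic.equivInvCenter : PiOneBrPic C ≃* InvGroup (Center C) :=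
  MulEquiv.ofBijective (toInvCenter C) toInvCenter_bijective

end UnitObject

section Exactness

variable {C : Type u} [Category.{v} C] [Abelian C] [Linear ℂ C] [MonoidalCategory C]
  [MonoidalPreadditive C] [MonoidalLinear ℂ C] [IsFiniteSemisimple C]

theorem val_forgetInv_toInvCenter_mk (φ : BimodAut (regular C)) :
    (forgetInv C (PiOneBrPic.toInvCenter C (BimodAutGroup.mk φ))).val =
      toSkeleton (φ.onC.obj (𝟙_ C)) :=
  Quotient.sound ⟨(Center.forget C).mapIso (fromSkeletonToSkeletonIso φ.centerObj)⟩

variable [RigidCategory C]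

/-- The inner autoequivalence `F_g` is trivial if and only if `g` has a half-braiding. -/
theorem forgetInv_mulExact_toEq : Function.MulExact
    ((forgetInv C).comp (PiOneBrPic.toInvCenter C)) (InvGroup.toEq C) := by
  intro x
  obtain ⟨g, hg, rfl⟩ := InvGroup.mk_surjective x
  have h : InvGroup.toEq C (InvGroup.mk g hg) = 1 ↔
      Nonempty (TwistedCentral (𝟭 C) (regular C) g) := by
    rw [InvGroup.toEq_mk]
    exact Iff.trans ⟨Quotient.exact, fun h => Quotient.sound h⟩
      (innerAut_iso_iff (G := TensorAut.id))
  rw [h]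
  constructor
  · rintro ⟨t⟩
    have h1 := hg.ev
    have h2 := hg.coev
    exact ⟨BimodAutGroup.mk (t.bimodAut (isEquivalence_tensorRight (asIso (ε_ g gᘁ))
      (asIso (η_ g gᘁ)).symm)), Units.ext ((val_forgetInv_toInvCenter_mk _).trans
        (Quotient.sound ⟨λ_ g⟩))⟩
  · rintro ⟨⟨φ⟩, hφ⟩
    obtain ⟨i⟩ : Nonempty (φ.onC.obj (𝟙_ C) ≅ g) :=
      Quotient.exact ((val_forgetInv_toInvCenter_mk φ).symm.trans (congrArg Units.val hφ))
    let t : TwistedCentral (𝟭 C) (regular C) (φ.onC.obj (𝟙_ C)) := φ.ofRestrict.twistedCentral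
    exact ⟨t.ofIso (p' := (g : C)) i⟩

end Exactness

/-! ### Characters of the universal grading group -/

section ScalarEnd

variable {D : Type u} [Category.{v} D] [Abelian D] [Linear ℂ D] [IsFiniteSemisimple D]

theorem exists_simple_decomposition (X : D) : ∃ (n : ℕ) (S : Fin n → {Y : D // Simple Y})
    (p : ∀ i, X ⟶ (S i).1) (q : ∀ i, (S i).1 ⟶ X), ∑ i, p i ≫ q i = 𝟙 X := by
  obtain ⟨n, S, hS, ⟨e⟩⟩ := IsFiniteSemisimple.semisimple X
  refine ⟨n, fun i => ⟨S i, hS i⟩, fun i => e.hom ≫ biproduct.π S i,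
    fun i => biproduct.ι S i ≫ e.inv, ?_⟩
  have h : ∑ i, (e.hom ≫ biproduct.π S i) ≫ biproduct.ι S i ≫ e.inv =
      e.hom ≫ (∑ i, biproduct.π S i ≫ biproduct.ι S i) ≫ e.inv := by
    simp only [Preadditive.comp_sum, Preadditive.sum_comp, Category.assoc]
  rw [h, biproduct.total]
  simp

/-- The endomorphism of `X` which is multiplication by `c S` on the isotypic component of each
simple object `S`. It is defined by a chosen decomposition of `X`, and is natural in `X` if `c` is
constant on isomorphism classes. -/
def scalarEnd (c : {Y : D // Simple Y} → ℂ) (X : D) : X ⟶ X :=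
  let h := (exists_simple_decomposition X).choose_spec
  ∑ i, c (h.choose i) • (h.choose_spec.choose i ≫ h.choose_spec.choose_spec.choose i)

theorem exists_scalarEnd_eq (c : {Y : D // Simple Y} → ℂ) (X : D) :
    ∃ (n : ℕ) (S : Fin n → {Y : D // Simple Y}) (p : ∀ i, X ⟶ (S i).1) (q : ∀ i, (S i).1 ⟶ X),
      ∑ i, p i ≫ q i = 𝟙 X ∧ scalarEnd c X = ∑ i, c (S i) • (p i ≫ q i) :=
  ⟨_, _, _, _, (exists_simple_decomposition X).choose_spec.choose_spec.choose_spec.choose_spec, rfl⟩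

theorem scalarEnd_naturality {c : {Y : D // Simple Y} → ℂ}
    (hc : ∀ (S T : {Y : D // Simple Y}) (f : S.1 ⟶ T.1), f ≠ 0 → c S = c T) {X X' : D}
    (f : X ⟶ X') : f ≫ scalarEnd c X' = scalarEnd c X ≫ f := by
  obtain ⟨n, S, p, q, h1, h2⟩ := exists_scalarEnd_eq c X
  obtain ⟨n', S', p', q', h1', h2'⟩ := exists_scalarEnd_eq c X'
  have h (i j) : c (S' j) • (q i ≫ f ≫ p' j) = c (S i) • (q i ≫ f ≫ p' j) := by
    by_cases h0 : q i ≫ f ≫ p' j = 0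
    · rw [h0, smul_zero, smul_zero]
    · rw [hc _ _ _ h0]
  calc
    f ≫ scalarEnd c X' = (∑ i, p i ≫ q i) ≫ f ≫ ∑ j, c (S' j) • (p' j ≫ q' j) := by
      rw [h1, h2', Category.id_comp]
    _ = ∑ i, ∑ j, p i ≫ (c (S' j) • (q i ≫ f ≫ p' j)) ≫ q' j := by
      simp only [Preadditive.comp_sum, Preadditive.sum_comp, Linear.comp_smul, Linear.smul_comp,
        Category.assoc, Finset.smul_sum]
      exact Finset.sum_comm
    _ = ∑ i, ∑ j, p i ≫ (c (S i) • (q i ≫ f ≫ p' j)) ≫ q' j := by simp_rw [h]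
    _ = (∑ i, c (S i) • (p i ≫ q i)) ≫ f ≫ ∑ j, p' j ≫ q' j := by
      simp only [Preadditive.comp_sum, Preadditive.sum_comp, Linear.comp_smul, Linear.smul_comp,
        Category.assoc]
      exact Finset.sum_comm
    _ = scalarEnd c X ≫ f := by rw [h1', h2, Category.comp_id]

theorem scalarEnd_simple {c : {Y : D // Simple Y} → ℂ}
    (hc : ∀ (S T : {Y : D // Simple Y}) (f : S.1 ⟶ T.1), f ≠ 0 → c S = c T) (X : D)
    [hX : Simple X] : scalarEnd c X = c ⟨X, hX⟩ • 𝟙 X := by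
  obtain ⟨n, S, p, q, h1, h2⟩ := exists_scalarEnd_eq c X
  rw [h2, ← h1, Finset.smul_sum]
  refine Finset.sum_congr rfl fun i _ => ?_
  by_cases h0 : p i = 0
  · rw [h0, zero_comp, smul_zero, smul_zero]
  · rw [hc ⟨X, hX⟩ (S i) (p i) h0]

theorem hom_ext_of_simple {X Y : D} {f g : X ⟶ Y}
    (h : ∀ (S : D) [Simple S] (i : S ⟶ X), i ≫ f = i ≫ g) : f = g := by
  obtain ⟨n, S, p, q, h1⟩ := exists_simple_decomposition X
  have h2 (i) : q i ≫ f = q i ≫ g :=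
    haveI := (S i).2
    h (S i).1 (q i)
  rw [← Category.id_comp f, ← Category.id_comp g, ← h1, Preadditive.sum_comp,
    Preadditive.sum_comp]
  simp only [Category.assoc, h2]

variable [MonoidalCategory D] [MonoidalPreadditive D]

theorem whiskerLeft_hom_ext_of_simple {W X Y : D} {f g : W ⊗ X ⟶ Y}
    (h : ∀ (S : D) [Simple S] (i : S ⟶ X), W ◁ i ≫ f = W ◁ i ≫ g) : f = g := by
  obtain ⟨n, S, p, q, h1⟩ := exists_simple_decomposition X
  have h2 (i) : W ◁ q i ≫ f = W ◁ q i ≫ g :=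
    haveI := (S i).2
    h (S i).1 (q i)
  have h3 : 𝟙 (W ⊗ X) = ∑ i, W ◁ p i ≫ W ◁ q i := by
    simp_rw [← MonoidalCategory.whiskerLeft_comp]
    rw [← whiskerLeft_sum, h1, whiskerLeft_id]
  rw [← Category.id_comp f, ← Category.id_comp g, h3, Preadditive.sum_comp,
    Preadditive.sum_comp]
  simp only [Category.assoc, h2]

theorem whiskerRight_hom_ext_of_simple {W X Y : D} {f g : X ⊗ W ⟶ Y}
    (h : ∀ (S : D) [Simple S] (i : S ⟶ X), i ▷ W ≫ f = i ▷ W ≫ g) : f = g := by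
  obtain ⟨n, S, p, q, h1⟩ := exists_simple_decomposition X
  have h2 (i) : q i ▷ W ≫ f = q i ▷ W ≫ g :=
    haveI := (S i).2
    h (S i).1 (q i)
  have h3 : 𝟙 (X ⊗ W) = ∑ i, p i ▷ W ≫ q i ▷ W := by
    simp_rw [← MonoidalCategory.comp_whiskerRight]
    rw [← sum_whiskerRight, h1, id_whiskerRight]
  rw [← Category.id_comp f, ← Category.id_comp g, h3, Preadditive.sum_comp,
    Preadditive.sum_comp]
  simp only [Category.assoc, h2]

end ScalarEnd

section Grading

variable {C : Type u} [Category.{v} C] [Abelian C] [MonoidalCategory C]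

theorem isGrading_univDeg : IsGrading (fun X : {X : C // Simple X} => haveI := X.2; univDeg X.1) :=
  (univDeg_universal _).2 ⟨MonoidHom.id _, fun _ => rfl, fun _ h => PresentedGroup.ext h⟩

/-- A grading is constant on isomorphism classes of simple objects. -/
theorem IsGrading.eq_of_hom_ne_zero {G : Type*} [Group G] {d : {X : C // Simple X} → G}
    (hd : IsGrading d) (h1 : Simple (𝟙_ C)) {S T : {X : C // Simple X}} (f : S.1 ⟶ T.1)
    (hf : f ≠ 0) : d S = d T := by
  have hT : (ρ_ T.1).inv ≠ 0 := fun h => by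
    have := T.2
    exact id_nonzero T.1 (by rw [← (ρ_ T.1).inv_hom_id, h, zero_comp])
  have hS : f ≫ (ρ_ T.1).inv ≠ 0 := fun h => hf (by
    rw [← Category.comp_id f, ← (ρ_ T.1).inv_hom_id, reassoc_of% h, zero_comp])
  rw [hd T ⟨_, h1⟩ S _ hS, hd T ⟨_, h1⟩ T _ hT, mul_assoc]
  have h := hd T ⟨_, h1⟩ T _ hT
  rw [left_eq_mul] at h
  rw [h, mul_one]

variable [Linear ℂ C] [MonoidalPreadditive C] [MonoidalLinear ℂ C] [RigidCategory C] [IsFusion C]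

/-- The natural endomorphism of `X` which is multiplication by `χ(deg S)` on the isotypic component
of each simple object `S`. -/
def charEnd (χ : UniversalGradingGroup C →* ℂˣ) (X : C) : X ⟶ X :=
  scalarEnd (fun S => haveI := S.2; χ (univDeg S.1)) X

theorem charEnd_naturality (χ : UniversalGradingGroup C →* ℂˣ) {X Y : C} (f : X ⟶ Y) :
    f ≫ charEnd χ Y = charEnd χ X ≫ f :=
  scalarEnd_naturality (fun _ _ g hg => congrArg (fun x => (χ x : ℂ))
    (isGrading_univDeg.eq_of_hom_ne_zero (IsFusion.simple_unit (C := C)) g hg)) f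

theorem charEnd_simple (χ : UniversalGradingGroup C →* ℂˣ) (S : C) [Simple S] :
    charEnd χ S = (χ (univDeg S) : ℂ) • 𝟙 S :=
  scalarEnd_simple (fun _ _ g hg => congrArg (fun x => (χ x : ℂ))
    (isGrading_univDeg.eq_of_hom_ne_zero (IsFusion.simple_unit (C := C)) g hg)) S

theorem comp_charEnd (χ : UniversalGradingGroup C →* ℂˣ) {S X : C} [Simple S] (i : S ⟶ X) :
    i ≫ charEnd χ X = (χ (univDeg S) : ℂ) • i := by
  rw [charEnd_naturality, charEnd_simple, Linear.smul_comp, Category.id_comp]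

theorem charEnd_one (X : C) : charEnd 1 X = 𝟙 X :=
  hom_ext_of_simple fun S _ i => by rw [comp_charEnd]; simp

theorem charEnd_comp (χ χ' : UniversalGradingGroup C →* ℂˣ) (X : C) :
    charEnd χ X ≫ charEnd χ' X = charEnd (χ * χ') X :=
  hom_ext_of_simple fun S _ i => by
    rw [← Category.assoc, comp_charEnd, comp_charEnd, comp_charEnd, smul_smul]
    simp [mul_comm]

/-- The natural automorphism given by a character is monoidal, because constituents of `S ⊗ T` have
degree `deg S * deg T`. -/
theorem charEnd_tensor (χ : UniversalGradingGroup C →* ℂˣ) (X Y : C) :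
    charEnd χ (X ⊗ Y) = charEnd χ X ▷ Y ≫ X ◁ charEnd χ Y := by
  refine whiskerRight_hom_ext_of_simple fun S hS i => whiskerLeft_hom_ext_of_simple fun T hT j =>
    hom_ext_of_simple fun R hR k => ?_
  have h1 : k ≫ S ◁ j ≫ i ▷ Y ≫ charEnd χ (X ⊗ Y) =
      (χ (univDeg R) : ℂ) • (k ≫ S ◁ j ≫ i ▷ Y) := by
    rw [← comp_charEnd]
    simp
  have h2 : i ▷ Y ≫ charEnd χ X ▷ Y ≫ X ◁ charEnd χ Y = (χ (univDeg S) : ℂ) •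
      (S ◁ charEnd χ Y ≫ i ▷ Y) := by
    rw [← comp_whiskerRight_assoc, comp_charEnd, MonoidalLinear.smul_whiskerRight,
      Linear.smul_comp, whisker_exchange]
  have h3 : S ◁ j ≫ S ◁ charEnd χ Y = (χ (univDeg T) : ℂ) • S ◁ j := by
    rw [← MonoidalCategory.whiskerLeft_comp, comp_charEnd, MonoidalLinear.whiskerLeft_smul]
  rw [h1, h2, Linear.comp_smul, reassoc_of% h3, Linear.smul_comp, Linear.comp_smul,
    Linear.comp_smul, smul_smul]
  by_cases hk : k = 0
  · simp [hk]
  · have h4 : univDeg R = univDeg S * univDeg T := isGrading_univDeg ⟨S, hS⟩ ⟨T, hT⟩ ⟨R, hR⟩ k hk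
    rw [h4, map_mul, Units.val_mul]

/-- The unit object with the half-braiding given by a character of `U(C)`. -/
def charCenter (χ : UniversalGradingGroup C →* ℂˣ) : Center C :=
  ⟨𝟙_ C,
    { β := fun X => λ_ X ≪≫
        { hom := charEnd χ X
          inv := charEnd χ⁻¹ X
          hom_inv_id := by
            have h : χ * χ⁻¹ = 1 := mul_inv_cancel χ
            rw [charEnd_comp, h, charEnd_one]
          inv_hom_id := by
            have h : χ⁻¹ * χ = 1 := inv_mul_cancel χ
            rw [charEnd_comp, h, charEnd_one] } ≪≫ (ρ_ X).symm
      monoidal := fun X Y => by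
        dsimp
        rw [charEnd_tensor]
        monoidal
      naturality := fun f => by
        dsimp
        rw [leftUnitor_naturality_assoc, reassoc_of% charEnd_naturality χ f]
        simp }⟩

theorem nonempty_charCenter_iso_iff (χ : UniversalGradingGroup C →* ℂˣ) (Z : Center C) :
    Nonempty (charCenter χ ≅ Z) ↔ IsCharacterBraiding χ Z := by
  have key (i : 𝟙_ C ≅ Z.1) (S : C) [Simple S] :
      (i.hom ▷ S ≫ (Z.2.β S).hom = (λ_ S).hom ≫ charEnd χ S ≫ (ρ_ S).inv ≫ S ◁ i.hom) ↔
        (Z.2.β S).hom =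
          (χ (univDeg S) : ℂ) • (i.inv ▷ S ≫ (λ_ S).hom ≫ (ρ_ S).inv ≫ S ◁ i.hom) := by
    rw [charEnd_simple, ← cancel_epi (i.inv ▷ S), inv_hom_whiskerRight_assoc]
    simp
  refine nonempty_center_iso_iff.trans ⟨?_, ?_⟩
  · rintro ⟨i, hi⟩
    exact ⟨i.symm, fun S _ => (key i S).1 ((hi S).trans (by
      change ((λ_ S).hom ≫ charEnd χ S ≫ (ρ_ S).inv) ≫ S ◁ i.hom = _
      simp only [Category.assoc]))⟩
  · rintro ⟨i, hi⟩
    refine ⟨i.symm, fun U => ?_⟩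
    change i.inv ▷ U ≫ (Z.2.β U).hom = ((λ_ U).hom ≫ charEnd χ U ≫ (ρ_ U).inv) ≫ U ◁ i.inv
    refine whiskerLeft_hom_ext_of_simple fun S _ j => ?_
    have h1 : i.inv ▷ S ≫ (Z.2.β S).hom =
      (λ_ S).hom ≫ charEnd χ S ≫ (ρ_ S).inv ≫ S ◁ i.inv := (key i.symm S).2 (hi S)
    have h2 := Z.2.naturality j
    rw [whisker_exchange_assoc, h2, reassoc_of% h1, Category.assoc, Category.assoc,
      leftUnitor_naturality_assoc, reassoc_of% charEnd_naturality χ j,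
      rightUnitor_inv_naturality_assoc j, whisker_exchange]

end Grading

/-! ### The homomorphism from characters to bimodule autoequivalences -/

section Character

variable {C : Type u} [Category.{v} C] [MonoidalCategory C]

/-- A half-braiding on an object isomorphic to `𝟙`, as a family of automorphisms. -/
def unitAut {X : C} (b : HalfBraiding X) (i : X ≅ 𝟙_ C) (Y : C) : Y ≅ Y :=
  (λ_ Y).symm ≪≫ whiskerRightIso i.symm Y ≪≫ b.β Y ≪≫ whiskerLeftIso Y i ≪≫ ρ_ Y

theorem unitAut_hom {X : C} (b : HalfBraiding X) (i : X ≅ 𝟙_ C) (Y : C) :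
    (unitAut b i Y).hom =
      (λ_ Y).inv ≫ i.inv ▷ Y ≫ (b.β Y).hom ≫ Y ◁ i.hom ≫ (ρ_ Y).hom := rfl

theorem unitAut_naturality {X : C} (b : HalfBraiding X) (i : X ≅ 𝟙_ C) {Y Y' : C} (f : Y ⟶ Y') :
    f ≫ (unitAut b i Y').hom = (unitAut b i Y).hom ≫ f := by
  simp only [unitAut_hom, Category.assoc, ← rightUnitor_naturality]
  rw [leftUnitor_inv_naturality_assoc, whisker_exchange_assoc, b.naturality_assoc,
    whisker_exchange_assoc]

theorem unitAut_tensor {X : C} (b : HalfBraiding X) (i : X ≅ 𝟙_ C) (Y Y' : C) :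
    (unitAut b i (Y ⊗ Y')).hom = (unitAut b i Y).hom ▷ Y' ≫ Y ◁ (unitAut b i Y').hom := by
  simp only [unitAut_hom]
  symm
  calc
    _ = 𝟙 _ ⊗≫ i.inv ▷ Y ▷ Y' ⊗≫ (b.β Y).hom ▷ Y' ⊗≫ Y ◁ (i.hom ≫ i.inv) ▷ Y' ⊗≫
        Y ◁ (b.β Y').hom ⊗≫ Y ◁ Y' ◁ i.hom ⊗≫ 𝟙 _ := by monoidal
    _ = _ := by rw [i.hom_inv_id, b.monoidal]; monoidal

variable [Abelian C] [Linear ℂ C] [MonoidalPreadditive C] [MonoidalLinear ℂ C] [RigidCategory C]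
  [IsFusion C]

theorem exists_smul_id_eq {S : C} [Simple S] (f : S ⟶ S) : ∃ c : ℂ, c • 𝟙 S = f :=
  haveI := IsFiniteSemisimple.finite_hom S S
  endomorphism_simple_eq_smul_id ℂ f

/-- Every half-braiding on the unit object comes from a character of `U(C)`: by Schur's lemma it is
a scalar on each simple object, and these scalars form a grading. -/
theorem exists_isCharacterBraiding (Z : Center C) (i : Z.1 ≅ 𝟙_ C) :
    ∃ χ : UniversalGradingGroup C →* ℂˣ, IsCharacterBraiding χ Z := by
  have h (S : {S : C // Simple S}) : ∃ c : ℂˣ, (unitAut Z.2 i S.1).hom = (c : ℂ) • 𝟙 S.1 := by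
    have := S.2
    obtain ⟨c, hc⟩ := exists_smul_id_eq (unitAut Z.2 i S.1).hom
    have h0 : c ≠ 0 := by
      rintro rfl
      rw [zero_smul] at hc
      exact id_nonzero S.1 (by rw [← (unitAut Z.2 i S.1).hom_inv_id, ← hc, zero_comp])
    exact ⟨Units.mk0 c h0, hc.symm⟩
  choose d hd using h
  have hg : IsGrading d := fun S T R f hf => by
    have h1 := unitAut_naturality Z.2 i f
    rw [unitAut_tensor, hd, hd, hd] at h1
    simp only [MonoidalLinear.smul_whiskerRight, MonoidalLinear.whiskerLeft_smul,
      Linear.comp_smul, Linear.smul_comp, id_whiskerRight, whiskerLeft_id, Category.comp_id,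
      Category.id_comp, smul_smul] at h1
    have h2 := smul_left_injective ℂ hf h1
    exact Units.ext (by rw [← h2, Units.val_mul, mul_comm])
  obtain ⟨χ, hχ, -⟩ := (univDeg_universal d).1 hg
  refine ⟨χ, i, fun S hS => ?_⟩
  have h1 : (χ (univDeg S) : ℂ) • 𝟙 S = (unitAut Z.2 i S).hom :=
    (hd ⟨S, hS⟩).symm ▸ congrArg (fun c : ℂˣ => (c : ℂ) • 𝟙 S) (hχ ⟨S, hS⟩)
  have h2 : (Z.2.β S).hom = i.hom ▷ S ≫ (λ_ S).hom ≫ (unitAut Z.2 i S).hom ≫ (ρ_ S).inv ≫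
      S ◁ i.inv := by
    simp [unitAut_hom]
  rw [h2, ← h1]
  simp

theorem charCenter_one : Nonempty (charCenter (1 : UniversalGradingGroup C →* ℂˣ) ≅ 𝟙_ _) :=
  nonempty_center_iso_iff.2 ⟨Iso.refl (𝟙_ C), fun U => by
    change 𝟙 (𝟙_ C) ▷ U ≫ (λ_ U).hom ≫ (ρ_ U).inv =
      ((λ_ U).hom ≫ charEnd 1 U ≫ (ρ_ U).inv) ≫ U ◁ 𝟙 (𝟙_ C)
    rw [charEnd_one]
    simp⟩

theorem charCenter_mul (χ χ' : UniversalGradingGroup C →* ℂˣ) :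
    Nonempty (charCenter (χ * χ') ≅ charCenter χ ⊗ charCenter χ') :=
  nonempty_center_iso_iff.2 ⟨(λ_ (𝟙_ C)).symm, fun U => by
    have h : χ * χ' = χ' * χ := mul_comm χ χ'
    change (λ_ (𝟙_ C)).inv ▷ U ≫ (α_ (𝟙_ C) (𝟙_ C) U).hom ≫
        𝟙_ C ◁ ((λ_ U).hom ≫ charEnd χ' U ≫ (ρ_ U).inv) ≫ (α_ (𝟙_ C) U (𝟙_ C)).inv ≫
        ((λ_ U).hom ≫ charEnd χ U ≫ (ρ_ U).inv) ▷ 𝟙_ C ≫ (α_ U (𝟙_ C) (𝟙_ C)).hom =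
      ((λ_ U).hom ≫ charEnd (χ * χ') U ≫ (ρ_ U).inv) ≫ U ◁ (λ_ (𝟙_ C)).inv
    rw [h, ← charEnd_comp]
    monoidal⟩

variable (C) in
/-- The homomorphism `Hom(U(C), ℂˣ) → Inv(Z(C))`. -/
def characterToInvCenter : (UniversalGradingGroup C →* ℂˣ) →* InvGroup (Center C) :=
  MonoidHom.toHomUnits
    { toFun := fun χ => toSkeleton (charCenter χ)
      map_one' := Quotient.sound charCenter_one
      map_mul' := fun χ χ' => by
        rw [← Skeleton.toSkeleton_tensorObj]
        exact Quotient.sound (charCenter_mul χ χ') }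

variable (C) in
/-- The homomorphism `Hom(U(C), ℂˣ) → π₁ BrPic(C)`. -/
def characterToPiOne : (UniversalGradingGroup C →* ℂˣ) →* PiOneBrPic C :=
  (PiOneBrPic.equivInvCenter C).symm.toMonoidHom.comp (characterToInvCenter C)

theorem equivInvCenter_characterToPiOne (χ : UniversalGradingGroup C →* ℂˣ) :
    PiOneBrPic.equivInvCenter C (characterToPiOne C χ) = characterToInvCenter C χ :=
  (PiOneBrPic.equivInvCenter C).apply_symm_apply _

theorem val_characterToInvCenter_eq_iff (χ : UniversalGradingGroup C →* ℂˣ) (Z : Center C) :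
    (characterToInvCenter C χ).val = toSkeleton Z ↔ IsCharacterBraiding χ Z := by
  rw [← nonempty_charCenter_iso_iff]
  exact ⟨Quotient.exact, fun h => Quotient.sound h⟩

theorem IsCharacterBraiding.unique {χ χ' : UniversalGradingGroup C →* ℂˣ} {Z : Center C}
    (h : IsCharacterBraiding χ Z) (h' : IsCharacterBraiding χ' Z) : χ = χ' := by
  obtain ⟨i, hi⟩ := h
  obtain ⟨j, hj⟩ := h'
  refine PresentedGroup.ext fun ⟨S, hS⟩ => Units.ext ?_
  change (χ (univDeg S) : ℂ) = χ' (univDeg S)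
  have := IsFusion.simple_unit (C := C)
  -- the two isomorphisms `Z ≅ 𝟙` differ by a scalar, which cancels
  obtain ⟨c, hc⟩ := exists_smul_id_eq (i.inv ≫ j.hom)
  have hc' : j.hom = c • i.hom := by
    rw [← cancel_epi i.inv, ← hc]
    simp
  have h1 : i.hom ▷ S ≫ (λ_ S).hom ≫ (ρ_ S).inv ≫ S ◁ i.inv =
      j.hom ▷ S ≫ (λ_ S).hom ≫ (ρ_ S).inv ≫ S ◁ j.inv := by
    rw [← cancel_mono (S ◁ j.hom)]
    simp only [Category.assoc, ← MonoidalCategory.whiskerLeft_comp, ← hc, Iso.inv_hom_id]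
    rw [hc']
    simp
  have h2 := hi S
  rw [hj S, ← h1] at h2
  refine (smul_left_injective ℂ ?_ h2).symm
  intro h0
  refine id_nonzero S ?_
  have h3 : 𝟙 S = (λ_ S).inv ≫ i.inv ▷ S ≫ (i.hom ▷ S ≫ (λ_ S).hom ≫ (ρ_ S).inv ≫ S ◁ i.inv) ≫
      S ◁ i.hom ≫ (ρ_ S).hom := by simp
  rw [h3, h0]
  simp

theorem characterToPiOne_injective : Function.Injective (characterToPiOne C) := by
  intro χ χ' h
  have h1 := congrArg (PiOneBrPic.equivInvCenter C) h
  rw [equivInvCenter_characterToPiOne, equivInvCenter_characterToPiOne] at h1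
  exact ((val_characterToInvCenter_eq_iff χ (charCenter χ)).1 rfl).unique
    ((val_characterToInvCenter_eq_iff χ' (charCenter χ)).1 (congrArg Units.val h1).symm)

/-- A bimodule autoequivalence comes from a character if and only if it maps `𝟙` to an object
isomorphic to `𝟙`. -/
theorem characterToPiOne_mulExact : Function.MulExact (characterToPiOne C)
    ((forgetInv C).comp (PiOneBrPic.toInvCenter C)) := by
  rintro ⟨φ⟩
  constructor
  · intro h
    obtain ⟨i⟩ : Nonempty (φ.onC.obj (𝟙_ C) ≅ 𝟙_ C) :=
      Quotient.exact ((val_forgetInv_toInvCenter_mk φ).symm.trans (congrArg Units.val h))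
    obtain ⟨χ, hχ⟩ := exists_isCharacterBraiding φ.centerObj i
    refine ⟨χ, (PiOneBrPic.equivInvCenter C).injective ?_⟩
    rw [equivInvCenter_characterToPiOne]
    exact Units.ext ((val_characterToInvCenter_eq_iff _ _).2 hχ)
  · rintro ⟨χ, h⟩
    have h1 := congrArg (PiOneBrPic.equivInvCenter C) h
    rw [equivInvCenter_characterToPiOne] at h1
    obtain ⟨i, -⟩ := (val_characterToInvCenter_eq_iff χ φ.centerObj).1 (congrArg Units.val h1)
    exact Units.ext ((val_forgetInv_toInvCenter_mk φ).trans (Quotient.sound ⟨i⟩))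

end Character

end

end FusionLES

/-- For a fusion category `C`, the exact sequence
`1 → Hom(U(C), ℂˣ) → π₁ BrPic(C) → Inv(C) → Eq(C) → Out(C) → 1`, where
`π₁ BrPic(C) ≅ Inv(Z(C)) → Inv(C)` forgets the half-braiding. -/
theorem mainTheorem2 (C : Type u) [Category.{v} C] [Abelian C] [Linear ℂ C] [MonoidalCategory C]
    [MonoidalPreadditive C] [MonoidalLinear ℂ C] [RigidCategory C] [IsFusion C] :
    ∃ _ : Group (Out C),
      (∀ M N P : OuterBimod C,
        Out.mk M * Out.mk N = Out.mk P ↔ IsRelTensor M.1 N.1 P.1) ∧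
      ∃ (e : PiOneBrPic C ≃* InvGroup (Center C))
        (ι : (UniversalGradingGroup C →* ℂˣ) →* PiOneBrPic C)
        (δ : PiOneBrPic C →* InvGroup C)
        (F : InvGroup C →* EqGroup C)
        (M : EqGroup C →* Out C),
        (∀ (φ : BimodAut (regular C)) (Z : Center C),
          (e (BimodAutGroup.mk φ) : Skeleton (Center C)) = toSkeleton Z ↔ φ.CorrespondsTo Z) ∧
        (∀ (χ : UniversalGradingGroup C →* ℂˣ) (Z : Center C),
          (e (ι χ) : Skeleton (Center C)) = toSkeleton Z ↔ IsCharacterBraiding χ Z) ∧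
        (∀ x : PiOneBrPic C, δ x = forgetInv C (e x)) ∧
        (∀ (g : C) (hg : IsInvertibleObj g),
          F (InvGroup.mk g hg) = EqGroup.mk (innerAut g hg)) ∧
        (∀ (G : TensorAut C) (P : OuterBimod C),
          M (EqGroup.mk G) = Out.mk P ↔ (twisted G).Equivalent P.1) ∧
        Function.Injective ι ∧
        Function.MulExact ι δ ∧
        Function.MulExact δ F ∧
        Function.MulExact F M ∧
        Function.Surjective M := by
  refine ⟨inferInstance, Out.mk_mul_mk_eq_iff, PiOneBrPic.equivInvCenter C,
    characterToPiOne C, (forgetInv C).comp (PiOneBrPic.toInvCenter C), InvGroup.toEq C,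
    EqGroup.toOutHom C, PiOneBrPic.val_toInvCenter_mk_eq_iff, fun χ Z => ?_, fun x => rfl,
    InvGroup.toEq_mk, fun G P => ?_, characterToPiOne_injective, characterToPiOne_mulExact,
    forgetInv_mulExact_toEq, InvGroup.toEq_mulExact_toOutHom, EqGroup.toOut_surjective C⟩
  · rw [equivInvCenter_characterToPiOne, val_characterToInvCenter_eq_iff]
  · rw [twisted_equivalent_iff]
    exact EqGroup.toOut_mk_eq_iff
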